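/- Let $s\in(1/2,1)$. There is a constant $c_s>0$ depending only on $s$ such that the following holds for all $n\ge 2$ and all bounded, uniformly continuous $u_0:\mathbb R^n\to\mathbb R$. **Notation.** $\|f\|:=\sup_x|f(x)|$; $\omega_{u_0}(r):=\sup_{|y|\le r}\|u_0(\cdot+y)-u_0\|$; $C_s:=4^s s\,\Gamma(\frac12+s)/(\pi^{1/2}\Gamma(1-s))$. A standard mollifier is a smooth $\rho\ge0$ on $\mathbb R^n$ supported in the closed unit ball with $\int\rho=1$; $\rho_\delta(y):=\delta^{-n}\rho(y/\delta)$ and $u_{0,\delta}:=u_0*\rho_\delta$. For $\phi$ bounded, and $C^2$ near $x$, if $\nabla\phi(x)\ne0$, put $$\Delta^s_\infty\phi(x):=C_s\int_0^\infty\frac{\phi(x+\eta\zeta)+\phi(x-\eta\zeta)-2\phi(x)}{\eta^{1+2s}}\,d\eta,\qquad \zeta:=\frac{\nabla\phi(x)}{|\nabla\phi(x)|},$$ and let $\Delta^{s,+}_\infty\phi(x)$ and $\Delta^{s,-}_\infty\phi(x)$ be $C_s\sup_{|y|=1}$ and $C_s\inf_{|y|=1}$ of $\int_0^\infty(\phi(x+\eta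 y)+\phi(x-\eta y)-2\phi(x))\eta^{-1-2s}\,d\eta$. For $\varepsilon>0$ put $$\mathcal L_\varepsilon[\phi](x):=C_s\sup_{|y|=1}\inf_{|\tilde y|=1}\int_\varepsilon^\infty\frac{\phi(x+\eta y)+\phi(x-\eta\tilde y)-2\phi(x)}{\eta^{1+2s}}\,d\eta.$$ **Viscosity solutions.** A bounded upper semicontinuous $u$ on $\mathbb R^n\times(0,\infty)$ is a subsolution of $\partial_tu=\Delta^s_\infty u$ if, whenever $t_0>0$, $R>0$, $B$ is the part in $\mathbb R^n\times(0,\infty)$ of the open ball $B_R(x_0,t_0)$ of $\mathbb R^{n+1}$, and $\phi$ is bounded on $\mathbb R^n\times(0,\infty)$, $C^2$ in $B$ and uniformly continuous on $(\mathbb R^n\times(0,\infty))\setminus B$, such that $u-\phi$ has a global maximum at $(x_0,t_0)$ that is strict within $B$, then at $(x_0,t_0)$: $\partial_t\phi\le\Delta^s_\infty\phi$ if $\nabla\phi\ne0$, and $\partial_t\phi\le\Delta^{s,+}_\infty\phi$ if $\nabla\phi=0$. Supersolutions are defined symmetrically (lower semicontinuous, minimum, reversed inequalities, $\Delta^{s,-}_\infty$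 in place of $\Delta^{s,+}_\infty$). A viscosity solution with initial value $u_0$ is a $u\in C_b(\mathbb R^n\times[0,\infty))$ that is a sub- and a supersolution and satisfies $u(x,0)=u_0(x)$ for all $x$. **Scheme.** For $\varepsilon,\tau>0$ with $\tau\le\frac{s}{C_s}\varepsilon^{2s}$ let $U^0=u_0$, $U^{j+1}=U^j+\tau\mathcal L_\varepsilon[U^j]$, and let $u_{\varepsilon,\tau}$ be the piecewise linear interpolation in time of $(U^j)$ with nodes $t_j=j\tau$. **Theorem.** For all sequences $\varepsilon_k\to0$, $\tau_k$ with $\varepsilon_k,\tau_k>0$ and $\tau_k\le\frac{s}{C_s}\varepsilon_k^{2s}$, there is a subsequence along which $u_{\varepsilon_k,\tau_k}$ converges locally uniformly on $\mathbb R^n\times[0,\infty)$ to a viscosity solution $u$ with initial value $u_0$ (in particular a viscosity solution exists), and: (a) $\|u(\cdot,t)\|\le\|u_0\|$ for all $t>0$; (b) $\|u(\cdot+y,t)-u(\cdot,t)\|\le\omega_{u_0}(|y|)$ for all $y\in\mathbb R^n$, $t>0$; (c) for every standard mollifier $\rho$, with $C:=c_s\|u_0\|\,\|\nabla\rho\|_{L^1}^{2-2s}\|D^2\rho\|_{L^1}^{2s-1}$,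 the quantity $\sup_{\varepsilon>0}\|\mathcal L_\varepsilon[u_{0,\delta}]\|$ is finite for every $\delta>0$; for all $t,\tilde t>0$ $$\|u(\cdot,t)-u(\cdot,\tilde t)\|\le\tilde\omega(|t-\tilde t|),\qquad \tilde\omega(r):=\inf_{\delta>0}\Big\{2\omega_{u_0}(\delta)+r\sup_{\varepsilon>0}\|\mathcal L_\varepsilon[u_{0,\delta}]\|\Big\};$$ $\tilde\omega$ is a modulus of continuity (nonnegative, nondecreasing on $[0,\infty)$, tending to $0$ at $0^+$) with $\tilde\omega(r)\le2\omega_{u_0}(r^{1/3})+C(r^{1/3}+r)$ for $r\ge0$; and moreover, for all $t,\tilde t>0$, $$\|u(\cdot,t)-u(\cdot,\tilde t)\|\le\omega_{u_0}(|t-\tilde t|^{1/3})+C\big(|t-\tilde t|^{1/3}+|t-\tilde t|\big).$$ -/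

import Mathlib

open Set Filter Topology MeasureTheory

noncomputable section

namespace InfFracLap

/-- The space `ℝⁿ` with its Euclidean norm. -/
abbrev Space (n : ℕ) : Type := EuclideanSpace ℝ (Fin n)

/-- The unit sphere of `ℝⁿ`, over which the directions range. -/
abbrev Dir (n : ℕ) : Type := Metric.sphere (0 : Space n) 1

/-- The normalizing constant `C_s = 4^s s Γ(1/2 + s) / (π^{1/2} Γ(1 - s))`. -/
def Cs (s : ℝ) : ℝ :=
  (4 : ℝ) ^ s * s * Real.Gamma (1 / 2 + s) / (Real.sqrt Real.pi * Real.Gamma (1 - s))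

/-- The supremum norm `sup_x |f x|`; it is only used for bounded functions. -/
def supNorm {n : ℕ} (f : Space n → ℝ) : ℝ := ⨆ x, |f x|

/-- Bounded and uniformly continuous functions on `ℝⁿ`. -/
def IsBUC {n : ℕ} (f : Space n → ℝ) : Prop :=
  (∃ M, ∀ x, |f x| ≤ M) ∧ UniformContinuous f

/-- `ω_f(r) = sup_{|y| ≤ r} ‖f(· + y) - f‖`. -/
def modCont {n : ℕ} (f : Space n → ℝ) (r : ℝ) : ℝ :=
  ⨆ y : Metric.closedBall (0 : Space n) r, supNorm (fun x => f (x + (y : Space n)) - f x)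

/-- A modulus of continuity: a nonnegative, nondecreasing function on `[0, ∞)` that tends to
`0` at `0+`. -/
def IsModulus (ω : ℝ → ℝ) : Prop :=
  (∀ r, 0 ≤ r → 0 ≤ ω r) ∧ MonotoneOn ω (Ici 0) ∧ Tendsto ω (𝓝[>] 0) (𝓝 0)

/-! ### The operators -/

/-- The infinity fractional Laplacian: the one-dimensional fractional Laplacian along the
gradient direction if the gradient does not vanish, and a supremum plus an infimum of one-sided
integrals over all directions otherwise. -/
def infLap {n : ℕ} (s : ℝ) (φ : Space n → ℝ) (x : Space n) : ℝ :=
  open Classical in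
  if gradient φ x ≠ 0 then
    Cs s * ∫ η in Ioi (0 : ℝ),
      (φ (x + η • (‖gradient φ x‖⁻¹ • gradient φ x))
        + φ (x - η • (‖gradient φ x‖⁻¹ • gradient φ x)) - 2 * φ x) / η ^ (1 + 2 * s)
  else
    Cs s * (⨆ y : Dir n, ∫ η in Ioi (0 : ℝ),
        (φ (x + η • (y : Space n)) - φ x) / η ^ (1 + 2 * s))
      + Cs s * (⨅ y : Dir n, ∫ η in Ioi (0 : ℝ),
        (φ (x - η • (y : Space n)) - φ x) / η ^ (1 + 2 * s))

/-- The upper operator, `C_s` times the supremum over all directions of the two-sided integral. -/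
def infLapSup {n : ℕ} (s : ℝ) (φ : Space n → ℝ) (x : Space n) : ℝ :=
  Cs s * ⨆ y : Dir n, ∫ η in Ioi (0 : ℝ),
    (φ (x + η • (y : Space n)) + φ (x - η • (y : Space n)) - 2 * φ x) / η ^ (1 + 2 * s)

/-- The lower operator, `C_s` times the infimum over all directions of the two-sided integral. -/
def infLapInf {n : ℕ} (s : ℝ) (φ : Space n → ℝ) (x : Space n) : ℝ :=
  Cs s * ⨅ y : Dir n, ∫ η in Ioi (0 : ℝ),
    (φ (x + η • (y : Space n)) + φ (x - η • (y : Space n)) - 2 * φ x) / η ^ (1 + 2 * s)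

/-- The truncated operator `ℒ_ε`, in which the integral runs over `(ε, ∞)`. -/
def truncLap {n : ℕ} (s ε : ℝ) (φ : Space n → ℝ) (x : Space n) : ℝ :=
  Cs s * ⨆ y : Dir n, ⨅ z : Dir n, ∫ η in Ioi ε,
    (φ (x + η • (y : Space n)) + φ (x - η • (z : Space n)) - 2 * φ x) / η ^ (1 + 2 * s)

/-! ### Viscosity solutions -/

/-- The domain `ℝⁿ × (0, ∞)`. -/
def posTime (n : ℕ) : Set (Space n × ℝ) := {p | 0 < p.2}

/-- The part in `ℝⁿ × (0, ∞)` of the open Euclidean ball of `ℝⁿ × ℝ` with centre `(x₀, t₀)` and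
radius `R`. -/
def stBall {n : ℕ} (x₀ : Space n) (t₀ R : ℝ) : Set (Space n × ℝ) :=
  {p | 0 < p.2 ∧ ‖p.1 - x₀‖ ^ 2 + (p.2 - t₀) ^ 2 < R ^ 2}

/-- Test functions at `(x₀, t₀)` with radius `R`: of class `C²` in the ball, uniformly continuous
on its complement, and bounded, so that the nonlocal operators apply. -/
def IsTest {n : ℕ} (x₀ : Space n) (t₀ R : ℝ) (φ : Space n → ℝ → ℝ) : Prop :=
  ContDiffOn ℝ 2 (fun p : Space n × ℝ => φ p.1 p.2) (stBall x₀ t₀ R) ∧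
  UniformContinuousOn (fun p : Space n × ℝ => φ p.1 p.2) (posTime n \ stBall x₀ t₀ R) ∧
  ∃ M, ∀ x t, 0 < t → |φ x t| ≤ M

/-- Viscosity subsolutions of `∂ₜ u = Δ_∞^s u` in `ℝⁿ × (0, ∞)`. The function `u - φ` has a global
maximum at `(x₀, t₀)`, which is strict in the ball (in particular it is the supremum there). -/
def IsViscSub {n : ℕ} (s : ℝ) (u : Space n → ℝ → ℝ) : Prop :=
  (∃ M, ∀ x t, 0 < t → |u x t| ≤ M) ∧
  UpperSemicontinuousOn (fun p : Space n × ℝ => u p.1 p.2) (posTime n) ∧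
  ∀ (x₀ : Space n) (t₀ R : ℝ) (φ : Space n → ℝ → ℝ), 0 < t₀ → 0 < R → IsTest x₀ t₀ R φ →
    (∀ x t, (x, t) ∈ stBall x₀ t₀ R → (x, t) ≠ (x₀, t₀) →
      u x t - φ x t < u x₀ t₀ - φ x₀ t₀) →
    (∀ x t, (x, t) ∈ posTime n \ stBall x₀ t₀ R →
      u x t - φ x t ≤ u x₀ t₀ - φ x₀ t₀) →
    (gradient (fun x => φ x t₀) x₀ ≠ 0 →
      deriv (fun t => φ x₀ t) t₀ ≤ infLap s (fun x => φ x t₀) x₀) ∧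
    (gradient (fun x => φ x t₀) x₀ = 0 →
      deriv (fun t => φ x₀ t) t₀ ≤ infLapSup s (fun x => φ x t₀) x₀)

/-- Viscosity supersolutions of `∂ₜ u = Δ_∞^s u` in `ℝⁿ × (0, ∞)`. -/
def IsViscSuper {n : ℕ} (s : ℝ) (u : Space n → ℝ → ℝ) : Prop :=
  (∃ M, ∀ x t, 0 < t → |u x t| ≤ M) ∧
  LowerSemicontinuousOn (fun p : Space n × ℝ => u p.1 p.2) (posTime n) ∧
  ∀ (x₀ : Space n) (t₀ R : ℝ) (φ : Space n → ℝ → ℝ), 0 < t₀ → 0 < R → IsTest x₀ t₀ R φ →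
    (∀ x t, (x, t) ∈ stBall x₀ t₀ R → (x, t) ≠ (x₀, t₀) →
      u x₀ t₀ - φ x₀ t₀ < u x t - φ x t) →
    (∀ x t, (x, t) ∈ posTime n \ stBall x₀ t₀ R →
      u x₀ t₀ - φ x₀ t₀ ≤ u x t - φ x t) →
    (gradient (fun x => φ x t₀) x₀ ≠ 0 →
      infLap s (fun x => φ x t₀) x₀ ≤ deriv (fun t => φ x₀ t) t₀) ∧
    (gradient (fun x => φ x t₀) x₀ = 0 →
      infLapInf s (fun x => φ x t₀) x₀ ≤ deriv (fun t => φ x₀ t) t₀)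

/-- Bounded continuous functions on `ℝⁿ × [0, ∞)` (values at negative times play no role). -/
def IsCb {n : ℕ} (u : Space n → ℝ → ℝ) : Prop :=
  ContinuousOn (fun p : Space n × ℝ => u p.1 p.2) (univ ×ˢ Ici 0) ∧
  ∃ M, ∀ x t, 0 ≤ t → |u x t| ≤ M

/-- Viscosity solutions of the Cauchy problem with initial value `u₀`, taken pointwise. -/
def IsViscSol {n : ℕ} (s : ℝ) (u₀ : Space n → ℝ) (u : Space n → ℝ → ℝ) : Prop :=
  IsCb u ∧ IsViscSub s u ∧ IsViscSuper s u ∧ ∀ x, u x 0 = u₀ x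

/-! ### The semi-discrete scheme -/

/-- The explicit scheme `U^{j+1} = U^j + τ ℒ_ε[U^j]`, `U^0 = u₀`. -/
def schemeStep {n : ℕ} (s ε τ : ℝ) (u₀ : Space n → ℝ) : ℕ → Space n → ℝ
  | 0 => u₀
  | j + 1 => fun x =>
      schemeStep s ε τ u₀ j x + τ * truncLap s ε (schemeStep s ε τ u₀ j) x

/-- The piecewise linear interpolation in time of the scheme, with nodes `t_j = j τ`. -/
def schemeInterp {n : ℕ} (s ε τ : ℝ) (u₀ : Space n → ℝ) (x : Space n) (t : ℝ) : ℝ :=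
  (⌊t / τ⌋₊ + 1 - t / τ) * schemeStep s ε τ u₀ ⌊t / τ⌋₊ x
    + (t / τ - ⌊t / τ⌋₊) * schemeStep s ε τ u₀ (⌊t / τ⌋₊ + 1) x

/-- The discretization parameters are positive and satisfy the stability condition
`τ ≤ (s / C_s) ε^{2s}`. -/
def IsCFL (s ε τ : ℝ) : Prop := 0 < ε ∧ 0 < τ ∧ τ ≤ s / Cs s * ε ^ (2 * s)

/-! ### Mollification and the modulus in time -/

/-- Standard mollifiers: smooth, nonnegative, supported in the closed unit ball, of mass one. -/
structure IsMollifier {n : ℕ} (ρ : Space n → ℝ) : Prop where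
  smooth : ContDiff ℝ (⊤ : ℕ∞) ρ
  nonneg : ∀ x, 0 ≤ ρ x
  supp : ∀ x, 1 < ‖x‖ → ρ x = 0
  mass : ∫ x, ρ x = 1

/-- The mollification `f_δ = f ∗ ρ_δ`, where `ρ_δ(y) = δ^{-n} ρ(y / δ)`. -/
def mollify {n : ℕ} (ρ : Space n → ℝ) (δ : ℝ) (f : Space n → ℝ) (x : Space n) : ℝ :=
  ∫ y, f (x - y) * ((δ ^ n)⁻¹ * ρ (δ⁻¹ • y))

/-- `inf_{δ > 0} (2 ω_{u₀}(δ) + r sup_{ε > 0} ‖ℒ_ε[u_{0,δ}]‖)`. -/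
def timeMod {n : ℕ} (s : ℝ) (ρ : Space n → ℝ) (u₀ : Space n → ℝ) (r : ℝ) : ℝ :=
  ⨅ δ : Ioi (0 : ℝ), (2 * modCont u₀ δ
    + r * ⨆ ε : Ioi (0 : ℝ), supNorm (truncLap s ε (mollify ρ δ u₀)))

/-- `c ‖u₀‖ ‖∇ρ‖_{L¹}^{2-2s} ‖D²ρ‖_{L¹}^{2s-1}`. -/
def timeConst {n : ℕ} (c s : ℝ) (ρ : Space n → ℝ) (u₀ : Space n → ℝ) : ℝ :=
  c * supNorm u₀ * (∫ x, ‖gradient ρ x‖) ^ (2 - 2 * s)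
    * (∫ x, ‖iteratedFDeriv ℝ 2 ρ x‖) ^ (2 * s - 1)

end InfFracLap

end

open Set Filter Topology MeasureTheory InfFracLap

open Set Filter Topology MeasureTheory

noncomputable section

namespace InfFracLap

/-! The proof is a Barles–Souganidis argument: stability, compactness, and consistency of a monotone
scheme.

Stability. For `ε > 0` the integral in `ℒ_ε` splits into rays, so `ℒ_ε[φ](x)` is `C_s` times the
supremum plus the infimum of the ray integrals minus `ε^{-2s}/s · φ(x)` (`RayBdd.truncLap_eq`). The
stability condition makes the coefficient of `φ(x)` in an Euler step nonnegative. The step is then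
monotone and commutes with constants, hence is a contraction in the sup norm
(`abs_eulerStep_sub_le`). With translation invariance this preserves the bound and the spatial
modulus. Applied to consecutive iterates it gives `‖ℒ_ε[U^j]‖ ≤ ‖ℒ_ε[U^0]‖`, a Lipschitz bound in
time for regular data (`abs_schemeInterp_time_le_aux`).

Modulus in time. Replacing `u₀` by a mollification costs twice the distance between the data. The
mollification has finite `ℒ_ε`, uniformly in `ε`: second differences control the integral up to a
radius `ℓ`, first differences beyond it, and balancing `ℓ` gives the powers `2 - 2s` and `2s - 1`
(`abs_truncLap_mollify_le`). The choice `δ = r^{1/3}` gives the explicit bound. For the sharper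
bound with coefficient `1` the midrange of `u₀` on balls of radius `δ/2` is mollified at scale
`δ/2`: it stays within half of `ω_{u₀}(δ)` of `u₀`, and halving the scale only multiplies the
constant by at most `4`.

Limit. Equicontinuity yields a locally uniformly convergent subsequence. If `u - φ` has a strict
maximum, then the scheme minus `φ` has a nearby maximum on a compact ball, and the last Euler step
can be compared with `φ` (`exists_touching`). The supremum is nearly attained by `φ` in some
direction `y`; the infimum is at most its value at `-y`; together they form the two-sided integral
along `y`. As `ε → 0` the directions accumulate at some `y₀`. Since `2s > 1`, the first order term
along rays has divergent weight, so `y₀` maximizes the directional derivative and is the gradient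
direction if `∇φ ≠ 0` (`fderiv_sub_nonneg`, `test_consistency`). If `∇φ = 0`, nothing is known about
`y₀`, which is why the supremum over directions appears. Supersolutions follow by `u ↦ -u`, because
`ℒ_ε` is odd. -/

theorem Cs_pos {s : ℝ} (hs : 0 < s) (hs' : s < 1) : 0 < Cs s := by
  unfold Cs
  have h1 : 0 < Real.Gamma (1 / 2 + s) := Real.Gamma_pos_of_pos (by linarith)
  have h2 : 0 < Real.Gamma (1 - s) := Real.Gamma_pos_of_pos (by linarith)
  have h3 : 0 < Real.sqrt Real.pi := Real.sqrt_pos.2 Real.pi_pos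
  have h4 : (0 : ℝ) < 4 ^ s := Real.rpow_pos_of_pos (by norm_num) s
  positivity

theorem dir_nonempty {n : ℕ} (hn : 2 ≤ n) : Nonempty (Dir n) := by
  have : Nonempty (Fin n) := ⟨⟨0, by omega⟩⟩
  have : Nontrivial (Space n) := inferInstance
  exact (NormedSpace.sphere_nonempty.2 zero_le_one).to_subtype

/-! ### The supremum norm -/

section supNorm
variable {n : ℕ} {f : Space n → ℝ} {M : ℝ}

theorem supNorm_le (h : ∀ x, |f x| ≤ M) : supNorm f ≤ M := ciSup_le h

theorem abs_le_supNorm (h : ∀ x, |f x| ≤ M) (x : Space n) : |f x| ≤ supNorm f :=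
  le_ciSup (f := fun x => |f x|) ⟨M, by rintro _ ⟨x, rfl⟩; exact h x⟩ x

theorem supNorm_nonneg (f : Space n → ℝ) : 0 ≤ supNorm f :=
  Real.iSup_nonneg fun _ => abs_nonneg _

theorem supNorm_diff_le (h : ∀ x, |f x| ≤ M) (y : Space n) :
    supNorm (fun x => f (x + y) - f x) ≤ 2 * M :=
  supNorm_le fun x => (abs_sub _ _).trans (by linarith [h (x + y), h x])

theorem abs_diff_le_supNorm (h : ∀ x, |f x| ≤ M) (x y : Space n) :
    |f (x + y) - f x| ≤ supNorm (fun x => f (x + y) - f x) :=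
  abs_le_supNorm (f := fun x => f (x + y) - f x) (M := 2 * M)
    (fun x => (abs_sub _ _).trans (by linarith [h (x + y), h x])) x

theorem modCont_bddAbove (h : ∀ x, |f x| ≤ M) (r : ℝ) :
    BddAbove (range fun y : Metric.closedBall (0 : Space n) r =>
      supNorm (fun x => f (x + (y : Space n)) - f x)) :=
  ⟨2 * M, by rintro _ ⟨y, rfl⟩; exact supNorm_diff_le h y⟩

theorem modCont_nonneg (f : Space n → ℝ) (r : ℝ) : 0 ≤ modCont f r :=
  Real.iSup_nonneg fun _ => supNorm_nonneg _

theorem supNorm_diff_le_modCont (h : ∀ x, |f x| ≤ M) {y : Space n} {r : ℝ} (hy : ‖y‖ ≤ r) :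
    supNorm (fun x => f (x + y) - f x) ≤ modCont f r :=
  le_ciSup (modCont_bddAbove h r) (⟨y, by simpa using hy⟩ : Metric.closedBall (0 : Space n) r)

theorem abs_sub_le_modCont (h : ∀ x, |f x| ≤ M) {x y : Space n} {r : ℝ} (hy : ‖x - y‖ ≤ r) :
    |f x - f y| ≤ modCont f r := by
  have := (abs_diff_le_supNorm h y (x - y)).trans (supNorm_diff_le_modCont h hy)
  simpa using this

/-- The condition `0 ≤ a` covers `r < 0`, where the ball is empty and the supremum takes the default
value `0`. -/
theorem modCont_le {r a : ℝ} (ha : 0 ≤ a) (h : ∀ y : Space n, ‖y‖ ≤ r → ∀ x, |f (x + y) - f x| ≤ a) :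
    modCont f r ≤ a :=
  Real.iSup_le (fun y => supNorm_le (h y (mem_closedBall_zero_iff.1 y.2))) ha

theorem modCont_tendsto (hf : UniformContinuous f) :
    ∀ η > 0, ∃ δ > 0, ∀ r ≤ δ, modCont f r ≤ η := by
  intro η hη
  obtain ⟨δ, hδ, h⟩ := Metric.uniformContinuous_iff.1 hf η hη
  refine ⟨δ / 2, by positivity, fun r hr => modCont_le hη.le fun y hy x => ?_⟩
  have := @h (x + y) x (by rw [dist_eq_norm]; simp; linarith)
  rw [Real.dist_eq] at this
  exact this.le

end supNorm

/-! ### Ray integrals -/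

theorem weight_eq {s : ℝ} {η : ℝ} (hη : 0 < η) (a : ℝ) :
    a / η ^ (1 + 2 * s) = a * η ^ (-(1 + 2 * s)) := by
  rw [Real.rpow_neg hη.le, div_eq_mul_inv]

theorem weight_integrable {s ε : ℝ} (hs : 0 < s) (hε : 0 < ε) (c : ℝ) :
    IntegrableOn (fun η : ℝ => c / η ^ (1 + 2 * s)) (Ioi ε) := by
  have : IntegrableOn (fun η : ℝ => c * η ^ (-(1 + 2 * s))) (Ioi ε) :=
    (integrableOn_Ioi_rpow_of_lt (by linarith) hε).const_mul c
  exact this.congr_fun (fun η hη => (weight_eq (hε.trans hη) c).symm) measurableSet_Ioi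

theorem weight_integral {s ε : ℝ} (hs : 0 < s) (hε : 0 < ε) (c : ℝ) :
    ∫ η in Ioi ε, c / η ^ (1 + 2 * s) = c * (ε ^ (-(2 * s)) / (2 * s)) := by
  rw [setIntegral_congr_fun measurableSet_Ioi
    (fun η hη => weight_eq (s := s) (hε.trans hη) c), integral_const_mul,
    integral_Ioi_rpow_of_lt (by linarith) hε]
  congr 1
  rw [show -(1 + 2 * s) + 1 = -(2 * s) by ring, neg_div_neg_eq]

theorem weight_integrable_of_bound {s ε : ℝ} (hs : 0 < s) (hε : 0 < ε) {g : ℝ → ℝ} {M : ℝ}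
    (hg : Measurable g) (hM : ∀ η, |g η| ≤ M) :
    IntegrableOn (fun η : ℝ => g η / η ^ (1 + 2 * s)) (Ioi ε) := by
  refine (weight_integrable hs hε M).mono'
    (hg.div (by fun_prop : Measurable fun η : ℝ => η ^ (1 + 2 * s))).aestronglyMeasurable
    ((ae_restrict_iff' measurableSet_Ioi).2 (Eventually.of_forall fun η hη => ?_))
  have : 0 < η ^ (1 + 2 * s) := Real.rpow_pos_of_pos (hε.trans hη) _
  rw [Real.norm_eq_abs, abs_div, abs_of_pos this]
  exact div_le_div_of_nonneg_right (hM η) this.le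

/-- The weighted integral of `φ` along the ray from `x` in direction `y`, truncated at `ε`. -/
def rayInt {n : ℕ} (s ε : ℝ) (φ : Space n → ℝ) (x y : Space n) : ℝ :=
  ∫ η in Ioi ε, φ (x + η • y) / η ^ (1 + 2 * s)

/-- `φ` is bounded by `M` and measurable along all lines through `x`. -/
structure RayBdd {n : ℕ} (φ : Space n → ℝ) (M : ℝ) (x : Space n) : Prop where
  bound : ∀ z, |φ z| ≤ M
  meas : ∀ y : Space n, Measurable fun η : ℝ => φ (x + η • y)

section ray
variable {n : ℕ} {s ε M N : ℝ} {φ ψ : Space n → ℝ} {x : Space n}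

theorem RayBdd.of_continuous (h : Continuous φ) (hM : ∀ z, |φ z| ≤ M) : RayBdd φ M x :=
  ⟨hM, fun y => (h.comp (by fun_prop : Continuous fun η : ℝ => x + η • y)).measurable⟩

theorem RayBdd.integrable (h : RayBdd φ M x) (hs : 0 < s) (hε : 0 < ε) (y : Space n) :
    IntegrableOn (fun η : ℝ => φ (x + η • y) / η ^ (1 + 2 * s)) (Ioi ε) :=
  weight_integrable_of_bound hs hε (h.meas y) fun _ => h.bound _

theorem RayBdd.rayInt_le (hφ : RayBdd φ M x) (hψ : RayBdd ψ N x) (hs : 0 < s) (hε : 0 < ε)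
    {e : ℝ → ℝ} (he : IntegrableOn (fun η : ℝ => e η / η ^ (1 + 2 * s)) (Ioi ε)) {y : Space n}
    (h : ∀ η, ε < η → φ (x + η • y) ≤ ψ (x + η • y) + e η) :
    rayInt s ε φ x y ≤ rayInt s ε ψ x y + ∫ η in Ioi ε, e η / η ^ (1 + 2 * s) := by
  unfold rayInt
  rw [← integral_add (hψ.integrable hs hε y) he]
  refine setIntegral_mono_on (hφ.integrable hs hε y) ((hψ.integrable hs hε y).add he)
    measurableSet_Ioi fun η hη => ?_
  have : 0 < η ^ (1 + 2 * s) := Real.rpow_pos_of_pos (hε.trans hη) _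
  change _ ≤ _ / _ + _ / _
  rw [← add_div]
  exact div_le_div_of_nonneg_right (h η hη) this.le

theorem RayBdd.abs_rayInt_le (h : RayBdd φ M x) (hs : 0 < s) (hε : 0 < ε) (y : Space n) :
    |rayInt s ε φ x y| ≤ M * (ε ^ (-(2 * s)) / (2 * s)) := by
  unfold rayInt
  rw [← weight_integral hs hε, ← Real.norm_eq_abs]
  refine norm_integral_le_of_norm_le (weight_integrable hs hε M)
    ((ae_restrict_iff' measurableSet_Ioi).2 (Eventually.of_forall fun η hη => ?_))
  have : 0 < η ^ (1 + 2 * s) := Real.rpow_pos_of_pos (hε.trans hη) _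
  rw [Real.norm_eq_abs, abs_div, abs_of_pos this]
  exact div_le_div_of_nonneg_right (h.bound _) this.le

theorem RayBdd.bddAbove (h : RayBdd φ M x) (hs : 0 < s) (hε : 0 < ε) :
    BddAbove (range fun y : Dir n => rayInt s ε φ x y) :=
  ⟨_, by rintro _ ⟨y, rfl⟩; exact (le_abs_self _).trans (h.abs_rayInt_le hs hε y)⟩

theorem RayBdd.bddBelow (h : RayBdd φ M x) (hs : 0 < s) (hε : 0 < ε) :
    BddBelow (range fun y : Dir n => rayInt s ε φ x y) :=
  ⟨_, by rintro _ ⟨y, rfl⟩; exact neg_le_of_abs_le (h.abs_rayInt_le hs hε y)⟩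

theorem RayBdd.sym_integral (h : RayBdd φ M x) (hs : 0 < s) (hε : 0 < ε) (y z : Space n) :
    ∫ η in Ioi ε, (φ (x + η • y) + φ (x - η • z) - 2 * φ x) / η ^ (1 + 2 * s)
      = rayInt s ε φ x y + rayInt s ε φ x (-z) - ε ^ (-(2 * s)) / s * φ x := by
  have e : ∀ η : ℝ, (φ (x + η • y) + φ (x - η • z) - 2 * φ x) / η ^ (1 + 2 * s)
      = φ (x + η • y) / η ^ (1 + 2 * s) + φ (x + η • (-z)) / η ^ (1 + 2 * s)
        - 2 * φ x / η ^ (1 + 2 * s) := fun η => by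
    rw [smul_neg, ← sub_eq_add_neg, sub_div, add_div]
  simp_rw [e]
  rw [integral_sub, integral_add (h.integrable hs hε y) (h.integrable hs hε (-z)),
    weight_integral hs hε]
  unfold rayInt
  · congr 1
    field_simp
  · exact (h.integrable hs hε y).add (h.integrable hs hε (-z))
  · exact weight_integrable hs hε _

variable [Nonempty (Dir n)]

/-- The directions `y` and `z` enter different summands, so the supremum and the infimum decouple;
the antipodal map of the sphere removes the sign of `z`. -/
theorem RayBdd.truncLap_eq (h : RayBdd φ M x) (hs : 0 < s) (hε : 0 < ε) :
    truncLap s ε φ x = Cs s * ((⨆ y : Dir n, rayInt s ε φ x y) + (⨅ y : Dir n, rayInt s ε φ x y)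
      - ε ^ (-(2 * s)) / s * φ x) := by
  unfold truncLap
  simp_rw [h.sym_integral hs hε]
  have hneg : (⨅ z : Dir n, rayInt s ε φ x (-(z : Space n))) = ⨅ y : Dir n, rayInt s ε φ x y := by
    have := (neg_involutive (G := Dir n)).surjective.iInf_comp
      (fun y : Dir n => rayInt s ε φ x y)
    simpa using this
  have hb : BddBelow (range fun z : Dir n => rayInt s ε φ x (-(z : Space n))) :=
    ⟨_, by rintro _ ⟨y, rfl⟩; exact neg_le_of_abs_le (h.abs_rayInt_le hs hε _)⟩
  have e1 : ∀ y : Dir n, (⨅ z : Dir n, (rayInt s ε φ x y + rayInt s ε φ x (-(z : Space n))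
      - ε ^ (-(2 * s)) / s * φ x)) = rayInt s ε φ x y + ((⨅ y : Dir n, rayInt s ε φ x y)
      - ε ^ (-(2 * s)) / s * φ x) := fun y => by
    rw [← hneg]
    simp_rw [add_sub_assoc, sub_eq_add_neg]
    rw [ciInf_add hb, add_ciInf]
    obtain ⟨B, hB⟩ := hb
    exact ⟨B + -(ε ^ (-(2 * s)) / s * φ x), by
      rintro _ ⟨z, rfl⟩
      have := hB ⟨z, rfl⟩
      simp only at this ⊢
      linarith⟩
  simp_rw [e1]
  rw [← ciSup_add (h.bddAbove hs hε), add_sub_assoc]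

end ray

/-! ### One step of the scheme -/

/-- One explicit time step of size `τ`. -/
def eulerStep {n : ℕ} (s ε τ : ℝ) (V : Space n → ℝ) (x : Space n) : ℝ :=
  V x + τ * truncLap s ε V x

theorem schemeStep_succ {n : ℕ} (s ε τ : ℝ) (u₀ : Space n → ℝ) (j : ℕ) :
    schemeStep s ε τ u₀ (j + 1) = eulerStep s ε τ (schemeStep s ε τ u₀ j) := rfl

/-- No boundedness is needed: the real infimum is by definition minus the supremum of the negatives,
so the default values agree. -/
theorem real_iSup_neg {ι : Sort*} (f : ι → ℝ) : (⨆ i, -f i) = -⨅ i, f i := by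
  rw [iInf, Real.sInf_def, neg_neg, iSup]
  congr 1
  ext a
  simp [neg_eq_iff_eq_neg]

theorem truncLap_neg {n : ℕ} [Nonempty (Dir n)] {s ε M : ℝ} {φ : Space n → ℝ} {x : Space n}
    (h : RayBdd φ M x) (hs : 0 < s) (hε : 0 < ε) :
    truncLap s ε (fun z => -φ z) x = -truncLap s ε φ x := by
  have h' : RayBdd (fun z => -φ z) M x := ⟨fun z => by simpa using h.bound z,
    fun y => (h.meas y).neg⟩
  have e : ∀ y, rayInt s ε (fun z => -φ z) x y = -rayInt s ε φ x y := fun y => by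
    unfold rayInt
    simp_rw [neg_div]
    exact integral_neg _
  rw [h'.truncLap_eq hs hε, h.truncLap_eq hs hε]
  simp_rw [e]
  have e1 : (⨆ y : Dir n, -rayInt s ε φ x y) = -⨅ y : Dir n, rayInt s ε φ x y :=
    real_iSup_neg _
  have e2 : (⨅ y : Dir n, -rayInt s ε φ x y) = -⨆ y : Dir n, rayInt s ε φ x y := by
    rw [eq_neg_iff_add_eq_zero, add_comm, ← eq_neg_iff_add_eq_zero, ← real_iSup_neg]
    simp
  rw [e1, e2]
  ring

theorem truncLap_translate {n : ℕ} (s ε : ℝ) (φ : Space n → ℝ) (x h : Space n) :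
    truncLap s ε (fun z => φ (z + h)) x = truncLap s ε φ (x + h) := by
  unfold truncLap
  have e1 : ∀ η : ℝ, ∀ y : Space n, x + η • y + h = x + h + η • y := fun η y => by abel
  have e2 : ∀ η : ℝ, ∀ y : Space n, x - η • y + h = x + h - η • y := fun η y => by abel
  simp_rw [e1, e2]

section euler
variable {n : ℕ} [Nonempty (Dir n)] {s ε τ M N : ℝ} {φ ψ : Space n → ℝ} {x : Space n}

theorem RayBdd.eulerStep_eq (h : RayBdd φ M x) (hs : 0 < s) (hε : 0 < ε) :
    eulerStep s ε τ φ x = (1 - τ * Cs s * (ε ^ (-(2 * s)) / s)) * φ x +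
      τ * Cs s * ((⨆ y : Dir n, rayInt s ε φ x y) + (⨅ y : Dir n, rayInt s ε φ x y)) := by
  rw [eulerStep, h.truncLap_eq hs hε]
  ring

/-- This is exactly the nonnegativity of the coefficient of `φ x` in `RayBdd.eulerStep_eq`. -/
theorem cfl_le (hs : 0 < s) (hs' : s < 1) (hε : 0 < ε) (hτ : τ ≤ s / Cs s * ε ^ (2 * s)) :
    τ * Cs s * (ε ^ (-(2 * s)) / s) ≤ 1 := by
  have hC := Cs_pos hs hs'
  have hp : 0 < ε ^ (2 * s) := Real.rpow_pos_of_pos hε _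
  calc τ * Cs s * (ε ^ (-(2 * s)) / s)
      ≤ s / Cs s * ε ^ (2 * s) * Cs s * (ε ^ (-(2 * s)) / s) := by
        gcongr
    _ = 1 := by
        rw [Real.rpow_neg hε.le]
        field_simp

/-- Every term of the step is nondecreasing in the values of the function. A constant `c` passes
through unchanged, since the two extremal rays return the `2 c w` that the diagonal coefficient
removes. -/
theorem eulerStep_le (hφ : RayBdd φ M x) (hψ : RayBdd ψ N x) (hs : 0 < s) (hs' : s < 1)
    (hε : 0 < ε) (hτ₀ : 0 ≤ τ) (hτ : τ ≤ s / Cs s * ε ^ (2 * s)) {c : ℝ}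
    (h : ∀ z, φ z ≤ ψ z + c) : eulerStep s ε τ φ x ≤ eulerStep s ε τ ψ x + c := by
  rw [hφ.eulerStep_eq hs hε, hψ.eulerStep_eq hs hε]
  have hC := Cs_pos hs hs'
  have h1 := cfl_le hs hs' hε hτ
  set w := ε ^ (-(2 * s)) / (2 * s) with hw
  have hw2 : ε ^ (-(2 * s)) / s = 2 * w := by rw [hw]; field_simp
  have hray : ∀ y : Dir n, rayInt s ε φ x y ≤ rayInt s ε ψ x y + c * w := fun y => by
    have := hφ.rayInt_le hψ hs hε (weight_integrable hs hε c) (y := y) fun η _ => h _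
    rwa [weight_integral hs hε] at this
  have hsup : (⨆ y : Dir n, rayInt s ε φ x y) ≤ (⨆ y : Dir n, rayInt s ε ψ x y) + c * w :=
    ciSup_le fun y => (hray y).trans (by gcongr; exact le_ciSup (hψ.bddAbove hs hε) y)
  have hinf : (⨅ y : Dir n, rayInt s ε φ x y) - c * w ≤ (⨅ y : Dir n, rayInt s ε ψ x y) :=
    le_ciInf fun y => by
      have := ciInf_le (hφ.bddBelow hs hε) y
      linarith [hray y]
  rw [hw2] at h1 ⊢
  have h2 : (1 - τ * Cs s * (2 * w)) * φ x ≤ (1 - τ * Cs s * (2 * w)) * (ψ x + c) :=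
    mul_le_mul_of_nonneg_left (h x) (by linarith)
  have h3 := mul_le_mul_of_nonneg_left (add_le_add hsup (sub_le_iff_le_add.1 hinf))
    (by positivity : 0 ≤ τ * Cs s)
  nlinarith

theorem abs_eulerStep_sub_le (hφ : RayBdd φ M x) (hψ : RayBdd ψ N x) (hs : 0 < s) (hs' : s < 1)
    (hε : 0 < ε) (hτ₀ : 0 ≤ τ) (hτ : τ ≤ s / Cs s * ε ^ (2 * s)) {c : ℝ}
    (h : ∀ z, |φ z - ψ z| ≤ c) : |eulerStep s ε τ φ x - eulerStep s ε τ ψ x| ≤ c := by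
  have h1 := eulerStep_le hφ hψ hs hs' hε hτ₀ hτ (c := c) fun z => by
    linarith [le_of_abs_le (h z)]
  have h2 := eulerStep_le hψ hφ hs hs' hε hτ₀ hτ (c := c) fun z => by
    linarith [neg_le_of_abs_le (h z)]
  exact abs_le.2 ⟨by linarith, by linarith⟩

theorem abs_eulerStep_le (hφ : RayBdd φ M x) (hs : 0 < s) (hs' : s < 1)
    (hε : 0 < ε) (hτ₀ : 0 ≤ τ) (hτ : τ ≤ s / Cs s * ε ^ (2 * s)) :
    |eulerStep s ε τ φ x| ≤ M := by
  have h0 : RayBdd (fun _ : Space n => (0 : ℝ)) 0 x := .of_continuous continuous_const (by simp)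
  have := abs_eulerStep_sub_le hφ h0 hs hs' hε hτ₀ hτ (c := M) (by simpa using hφ.bound)
  have e : eulerStep s ε τ (fun _ : Space n => (0 : ℝ)) x = 0 := by
    simp [eulerStep, truncLap]
  simpa [e] using this

end euler

section scheme
variable {n : ℕ} {s ε τ M : ℝ} {u v : Space n → ℝ}

/-- Transfers continuity from `u` to anything built from it by a translation-invariant contraction;
used for the iterates and for `midrange`. -/
theorem uniformContinuous_of_diff (hu : UniformContinuous u)
    (h : ∀ y c, (∀ x, |u (x + y) - u x| ≤ c) → ∀ x, |v (x + y) - v x| ≤ c) :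
    UniformContinuous v := by
  rw [Metric.uniformContinuous_iff]
  intro e he
  obtain ⟨δ, hδ, hd⟩ := Metric.uniformContinuous_iff.1 hu (e / 2) (by positivity)
  refine ⟨δ, hδ, fun a b hab => ?_⟩
  have := h (a - b) (e / 2) (fun x => by
    have := @hd (x + (a - b)) x (by simpa [dist_eq_norm] using hab)
    rw [Real.dist_eq] at this
    exact this.le) b
  rw [Real.dist_eq]
  rw [add_sub_cancel] at this
  linarith

/-! ### The interpolation in time -/

/-- Linear interpolation is a shortened Euler step from the preceding node. A shorter step still
satisfies the stability condition, so every estimate for steps holds at all times. -/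
theorem schemeInterp_eq (hτ : 0 < τ) (t : ℝ) (x : Space n) :
    schemeInterp s ε τ u x t
      = eulerStep s ε (t - ⌊t / τ⌋₊ * τ) (schemeStep s ε τ u ⌊t / τ⌋₊) x := by
  simp only [schemeInterp, schemeStep, eulerStep]
  field_simp
  ring

theorem schemeInterp_node (hτ : 0 < τ) (j : ℕ) (x : Space n) :
    schemeInterp s ε τ u x (j * τ) = schemeStep s ε τ u j x := by
  rw [schemeInterp, mul_div_cancel_right₀ _ hτ.ne', Nat.floor_natCast]
  simp

theorem floor_mul_le (hτ : 0 < τ) {t : ℝ} (ht : 0 ≤ t) : ⌊t / τ⌋₊ * τ ≤ t := by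
  rw [← le_div_iff₀ hτ]
  exact Nat.floor_le (by positivity)

theorem lt_floor_add_one_mul (hτ : 0 < τ) (t : ℝ) : t < (⌊t / τ⌋₊ + 1) * τ := by
  rw [← div_lt_iff₀ hτ]
  exact Nat.lt_floor_add_one _

theorem schemeInterp_zero (hτ : 0 < τ) (x : Space n) : schemeInterp s ε τ u x 0 = u x := by
  have := schemeInterp_node (s := s) (ε := ε) (u := u) hτ 0 x
  simpa [schemeStep] using this

/-- Every positive time is reached by a last step of positive length at most `τ`. -/
theorem exists_last_step (hτ : 0 < τ) {t : ℝ} (ht : 0 < t) :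
    ∃ j : ℕ, j * τ < t ∧ t ≤ (j + 1) * τ ∧ ∀ x : Space n, schemeInterp s ε τ u x t
      = eulerStep s ε (t - j * τ) (schemeStep s ε τ u j) x := by
  rcases (floor_mul_le hτ ht.le).lt_or_eq with h | h
  · exact ⟨_, h, (lt_floor_add_one_mul hτ t).le, fun x => schemeInterp_eq hτ t x⟩
  -- At a node the floor would give a step of length zero, so the preceding node and a full step are
  -- taken.
  · obtain ⟨j, hj⟩ : ∃ j, ⌊t / τ⌋₊ = j + 1 := Nat.exists_eq_succ_of_ne_zero fun h0 => by
      rw [h0] at h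
      simp at h
      exact ht.ne h
    rw [hj] at h
    push_cast at h
    refine ⟨j, by nlinarith, h.ge, fun x => ?_⟩
    have h1 : t - j * τ = τ := by linarith
    rw [h1, ← schemeStep_succ, ← schemeInterp_node hτ]
    push_cast
    rw [h]

/-! ### Properties of the scheme -/

variable [Nonempty (Dir n)]

/-- Both properties go through one induction: the second supplies the continuity that makes the ray
integrals of the next step meaningful. -/
theorem schemeStep_regular (hs : 0 < s) (hs' : s < 1) (hc : IsCFL s ε τ)
    (hu : UniformContinuous u) (hM : ∀ x, |u x| ≤ M) (j : ℕ) :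
    (∀ x, |schemeStep s ε τ u j x| ≤ M) ∧ (∀ y c, (∀ x, |u (x + y) - u x| ≤ c) →
      ∀ x, |schemeStep s ε τ u j (x + y) - schemeStep s ε τ u j x| ≤ c) := by
  obtain ⟨hε, hτ, hcfl⟩ := hc
  induction j with
  | zero => exact ⟨hM, fun y c h => h⟩
  | succ j ih =>
    have hcont := (uniformContinuous_of_diff hu ih.2).continuous
    refine ⟨fun x => abs_eulerStep_le (.of_continuous hcont ih.1) hs hs' hε hτ.le hcfl,
      fun y c h x => ?_⟩
    have h1 : eulerStep s ε τ (schemeStep s ε τ u j) (x + y)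
        = eulerStep s ε τ (fun z => schemeStep s ε τ u j (z + y)) x := by
      simp only [eulerStep, truncLap_translate]
    rw [schemeStep_succ, h1]
    exact abs_eulerStep_sub_le (M := M) (N := M)
      (.of_continuous (hcont.comp (continuous_add_const y)) fun z => ih.1 _)
      (.of_continuous hcont ih.1) hs hs' hε hτ.le hcfl (ih.2 y c h)

theorem schemeStep_continuous (hs : 0 < s) (hs' : s < 1) (hc : IsCFL s ε τ)
    (hu : IsBUC u) (j : ℕ) : Continuous (schemeStep s ε τ u j) := by
  obtain ⟨⟨M, hM⟩, hu⟩ := hu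
  exact (uniformContinuous_of_diff hu (schemeStep_regular hs hs' hc hu hM j).2).continuous

theorem abs_schemeStep_le (hs : 0 < s) (hs' : s < 1) (hc : IsCFL s ε τ)
    (hu : IsBUC u) (hM : ∀ x, |u x| ≤ M) (j : ℕ) (x : Space n) :
    |schemeStep s ε τ u j x| ≤ M :=
  (schemeStep_regular hs hs' hc hu.2 hM j).1 x

theorem RayBdd.schemeStep (hs : 0 < s) (hs' : s < 1) (hc : IsCFL s ε τ)
    (hu : IsBUC u) (hM : ∀ x, |u x| ≤ M) (j : ℕ) (x : Space n) :
    RayBdd (schemeStep s ε τ u j) M x :=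
  .of_continuous (schemeStep_continuous hs hs' hc hu j) (abs_schemeStep_le hs hs' hc hu hM j)

theorem abs_schemeStep_sub_le (hs : 0 < s) (hs' : s < 1) (hc : IsCFL s ε τ)
    (hu : IsBUC u) (hv : IsBUC v) {c : ℝ} (h : ∀ x, |u x - v x| ≤ c) (j : ℕ) (x : Space n) :
    |schemeStep s ε τ u j x - schemeStep s ε τ v j x| ≤ c := by
  obtain ⟨M, hM⟩ := hu.1
  obtain ⟨N, hN⟩ := hv.1
  induction j generalizing x with
  | zero => exact h x
  | succ j ih =>
    exact abs_eulerStep_sub_le (.schemeStep hs hs' hc hu hM j x) (.schemeStep hs hs' hc hv hN j x)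
      hs hs' hc.1 hc.2.1.le hc.2.2 ih

/-- The increment `U^{j+1} - U^j` equals `τ ℒ_ε[U^j]`, and a contraction applied to two consecutive
iterates does not enlarge it. -/
theorem abs_truncLap_schemeStep_le (hs : 0 < s) (hs' : s < 1) (hc : IsCFL s ε τ)
    (hu : IsBUC u) {K : ℝ} (hK : ∀ x, |truncLap s ε u x| ≤ K) (j : ℕ) (x : Space n) :
    |truncLap s ε (schemeStep s ε τ u j) x| ≤ K := by
  obtain ⟨M, hM⟩ := hu.1
  have hτ := hc.2.1
  have e : ∀ j x, schemeStep s ε τ u (j + 1) x - schemeStep s ε τ u j x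
      = τ * truncLap s ε (schemeStep s ε τ u j) x := fun j x => by
    simp [schemeStep]
  induction j generalizing x with
  | zero => exact hK x
  | succ j ih =>
    have h1 : ∀ z, |schemeStep s ε τ u (j + 1) z - schemeStep s ε τ u j z| ≤ τ * K := fun z => by
      rw [e, abs_mul, abs_of_pos hτ]
      exact mul_le_mul_of_nonneg_left (ih z) hτ.le
    have h2 := abs_eulerStep_sub_le (.schemeStep hs hs' hc hu hM (j + 1) x)
      (.schemeStep hs hs' hc hu hM j x) hs hs' hc.1 hc.2.1.le hc.2.2 h1
    rw [← schemeStep_succ, ← schemeStep_succ, e, abs_mul, abs_of_pos hτ] at h2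
    exact le_of_mul_le_mul_left h2 hτ

theorem schemeStep_neg (hs : 0 < s) (hs' : s < 1) (hc : IsCFL s ε τ) (hu : IsBUC u) (j : ℕ) :
    schemeStep s ε τ (fun x => -u x) j = fun x => -schemeStep s ε τ u j x := by
  obtain ⟨M, hM⟩ := hu.1
  induction j with
  | zero => rfl
  | succ j ih =>
    funext x
    rw [schemeStep_succ, ih, eulerStep,
      truncLap_neg (.schemeStep hs hs' hc hu hM j x) hs hc.1, schemeStep_succ, eulerStep]
    ring

theorem abs_schemeInterp_le (hs : 0 < s) (hs' : s < 1) (hc : IsCFL s ε τ)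
    (hu : IsBUC u) (hM : ∀ x, |u x| ≤ M) {t : ℝ} (ht : 0 ≤ t) (x : Space n) :
    |schemeInterp s ε τ u x t| ≤ M := by
  rw [schemeInterp_eq hc.2.1]
  have h1 := floor_mul_le hc.2.1 ht
  have h2 := lt_floor_add_one_mul hc.2.1 t
  exact abs_eulerStep_le (.schemeStep hs hs' hc hu hM _ x) hs hs' hc.1 (by linarith)
    (le_trans (by linarith) hc.2.2)

theorem abs_schemeInterp_translate_le (hs : 0 < s) (hs' : s < 1) (hc : IsCFL s ε τ)
    (hu : IsBUC u) {t : ℝ} (ht : 0 ≤ t) {y : Space n} {c : ℝ}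
    (h : ∀ x, |u (x + y) - u x| ≤ c) (x : Space n) :
    |schemeInterp s ε τ u (x + y) t - schemeInterp s ε τ u x t| ≤ c := by
  obtain ⟨M, hM⟩ := hu.1
  rw [schemeInterp_eq hc.2.1, schemeInterp_eq hc.2.1]
  have h1 := floor_mul_le hc.2.1 ht
  have h2 := lt_floor_add_one_mul hc.2.1 t
  set j := ⌊t / τ⌋₊
  have e : eulerStep s ε (t - j * τ) (schemeStep s ε τ u j) (x + y)
      = eulerStep s ε (t - j * τ) (fun z => schemeStep s ε τ u j (z + y)) x := by
    simp only [eulerStep, truncLap_translate]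
  rw [e]
  exact abs_eulerStep_sub_le (M := M) (N := M)
    (.of_continuous ((schemeStep_continuous hs hs' hc hu j).comp (continuous_add_const y))
      fun z => abs_schemeStep_le hs hs' hc hu hM j _) (.schemeStep hs hs' hc hu hM _ x)
    hs hs' hc.1 (by linarith) (le_trans (by linarith) hc.2.2)
    ((schemeStep_regular hs hs' hc hu.2 hM j).2 y c h)

theorem abs_schemeInterp_sub_le (hs : 0 < s) (hs' : s < 1) (hc : IsCFL s ε τ)
    (hu : IsBUC u) (hv : IsBUC v) {c : ℝ} (h : ∀ x, |u x - v x| ≤ c) {t : ℝ} (ht : 0 ≤ t)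
    (x : Space n) :
    |schemeInterp s ε τ u x t - schemeInterp s ε τ v x t| ≤ c := by
  obtain ⟨M, hM⟩ := hu.1
  obtain ⟨N, hN⟩ := hv.1
  rw [schemeInterp_eq hc.2.1, schemeInterp_eq hc.2.1]
  have h1 := floor_mul_le hc.2.1 ht
  have h2 := lt_floor_add_one_mul hc.2.1 t
  exact abs_eulerStep_sub_le (.schemeStep hs hs' hc hu hM _ x) (.schemeStep hs hs' hc hv hN _ x)
    hs hs' hc.1 (by linarith) (le_trans (by linarith) hc.2.2)
    (abs_schemeStep_sub_le hs hs' hc hu hv h _)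

theorem abs_schemeInterp_time_le_aux (hs : 0 < s) (hs' : s < 1) (hc : IsCFL s ε τ)
    (hu : IsBUC u) {K : ℝ} (hK : ∀ x, |truncLap s ε u x| ≤ K) {t t' : ℝ} (ht : 0 ≤ t)
    (htt : t ≤ t') (x : Space n) :
    |schemeInterp s ε τ u x t' - schemeInterp s ε τ u x t| ≤ K * (t' - t) := by
  have hτ := hc.2.1
  have hK' := fun j => abs_le.1 (abs_truncLap_schemeStep_le hs hs' hc hu hK j x)
  have hsteps : ∀ i k : ℕ, |schemeStep s ε τ u (i + k) x - schemeStep s ε τ u i x|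
      ≤ k * τ * K := fun i k => by
    induction k with
    | zero => simp
    | succ k ih =>
      have := hK' (i + k)
      rw [← add_assoc, schemeStep, abs_le] at *
      push_cast
      constructor <;> nlinarith
  rw [schemeInterp_eq hτ, schemeInterp_eq hτ]
  have h1 := floor_mul_le hτ ht
  have h2 := lt_floor_add_one_mul hτ t
  have h1' := floor_mul_le hτ (ht.trans htt)
  have hle : ⌊t / τ⌋₊ ≤ ⌊t' / τ⌋₊ := Nat.floor_mono (by gcongr)
  generalize ⌊t / τ⌋₊ = i at *
  generalize ⌊t' / τ⌋₊ = j at *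
  simp only [eulerStep]
  rcases hle.eq_or_lt with rfl | hlt
  · have e : schemeStep s ε τ u i x + (t' - i * τ) * truncLap s ε (schemeStep s ε τ u i) x -
        (schemeStep s ε τ u i x + (t - i * τ) * truncLap s ε (schemeStep s ε τ u i) x)
        = (t' - t) * truncLap s ε (schemeStep s ε τ u i) x := by ring
    rw [e, abs_mul, abs_of_nonneg (sub_nonneg.2 htt), mul_comm]
    exact mul_le_mul_of_nonneg_right (abs_le.2 (hK' i)) (sub_nonneg.2 htt)
  -- The times lie in different steps: the path goes from `t` up to the node `i + 1`, through `k`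
  -- full steps, and on to `t'`.
  · obtain ⟨k, rfl⟩ := Nat.exists_eq_add_of_lt hlt
    have h3 := abs_le.1 (hsteps (i + 1) k)
    rw [show i + 1 + k = i + k + 1 by ring] at h3
    have h4 := hK' i
    have h5 := hK' (i + k + 1)
    have e1 : schemeStep s ε τ u (i + 1) x
      = schemeStep s ε τ u i x + τ * truncLap s ε (schemeStep s ε τ u i) x := rfl
    push_cast at *
    generalize truncLap s ε (schemeStep s ε τ u (i + k + 1)) x = A at *
    generalize truncLap s ε (schemeStep s ε τ u i) x = B at *
    have p1 := mul_le_mul_of_nonneg_left h4.1 (by linarith : 0 ≤ (i + 1) * τ - t)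
    have p2 := mul_le_mul_of_nonneg_left h4.2 (by linarith : 0 ≤ (i + 1) * τ - t)
    have p3 := mul_le_mul_of_nonneg_left h5.1 (by linarith : 0 ≤ t' - (i + k + 1) * τ)
    have p4 := mul_le_mul_of_nonneg_left h5.2 (by linarith : 0 ≤ t' - (i + k + 1) * τ)
    rw [abs_le]
    constructor <;> linarith

theorem abs_schemeInterp_time_le (hs : 0 < s) (hs' : s < 1) (hc : IsCFL s ε τ)
    (hu : IsBUC u) (hv : IsBUC v) {c K : ℝ} (h : ∀ x, |u x - v x| ≤ c)
    (hK : ∀ x, |truncLap s ε v x| ≤ K) {t t' : ℝ} (ht : 0 ≤ t) (ht' : 0 ≤ t') (x : Space n) :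
    |schemeInterp s ε τ u x t - schemeInterp s ε τ u x t'| ≤ 2 * c + |t - t'| * K := by
  wlog htt : t' ≤ t generalizing t t'
  · rw [abs_sub_comm, abs_sub_comm t]
    exact this ht' ht (le_of_not_ge htt)
  have h1 := abs_le.1 (abs_schemeInterp_sub_le hs hs' hc hu hv h ht x)
  have h2 := abs_le.1 (abs_schemeInterp_sub_le hs hs' hc hu hv h ht' x)
  have h3 := abs_le.1 (abs_schemeInterp_time_le_aux hs hs' hc hv hK ht' htt x)
  rw [abs_of_nonneg (sub_nonneg.2 htt), abs_le]
  constructor <;> linarith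

theorem schemeInterp_neg (hs : 0 < s) (hs' : s < 1) (hc : IsCFL s ε τ) (hu : IsBUC u)
    (x : Space n) (t : ℝ) :
    schemeInterp s ε τ (fun x => -u x) x t = -schemeInterp s ε τ u x t := by
  simp only [schemeInterp, schemeStep_neg hs hs' hc hu]
  ring

end scheme

/-! ### Differences of compactly supported functions in `L¹` -/

section L1
variable {n : ℕ} {f : Space n → ℝ}

/-- The fundamental theorem of calculus on the segment from `w` to `w + h`, then Fubini and
translation invariance of the volume. -/
theorem integral_abs_diff_le (hf : ContDiff ℝ 1 f) (hc : HasCompactSupport f) (h : Space n) :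
    ∫ w, |f (w + h) - f w| ≤ ∫ w, |fderiv ℝ f w h| := by
  have hcont : Continuous fun w => fderiv ℝ f w h :=
    (hf.continuous_fderiv one_ne_zero).clm_apply continuous_const
  have hcs : HasCompactSupport fun w => fderiv ℝ f w h := hc.fderiv_apply ℝ h
  have hint : Integrable fun w => |fderiv ℝ f w h| :=
    (hcont.integrable_of_hasCompactSupport hcs).abs
  have hprod : Integrable (fun p : Space n × ℝ => |fderiv ℝ f (p.1 + p.2 • h) h|)
      (volume.prod (volume.restrict (Ioc 0 1))) := by
    rw [integrable_prod_iff' (by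
      have : Continuous fun p : Space n × ℝ => |fderiv ℝ f (p.1 + p.2 • h) h| :=
        (hcont.comp (by fun_prop : Continuous fun p : Space n × ℝ => p.1 + p.2 • h)).abs
      exact this.aestronglyMeasurable)]
    refine ⟨Eventually.of_forall fun t => hint.comp_add_right (t • h), ?_⟩
    have : ∀ t : ℝ, ∫ w, ‖|fderiv ℝ f (w + t • h) h|‖ = ∫ w, ‖|fderiv ℝ f w h|‖ := fun t =>
      integral_add_right_eq_self (fun w => ‖|fderiv ℝ f w h|‖) (t • h)
    simp only [this]
    exact integrable_const _
  have hpt : ∀ w, |f (w + h) - f w| ≤ ∫ t in Ioc (0 : ℝ) 1, |fderiv ℝ f (w + t • h) h| := by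
    intro w
    have hd : ∀ t ∈ uIcc (0 : ℝ) 1,
        HasDerivAt (fun t : ℝ => f (w + t • h)) (fderiv ℝ f (w + t • h) h) t := fun t _ => by
      have h1 : HasDerivAt (fun t : ℝ => w + t • h) h t := by
        simpa using ((hasDerivAt_id t).smul_const h).const_add w
      exact ((hf.differentiable one_ne_zero _).hasFDerivAt).comp_hasDerivAt t h1
    have hc1 : Continuous fun t : ℝ => fderiv ℝ f (w + t • h) h :=
      hcont.comp (by fun_prop : Continuous fun t : ℝ => w + t • h)
    have := intervalIntegral.integral_eq_sub_of_hasDerivAt hd (hc1.intervalIntegrable _ _)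
    simp only [one_smul, zero_smul, add_zero] at this
    rw [← this, intervalIntegral.integral_of_le zero_le_one]
    exact abs_integral_le_integral_abs
  calc ∫ w, |f (w + h) - f w|
      ≤ ∫ w, ∫ t in Ioc (0 : ℝ) 1, |fderiv ℝ f (w + t • h) h| := by
        refine integral_mono_of_nonneg (Eventually.of_forall fun w => abs_nonneg _)
          hprod.integral_prod_left (Eventually.of_forall hpt)
    _ = ∫ t in Ioc (0 : ℝ) 1, ∫ w, |fderiv ℝ f (w + t • h) h| := integral_integral_swap hprod
    _ = ∫ t in Ioc (0 : ℝ) 1, ∫ w, |fderiv ℝ f w h| := by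
        congr 1
        funext t
        exact integral_add_right_eq_self (fun w => |fderiv ℝ f w h|) (t • h)
    _ = ∫ w, |fderiv ℝ f w h| := by simp

theorem integral_abs_diff_le_norm (hf : ContDiff ℝ 1 f) (hc : HasCompactSupport f) (h : Space n) :
    ∫ w, |f (w + h) - f w| ≤ ‖h‖ * ∫ w, ‖gradient f w‖ := by
  refine (integral_abs_diff_le hf hc h).trans ?_
  rw [← integral_const_mul]
  have hcont : Continuous (fderiv ℝ f) := hf.continuous_fderiv one_ne_zero
  have e : ∀ w, ‖gradient f w‖ = ‖fderiv ℝ f w‖ := fun w => by simp [gradient]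
  simp_rw [e]
  refine integral_mono_of_nonneg (Eventually.of_forall fun w => abs_nonneg _)
    ((hcont.norm.integrable_of_hasCompactSupport (hc.fderiv ℝ).norm).const_mul _)
    (Eventually.of_forall fun w => ?_)
  simp only
  rw [mul_comm]
  exact (fderiv ℝ f w).le_opNorm h

theorem integral_abs_second_diff_le (hf : ContDiff ℝ 2 f) (hc : HasCompactSupport f)
    (h : Space n) :
    ∫ w, |f (w + h) + f (w - h) - 2 * f w| ≤ ‖h‖ ^ 2 * ∫ w, ‖iteratedFDeriv ℝ 2 f w‖ := by
  have hf1 : ContDiff ℝ 1 f := hf.of_le (by norm_num)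
  have hd1 : ContDiff ℝ 1 (fderiv ℝ f) := hf.fderiv_right (by norm_num)
  have hg : ContDiff ℝ 1 fun w => fderiv ℝ f w h := hd1.clm_apply contDiff_const
  have hgc : HasCompactSupport fun w => fderiv ℝ f w h := hc.fderiv_apply ℝ h
  have hct : HasCompactSupport fun w => f (w + h) := hc.comp_homeomorph (Homeomorph.addRight h)
  have hft : ContDiff ℝ 1 fun w => f (w + h) := hf1.comp (contDiff_id.add contDiff_const)
  -- Up to sign the second difference is the difference with step `-h` of `w ↦ f (w + h) - f w`; a
  -- second application, with step `h`, follows below.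
  have h2 := integral_abs_diff_le (hft.sub hf1) (hct.sub hc) (-h)
  have e1 : ∀ w, |f (w + -h + h) - f (w + -h) - (f (w + h) - f w)|
      = |f (w + h) + f (w - h) - 2 * f w| := fun w => by
    rw [← abs_neg, neg_add_cancel_right, ← sub_eq_add_neg]
    congr 1
    ring
  have e2 : ∀ w, |fderiv ℝ (fun w => f (w + h) - f w) w (-h)|
      = |fderiv ℝ f (w + h) h - fderiv ℝ f w h| := fun w => by
    rw [fderiv_fun_sub (hft.differentiable one_ne_zero w) (hf1.differentiable one_ne_zero w),
      fderiv_comp_add_right, map_neg, abs_neg]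
    rfl
  simp_rw [e1, e2] at h2
  refine h2.trans ((integral_abs_diff_le hg hgc h).trans ?_)
  rw [← integral_const_mul]
  have hI : Continuous fun w => ‖iteratedFDeriv ℝ 2 f w‖ :=
    (hf.continuous_iteratedFDeriv le_rfl).norm
  refine integral_mono_of_nonneg (Eventually.of_forall fun w => abs_nonneg _)
    ((hI.integrable_of_hasCompactSupport (hc.iteratedFDeriv 2).norm).const_mul _)
    (Eventually.of_forall fun w => ?_)
  have e3 : fderiv ℝ (fun w => fderiv ℝ f w h) w h = iteratedFDeriv ℝ 2 f w ![h, h] := by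
    rw [iteratedFDeriv_two_apply, fderiv_clm_apply (hd1.differentiable one_ne_zero w)
      (differentiableAt_const _)]
    simp
  simp only
  rw [e3, mul_comm]
  have := (iteratedFDeriv ℝ 2 f w).le_opNorm ![h, h]
  simpa [Fin.prod_univ_two, sq] using this

theorem IsMollifier.hasCompactSupport (hf : IsMollifier f) : HasCompactSupport f :=
  HasCompactSupport.of_support_subset_isCompact (isCompact_closedBall (0 : Space n) 1) fun x hx => by
    rw [mem_closedBall_zero_iff]
    by_contra h
    exact hx (hf.supp x (not_le.1 h))

theorem IsMollifier.contDiff_two (hf : IsMollifier f) : ContDiff ℝ 2 f := by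
  exact_mod_cast contDiff_infty.1 hf.smooth 2

/-- A mollifier with vanishing derivative would be constant, hence zero by its support, against mass
one. Positivity of this integral and of the Hessian one is needed for the balancing radius in
`abs_truncLap_mollify_le`. -/
theorem IsMollifier.integral_fderiv_pos (hf : IsMollifier f) (hn : Nonempty (Dir n)) :
    0 < ∫ x, ‖fderiv ℝ f x‖ := by
  have hcont : Continuous (fderiv ℝ f) := hf.smooth.continuous_fderiv (by simp)
  by_contra hle
  have h0 : ∫ x, ‖fderiv ℝ f x‖ = 0 :=
    le_antisymm (not_lt.1 hle) (integral_nonneg fun _ => norm_nonneg _)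
  rw [integral_eq_zero_iff_of_nonneg (fun _ => norm_nonneg _)
    (hcont.norm.integrable_of_hasCompactSupport (hf.hasCompactSupport.fderiv ℝ).norm)] at h0
  have h1 := hcont.norm.ae_eq_iff_eq volume (continuous_const (y := (0 : ℝ))) |>.1 h0
  have h2 : ∀ x, fderiv ℝ f x = 0 := fun x => norm_eq_zero.1 (congrFun h1 x)
  obtain ⟨e⟩ := hn
  have h3 : ∀ x, f x = 0 := fun x => by
    rw [is_const_of_fderiv_eq_zero (hf.smooth.differentiable (by simp)) h2 x ((2 : ℝ) • (e : Space n))]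
    refine hf.supp _ ?_
    rw [norm_smul, norm_eq_of_mem_sphere]
    norm_num
  have := hf.mass
  simp [h3] at this

theorem IsMollifier.integral_gradient_pos (hf : IsMollifier f) (hn : Nonempty (Dir n)) :
    0 < ∫ x, ‖gradient f x‖ := by
  have e : ∀ w, ‖gradient f w‖ = ‖fderiv ℝ f w‖ := fun w => by simp [gradient]
  simp_rw [e]
  exact hf.integral_fderiv_pos hn

theorem IsMollifier.integral_iteratedFDeriv_pos (hf : IsMollifier f) (hn : Nonempty (Dir n)) :
    0 < ∫ x, ‖iteratedFDeriv ℝ 2 f x‖ := by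
  have hcont : Continuous (iteratedFDeriv ℝ 2 f) :=
    hf.contDiff_two.continuous_iteratedFDeriv le_rfl
  by_contra hle
  have h0 : ∫ x, ‖iteratedFDeriv ℝ 2 f x‖ = 0 :=
    le_antisymm (not_lt.1 hle) (integral_nonneg fun _ => norm_nonneg _)
  rw [integral_eq_zero_iff_of_nonneg (fun _ => norm_nonneg _)
    (hcont.norm.integrable_of_hasCompactSupport (hf.hasCompactSupport.iteratedFDeriv 2).norm)] at h0
  have h1 := hcont.norm.ae_eq_iff_eq volume (continuous_const (y := (0 : ℝ))) |>.1 h0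
  have h2 : ∀ x, fderiv ℝ (fderiv ℝ f) x = 0 := fun x => by
    ext a b
    have := iteratedFDeriv_two_apply (𝕜 := ℝ) f x ![a, b]
    rw [norm_eq_zero.1 (congrFun h1 x)] at this
    simpa using this.symm
  have hd : Differentiable ℝ (fderiv ℝ f) :=
    (hf.contDiff_two.fderiv_right (m := 1) (by norm_num)).differentiable one_ne_zero
  have hc := is_const_of_fderiv_eq_zero hd h2
  have hz : ∀ x, fderiv ℝ f x = 0 := fun x => by
    obtain ⟨e⟩ := hn
    rw [hc x ((2 : ℝ) • (e : Space n))]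
    have hev : f =ᶠ[𝓝 ((2 : ℝ) • (e : Space n))] fun _ => 0 := by
      have : ∀ᶠ z in 𝓝 ((2 : ℝ) • (e : Space n)), 1 < ‖z‖ :=
        continuous_norm.continuousAt.eventually_const_lt (by
          change 1 < ‖(2 : ℝ) • (e : Space n)‖
          rw [norm_smul, norm_eq_of_mem_sphere]; norm_num)
      exact this.mono fun z hz => hf.supp z hz
    rw [hev.fderiv_eq]
    simp
  have := hf.integral_fderiv_pos hn
  simp [hz] at this

end L1

/-! ### Mollification -/

section mollify
variable {n : ℕ} {ρ f u : Space n → ℝ} {δ M : ℝ}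

theorem mollify_eq (ρ f : Space n → ℝ) (hδ : 0 < δ) (x : Space n) :
    mollify ρ δ f x = ∫ z, f (x - δ • z) * ρ z := by
  have h := Measure.integral_comp_smul (volume : Measure (Space n))
    (fun z => f (x - δ • z) * ρ z) δ⁻¹
  rw [finrank_euclideanSpace_fin, abs_of_pos (by positivity), inv_pow, inv_inv] at h
  unfold mollify
  have e : ∀ y : Space n, f (x - y) * ((δ ^ n)⁻¹ * ρ (δ⁻¹ • y))
      = (δ ^ n)⁻¹ * (f (x - δ • δ⁻¹ • y) * ρ (δ⁻¹ • y)) := fun y => by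
    rw [smul_inv_smul₀ hδ.ne']
    ring
  simp_rw [e]
  rw [integral_const_mul, h, smul_eq_mul, inv_mul_cancel_left₀ (by positivity)]

/-- The shift is moved to the kernel, so that differences of the mollification fall on `ρ` and only
the sup norm of `f` enters. -/
theorem mollify_add (ρ f : Space n → ℝ) (hδ : 0 < δ) (x h : Space n) :
    mollify ρ δ f (x + h) = ∫ z, f (x - δ • z) * ρ (z + δ⁻¹ • h) := by
  rw [mollify_eq ρ f hδ, ← integral_add_right_eq_self _ (δ⁻¹ • h)]
  congr 1
  funext z
  rw [smul_add, smul_inv_smul₀ hδ.ne', add_sub_add_right_eq_sub]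

theorem integrable_mul_of_bound {g k : Space n → ℝ} (hg : Continuous g) (hM : ∀ x, |g x| ≤ M)
    (hk : Integrable k) : Integrable fun z => g z * k z :=
  hk.bdd_mul hg.aestronglyMeasurable (Eventually.of_forall hM)

theorem abs_integral_mul_le {g k : Space n → ℝ} (hM : ∀ x, |g x| ≤ M) (hk : Integrable k) :
    |∫ z, g z * k z| ≤ M * ∫ z, |k z| := by
  rw [← integral_const_mul, ← Real.norm_eq_abs]
  refine norm_integral_le_of_norm_le (hk.abs.const_mul M) (Eventually.of_forall fun z => ?_)
  rw [Real.norm_eq_abs, abs_mul]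
  exact mul_le_mul_of_nonneg_right (hM z) (abs_nonneg _)

theorem IsMollifier.integrable (hρ : IsMollifier ρ) : Integrable ρ :=
  hρ.smooth.continuous.integrable_of_hasCompactSupport hρ.hasCompactSupport

theorem abs_mollify_sub_le (hρ : IsMollifier ρ) (hδ : 0 < δ) (hf : Continuous f)
    (hM : ∀ x, |f x| ≤ M) {c : ℝ} {x : Space n} (a : ℝ)
    (h : ∀ y, ‖y‖ ≤ δ → |f (x - y) - a| ≤ c) : |mollify ρ δ f x - a| ≤ c := by
  have hi : Integrable fun z => f (x - δ • z) * ρ z :=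
    integrable_mul_of_bound (by fun_prop) (fun z => hM _) hρ.integrable
  have e : mollify ρ δ f x - a = ∫ z, (f (x - δ • z) - a) * ρ z := by
    simp_rw [sub_mul]
    rw [integral_sub hi (hρ.integrable.const_mul a), integral_const_mul, hρ.mass, mul_one,
      mollify_eq ρ f hδ]
  have e2 : c = ∫ z, c * ρ z := by rw [integral_const_mul, hρ.mass, mul_one]
  rw [e, e2, ← Real.norm_eq_abs]
  refine norm_integral_le_of_norm_le (hρ.integrable.const_mul c)
    (Eventually.of_forall fun z => ?_)
  rw [Real.norm_eq_abs, abs_mul, abs_of_nonneg (hρ.nonneg z)]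
  rcases le_or_gt ‖z‖ 1 with hz | hz
  · refine mul_le_mul_of_nonneg_right (h _ ?_) (hρ.nonneg z)
    rw [norm_smul, Real.norm_of_nonneg hδ.le]
    exact mul_le_of_le_one_right hδ.le hz
  · simp [hρ.supp z hz]

theorem abs_mollify_le (hρ : IsMollifier ρ) (hδ : 0 < δ) (hf : Continuous f)
    (hM : ∀ x, |f x| ≤ M) (x : Space n) : |mollify ρ δ f x| ≤ M := by
  simpa using abs_mollify_sub_le hρ hδ hf hM 0 (x := x) (c := M) fun y _ => by simpa using hM _

theorem abs_mollify_diff_le (hρ : IsMollifier ρ) (hδ : 0 < δ) (hf : Continuous f)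
    (hM : ∀ x, |f x| ≤ M) (x h : Space n) :
    |mollify ρ δ f (x + h) - mollify ρ δ f x| ≤ M * (∫ w, ‖gradient ρ w‖) / δ * ‖h‖ := by
  have hM0 : 0 ≤ M := (abs_nonneg _).trans (hM 0)
  have hr : Integrable fun z => ρ (z + δ⁻¹ • h) := hρ.integrable.comp_add_right _
  rw [mollify_add ρ f hδ, mollify_eq ρ f hδ,
    ← integral_sub (integrable_mul_of_bound (by fun_prop) (fun z => hM _) hr)
      (integrable_mul_of_bound (by fun_prop) (fun z => hM _) hρ.integrable)]
  simp_rw [← mul_sub]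
  refine (abs_integral_mul_le (M := M) (fun z => hM _) (hr.sub hρ.integrable)).trans ?_
  have := integral_abs_diff_le_norm (hρ.smooth.of_le (by exact_mod_cast le_top))
    hρ.hasCompactSupport (δ⁻¹ • h)
  rw [norm_smul, norm_inv, Real.norm_of_nonneg hδ.le] at this
  calc _ ≤ M * (δ⁻¹ * ‖h‖ * ∫ w, ‖gradient ρ w‖) := mul_le_mul_of_nonneg_left this hM0
    _ = _ := by ring

theorem abs_mollify_second_diff_le (hρ : IsMollifier ρ) (hδ : 0 < δ) (hf : Continuous f)
    (hM : ∀ x, |f x| ≤ M) (x h : Space n) :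
    |mollify ρ δ f (x + h) + mollify ρ δ f (x - h) - 2 * mollify ρ δ f x|
      ≤ M * (∫ w, ‖iteratedFDeriv ℝ 2 ρ w‖) / δ ^ 2 * ‖h‖ ^ 2 := by
  have hM0 : 0 ≤ M := (abs_nonneg _).trans (hM 0)
  have hr : Integrable fun z => ρ (z + δ⁻¹ • h) := hρ.integrable.comp_add_right _
  have hl : Integrable fun z => ρ (z - δ⁻¹ • h) := hρ.integrable.comp_sub_right _
  have hi : ∀ {k : Space n → ℝ}, Integrable k → Integrable fun z => f (x - δ • z) * k z :=
    fun hk => integrable_mul_of_bound (by fun_prop) (fun z => hM _) hk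
  have e : mollify ρ δ f (x + h) + mollify ρ δ f (x - h) - 2 * mollify ρ δ f x
      = ∫ z, f (x - δ • z) * (ρ (z + δ⁻¹ • h) + ρ (z - δ⁻¹ • h) - 2 * ρ z) := by
    have e1 : ∀ z, f (x - δ • z) * (ρ (z + δ⁻¹ • h) + ρ (z - δ⁻¹ • h) - 2 * ρ z)
      = f (x - δ • z) * ρ (z + δ⁻¹ • h) + f (x - δ • z) * ρ (z - δ⁻¹ • h)
        - 2 * (f (x - δ • z) * ρ z) := fun z => by ring
    simp_rw [e1]
    have h3 := integral_sub ((hi hr).add (hi hl)) ((hi hρ.integrable).const_mul 2)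
    simp only [Pi.add_apply] at h3
    rw [h3,
      integral_add (hi hr) (hi hl), integral_const_mul, mollify_add ρ f hδ, sub_eq_add_neg x h,
      mollify_add ρ f hδ, mollify_eq ρ f hδ]
    simp_rw [smul_neg, ← sub_eq_add_neg]
  rw [e]
  refine (abs_integral_mul_le (M := M) (fun z => hM _)
    ((hr.add hl).sub (hρ.integrable.const_mul 2))).trans ?_
  have := integral_abs_second_diff_le hρ.contDiff_two
    hρ.hasCompactSupport (δ⁻¹ • h)
  rw [norm_smul, norm_inv, Real.norm_of_nonneg hδ.le] at this
  calc _ ≤ M * ((δ⁻¹ * ‖h‖) ^ 2 * ∫ w, ‖iteratedFDeriv ℝ 2 ρ w‖) :=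
        mul_le_mul_of_nonneg_left this hM0
    _ = _ := by ring

theorem mollify_isBUC (hρ : IsMollifier ρ) (hδ : 0 < δ) (hf : Continuous f)
    (hM : ∀ x, |f x| ≤ M) : IsBUC (mollify ρ δ f) := by
  refine ⟨⟨M, abs_mollify_le hρ hδ hf hM⟩, ?_⟩
  refine LipschitzWith.uniformContinuous
    (K := Real.toNNReal (M * (∫ w, ‖gradient ρ w‖) / δ)) (LipschitzWith.of_dist_le_mul fun x y => ?_)
  have := abs_mollify_diff_le hρ hδ hf hM y (x - y)
  rw [add_sub_cancel] at this
  rw [Real.dist_eq, dist_eq_norm]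
  exact this.trans (mul_le_mul_of_nonneg_right (Real.le_coe_toNNReal _) (norm_nonneg _))

end mollify

/-! ### Bounds for the symmetric integral -/

/-- The function `B η^{1-2s}` up to `ℓ`, and `A η^{-q}` beyond. -/
def splitBound (s q B A ℓ : ℝ) (η : ℝ) : ℝ :=
  (Iic ℓ).indicator (fun η => B * η ^ (1 - 2 * s)) η + (Ioi ℓ).indicator (fun η => A * η ^ (-q)) η

section split
variable {s q B A ℓ : ℝ}

theorem splitBound_near_integrable (hs' : s < 1) (hℓ : 0 < ℓ) :
    IntegrableOn ((Iic ℓ).indicator fun η : ℝ => B * η ^ (1 - 2 * s)) (Ioi 0) := by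
  rw [IntegrableOn, integrable_indicator_iff measurableSet_Iic, IntegrableOn,
    Measure.restrict_restrict measurableSet_Iic, inter_comm, Ioi_inter_Iic]
  have := (intervalIntegral.intervalIntegrable_rpow' (a := 0) (b := ℓ) (r := 1 - 2 * s)
    (by linarith)).const_mul B
  exact (intervalIntegrable_iff_integrableOn_Ioc_of_le hℓ.le).1 this

theorem splitBound_far_integrable (hq : 1 < q) (hℓ : 0 < ℓ) :
    IntegrableOn ((Ioi ℓ).indicator fun η : ℝ => A * η ^ (-q)) (Ioi 0) := by
  rw [IntegrableOn, integrable_indicator_iff measurableSet_Ioi, IntegrableOn,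
    Measure.restrict_restrict measurableSet_Ioi, Ioi_inter_Ioi, sup_eq_left.2 hℓ.le]
  exact (integrableOn_Ioi_rpow_of_lt (by linarith) hℓ).const_mul A

theorem splitBound_integrable (hs' : s < 1) (hq : 1 < q) (hℓ : 0 < ℓ) :
    IntegrableOn (splitBound s q B A ℓ) (Ioi 0) :=
  (splitBound_near_integrable hs' hℓ).add (splitBound_far_integrable hq hℓ)

theorem splitBound_integral (hs' : s < 1) (hq : 1 < q) (hℓ : 0 < ℓ) :
    ∫ η in Ioi 0, splitBound s q B A ℓ η
      = B * (ℓ ^ (2 - 2 * s) / (2 - 2 * s)) + A * (ℓ ^ (1 - q) / (q - 1)) := by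
  unfold splitBound
  rw [integral_add (splitBound_near_integrable hs' hℓ) (splitBound_far_integrable hq hℓ),
    setIntegral_indicator measurableSet_Iic, setIntegral_indicator measurableSet_Ioi,
    Ioi_inter_Iic, Ioi_inter_Ioi, sup_eq_right.2 hℓ.le, integral_const_mul, integral_const_mul,
    integral_Ioi_rpow_of_lt (by linarith) hℓ, ← intervalIntegral.integral_of_le hℓ.le,
    integral_rpow (Or.inl (by linarith)), Real.zero_rpow (by linarith)]
  congr 2
  · rw [sub_zero, show 1 - 2 * s + 1 = 2 - 2 * s by ring]
  · rw [show -q + 1 = -(q - 1) by ring, neg_div_neg_eq, neg_sub]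

theorem splitBound_nonneg (hB : 0 ≤ B) (hA : 0 ≤ A) {η : ℝ} (hη : 0 < η) :
    0 ≤ splitBound s q B A ℓ η :=
  add_nonneg (indicator_apply_nonneg fun _ => by positivity)
    (indicator_apply_nonneg fun _ => by positivity)

/-- The value `q = 2 * s` corresponds to linear growth beyond `ℓ`, the value `q = 1 + 2 * s` to
boundedness. -/
theorem abs_div_weight_le_splitBound {g η : ℝ} (hη : 0 < η)
    (h1 : η ≤ ℓ → |g| ≤ B * η ^ 2) (h2 : ℓ < η → |g| ≤ A * η ^ (1 + 2 * s - q)) :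
    |g / η ^ (1 + 2 * s)| ≤ splitBound s q B A ℓ η := by
  have hp : 0 < η ^ (1 + 2 * s) := Real.rpow_pos_of_pos hη _
  rw [abs_div, abs_of_pos hp, div_le_iff₀ hp, splitBound]
  rcases le_or_gt η ℓ with h | h
  · rw [indicator_of_mem (by exact h), indicator_of_notMem (by simpa using h), add_zero, mul_assoc,
      ← Real.rpow_add hη, show 1 - 2 * s + (1 + 2 * s) = 2 by ring]
    exact_mod_cast h1 h
  · rw [indicator_of_notMem (by simpa using h), indicator_of_mem (by exact h), zero_add, mul_assoc,
      ← Real.rpow_add hη, show -q + (1 + 2 * s) = 1 + 2 * s - q by ring]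
    exact h2 h

end split

/-! ### Uniform bounds for the truncated operator from first and second differences -/

section truncBound
variable {n : ℕ} [Nonempty (Dir n)] {s ε M : ℝ} {v : Space n → ℝ} {x : Space n}

/-- Antipodal pairing: against any `y` in the supremum the infimum may be tested at `-y`, and
conversely. Only two-sided integrals along one line remain. -/
theorem RayBdd.abs_truncLap_le (h : RayBdd v M x) (hs : 0 < s) (hs' : s < 1) (hε : 0 < ε) {Q : ℝ}
    (hQ : ∀ y : Dir n, |∫ η in Ioi ε, (v (x + η • (y : Space n)) + v (x - η • (y : Space n))
      - 2 * v x) / η ^ (1 + 2 * s)| ≤ Q) :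
    |truncLap s ε v x| ≤ Cs s * Q := by
  have hC := Cs_pos hs hs'
  rw [h.truncLap_eq hs hε, abs_mul, abs_of_pos hC]
  refine mul_le_mul_of_nonneg_left ?_ hC.le
  simp_rw [h.sym_integral hs hε, abs_le] at hQ
  have h1 : (⨆ y : Dir n, rayInt s ε v x y) ≤
      Q + ε ^ (-(2 * s)) / s * v x - ⨅ y : Dir n, rayInt s ε v x y := ciSup_le fun y => by
    have := ciInf_le (h.bddBelow hs hε) (-y)
    rw [coe_neg_sphere] at this
    linarith [(hQ y).2]
  have h2 : -Q + ε ^ (-(2 * s)) / s * v x - (⨆ y : Dir n, rayInt s ε v x y)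
      ≤ ⨅ y : Dir n, rayInt s ε v x y := le_ciInf fun y => by
    have := le_ciSup (h.bddAbove hs hε) (-y)
    rw [coe_neg_sphere] at this
    have h3 := (hQ (-y)).1
    rw [coe_neg_sphere, neg_neg] at h3
    linarith
  exact abs_le.2 ⟨by linarith, by linarith⟩

theorem abs_truncLap_le_of_diff (hv : Continuous v) (hM : ∀ z, |v z| ≤ M) (hs : 1 / 2 < s)
    (hs' : s < 1) (hε : 0 < ε) {A B ℓ : ℝ} (hA0 : 0 ≤ A) (hB0 : 0 ≤ B) (hℓ : 0 < ℓ)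
    (hA : ∀ z h, |v (z + h) - v z| ≤ A * ‖h‖)
    (hB : ∀ z h, |v (z + h) + v (z - h) - 2 * v z| ≤ B * ‖h‖ ^ 2) :
    |truncLap s ε v x| ≤ Cs s * (B * (ℓ ^ (2 - 2 * s) / (2 - 2 * s))
      + 2 * A * (ℓ ^ (1 - 2 * s) / (2 * s - 1))) := by
  refine (RayBdd.of_continuous hv hM).abs_truncLap_le (by linarith) hs' hε fun y => ?_
  rw [← splitBound_integral hs' (by linarith : 1 < 2 * s) hℓ, ← Real.norm_eq_abs]
  have hint := splitBound_integrable (B := B) (A := 2 * A) hs' (by linarith : 1 < 2 * s) hℓ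
  refine (norm_integral_le_of_norm_le (hint.mono_set (Ioi_subset_Ioi hε.le))
    ((ae_restrict_iff' measurableSet_Ioi).2 (Eventually.of_forall fun η hη => ?_))).trans
    (setIntegral_mono_set hint ((ae_restrict_iff' measurableSet_Ioi).2
      (Eventually.of_forall fun η hη => splitBound_nonneg hB0 (by positivity) hη))
      (Ioi_subset_Ioi hε.le).eventuallyLE)
  have hη0 : 0 < η := hε.trans hη
  have hn : ‖η • (y : Space n)‖ = η := by
    rw [norm_smul, norm_eq_of_mem_sphere, Real.norm_of_nonneg hη0.le, mul_one]
  refine abs_div_weight_le_splitBound hη0 (fun _ => ?_) fun _ => ?_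
  · simpa [hn] using hB x (η • (y : Space n))
  · have h1 := hA x (η • (y : Space n))
    have h2 := hA x (-(η • (y : Space n)))
    rw [norm_neg] at h2
    rw [hn, ← sub_eq_add_neg] at *
    rw [add_sub_cancel_right, Real.rpow_one]
    rw [abs_le] at *
    constructor <;> linarith [h1.1, h1.2, h2.1, h2.2]

end truncBound

/-- The constant in the bound for `ℒ_ε` of a mollified function. -/
def lapConst (s : ℝ) : ℝ := Cs s * (1 / (2 - 2 * s) + 2 / (2 * s - 1))

theorem lapConst_pos {s : ℝ} (hs : 1 / 2 < s) (hs' : s < 1) : 0 < lapConst s := by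
  have := Cs_pos (by linarith : 0 < s) hs'
  have h1 : 0 < 2 - 2 * s := by linarith
  have h2 : 0 < 2 * s - 1 := by linarith
  unfold lapConst
  positivity

/-! ### Mollified data and the midrange -/

section time
variable {n : ℕ} {s ε δ M : ℝ} {ρ f u : Space n → ℝ}

theorem abs_truncLap_mollify_le [hne : Nonempty (Dir n)] (hs : 1 / 2 < s) (hs' : s < 1)
    (hε : 0 < ε) (hδ : 0 < δ) (hρ : IsMollifier ρ) (hf : Continuous f) (hM : ∀ x, |f x| ≤ M)
    (x : Space n) :
    |truncLap s ε (mollify ρ δ f) x| ≤ lapConst s * M * (∫ x, ‖gradient ρ x‖) ^ (2 - 2 * s)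
      * (∫ x, ‖iteratedFDeriv ℝ 2 ρ x‖) ^ (2 * s - 1) * δ ^ (-(2 * s)) := by
  have hG := hρ.integral_gradient_pos hne
  have hD := hρ.integral_iteratedFDeriv_pos hne
  have hM0 : 0 ≤ M := (abs_nonneg _).trans (hM 0)
  have h := abs_truncLap_le_of_diff (x := x) (mollify_isBUC hρ hδ hf hM).2.continuous
    (abs_mollify_le hρ hδ hf hM) hs hs' hε (by positivity) (by positivity)
    -- The radius `ℓ = A / B` for the Lipschitz constant `A` and the second difference constant `B`,
    -- at which `B ℓ^{2-2s} = A ℓ^{1-2s}`.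
    (ℓ := (∫ x, ‖gradient ρ x‖) * δ / ∫ x, ‖iteratedFDeriv ℝ 2 ρ x‖) (by positivity)
    (abs_mollify_diff_le hρ hδ hf hM) (abs_mollify_second_diff_le hρ hδ hf hM)
  refine h.trans_eq ?_
  generalize (∫ x, ‖gradient ρ x‖) = G at *
  generalize (∫ x, ‖iteratedFDeriv ℝ 2 ρ x‖) = D at *
  have e1 : (G * δ / D) ^ (2 - 2 * s)
      = G ^ (2 - 2 * s) * (δ ^ (-(2 * s)) * δ ^ 2) * (D ^ (2 * s - 1) / D) := by
    rw [Real.div_rpow (by positivity) hD.le, Real.mul_rpow hG.le hδ.le, div_eq_mul_inv,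
      ← Real.rpow_neg hD.le, ← Real.rpow_natCast δ 2, ← Real.rpow_add hδ,
      show -(2 - 2 * s) = (2 * s - 1) - 1 by ring, Real.rpow_sub_one hD.ne']
    congr 3
    push_cast
    ring
  have e2 : (G * δ / D) ^ (1 - 2 * s)
      = (G ^ (2 - 2 * s) / G) * (δ ^ (-(2 * s)) * δ) * D ^ (2 * s - 1) := by
    rw [Real.div_rpow (by positivity) hD.le, Real.mul_rpow hG.le hδ.le, div_eq_mul_inv,
      ← Real.rpow_neg hD.le, ← Real.rpow_add_one hδ.ne', ← Real.rpow_sub_one hG.ne']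
    congr 3 <;> ring
  rw [e1, e2, lapConst]
  have h1 : 2 - 2 * s ≠ 0 := by linarith
  have h2 : 2 * s - 1 ≠ 0 := by linarith
  field_simp

/-- The mean of the infimum and the supremum over balls of radius `r`. -/
def midrange (u : Space n → ℝ) (r : ℝ) (x : Space n) : ℝ :=
  ((⨆ y : Metric.closedBall (0 : Space n) r, u (x + (y : Space n)))
    + ⨅ y : Metric.closedBall (0 : Space n) r, u (x + (y : Space n))) / 2

theorem midrange_aux (hM : ∀ x, |u x| ≤ M) {r : ℝ} (hr : 0 ≤ r) :
    Nonempty (Metric.closedBall (0 : Space n) r) ∧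
    (∀ x, BddAbove (range fun y : Metric.closedBall (0 : Space n) r => u (x + (y : Space n)))) ∧
    ∀ x, BddBelow (range fun y : Metric.closedBall (0 : Space n) r => u (x + (y : Space n))) :=
  ⟨⟨0, by simpa using hr⟩,
    fun x => ⟨M, by rintro _ ⟨y, rfl⟩; exact le_of_abs_le (hM _)⟩,
    fun x => ⟨-M, by rintro _ ⟨y, rfl⟩; exact neg_le_of_abs_le (hM _)⟩⟩

theorem abs_midrange_le (hM : ∀ x, |u x| ≤ M) {r : ℝ} (hr : 0 ≤ r) (x : Space n) :
    |midrange u r x| ≤ M := by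
  obtain ⟨hne, hb, hb'⟩ := midrange_aux hM hr
  have h1 := ciSup_le (f := fun y : Metric.closedBall (0 : Space n) r => u (x + (y : Space n)))
    fun y => le_of_abs_le (hM _)
  have h2 := le_ciInf (f := fun y : Metric.closedBall (0 : Space n) r => u (x + (y : Space n)))
    fun y => neg_le_of_abs_le (hM _)
  have h3 := ciInf_le_ciSup (hb' x) (hb x)
  unfold midrange
  rw [abs_le]
  constructor <;> linarith

theorem abs_midrange_diff_le (hM : ∀ x, |u x| ≤ M) {r : ℝ} (hr : 0 ≤ r) {h : Space n} {c : ℝ}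
    (hc : ∀ x, |u (x + h) - u x| ≤ c) (x : Space n) :
    |midrange u r (x + h) - midrange u r x| ≤ c := by
  obtain ⟨hne, hb, hb'⟩ := midrange_aux hM hr
  have e : ∀ y : Space n, |u (x + h + y) - u (x + y)| ≤ c := fun y => by
    rw [add_right_comm]; exact hc _
  have h1 := ciSup_le (f := fun y : Metric.closedBall (0 : Space n) r => u (x + h + (y : Space n)))
    (fun y => (sub_le_iff_le_add.1 (le_of_abs_le (e y))).trans
      (add_le_add_right (le_ciSup (hb x) y) c))
  have h2 := ciSup_le (f := fun y : Metric.closedBall (0 : Space n) r => u (x + (y : Space n)))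
    (fun y => (show u (x + y) ≤ c + u (x + h + y) by linarith [neg_le_of_abs_le (e y)]).trans
      (add_le_add_right (le_ciSup (hb (x + h)) y) c))
  have h3 := le_ciInf (f := fun y : Metric.closedBall (0 : Space n) r => u (x + h + (y : Space n)))
    (fun y => (add_le_add_right (ciInf_le (hb' x) y) (-c)).trans
      (show -c + u (x + y) ≤ _ by linarith [neg_le_of_abs_le (e y)]))
  have h4 := le_ciInf (f := fun y : Metric.closedBall (0 : Space n) r => u (x + (y : Space n)))
    (fun y => (add_le_add_right (ciInf_le (hb' (x + h)) y) (-c)).trans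
      (show -c + u (x + h + y) ≤ _ by linarith [le_of_abs_le (e y)]))
  unfold midrange
  rw [abs_le]
  constructor <;> linarith

/-- Each value of `u` on the ball lies between the two extremes, so it differs from their mean by
at most half the oscillation. -/
theorem abs_midrange_sub_le (hM : ∀ x, |u x| ≤ M) {r : ℝ} (hr : 0 ≤ r) {x z : Space n}
    (hz : ‖z - x‖ ≤ r) : |midrange u r x - u z| ≤ modCont u (2 * r) / 2 := by
  obtain ⟨hne, hb, hb'⟩ := midrange_aux hM hr
  have hosc : (⨆ y : Metric.closedBall (0 : Space n) r, u (x + (y : Space n)))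
      ≤ modCont u (2 * r) + ⨅ y : Metric.closedBall (0 : Space n) r, u (x + (y : Space n)) := by
    refine ciSup_le fun y => ?_
    rw [← sub_le_iff_le_add']
    refine le_ciInf fun y' => ?_
    have hy := mem_closedBall_zero_iff.1 y.2
    have hy' := mem_closedBall_zero_iff.1 y'.2
    have := abs_sub_le_modCont hM (x := x + (y : Space n)) (y := x + (y' : Space n)) (r := 2 * r)
      (by rw [add_sub_add_left_eq_sub]; exact (norm_sub_le _ _).trans (by linarith))
    linarith [le_of_abs_le this]
  have h1 := le_ciSup (hb x) ⟨z - x, by simpa using hz⟩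
  have h2 := ciInf_le (hb' x) ⟨z - x, by simpa using hz⟩
  simp only [add_sub_cancel] at h1 h2
  unfold midrange
  rw [abs_le]
  constructor <;> linarith

theorem midrange_isBUC (hu : IsBUC u) {r : ℝ} (hr : 0 ≤ r) : IsBUC (midrange u r) := by
  obtain ⟨⟨M, hM⟩, huc⟩ := hu
  exact ⟨⟨M, abs_midrange_le hM hr⟩,
    uniformContinuous_of_diff huc fun y c h => abs_midrange_diff_le hM hr h⟩

/-- The kernel only sees centres within `δ / 2` of `x`, and the midrange balls around them have
radius `δ / 2`, so they all contain `x` and have diameter at most `δ`. -/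
theorem abs_mollify_midrange_sub_le (hρ : IsMollifier ρ) (hu : IsBUC u) (hδ : 0 < δ)
    (x : Space n) : |u x - mollify ρ (δ / 2) (midrange u (δ / 2)) x| ≤ modCont u δ / 2 := by
  have hb := midrange_isBUC hu (by positivity : 0 ≤ δ / 2)
  obtain ⟨⟨M, hM⟩, huc⟩ := hu
  obtain ⟨N, hN⟩ := hb.1
  rw [abs_sub_comm]
  refine abs_mollify_sub_le hρ (by positivity) hb.2.continuous hN (u x) fun y hy => ?_
  have := abs_midrange_sub_le hM (by positivity : 0 ≤ δ / 2) (x := x - y) (z := x)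
    (by simpa using hy)
  rwa [mul_div_cancel₀ δ two_ne_zero] at this

theorem abs_mollify_sub_self_le (hρ : IsMollifier ρ) (hu : IsBUC u) (hδ : 0 < δ)
    (x : Space n) : |u x - mollify ρ δ u x| ≤ modCont u δ := by
  obtain ⟨⟨M, hM⟩, huc⟩ := hu
  rw [abs_sub_comm]
  refine abs_mollify_sub_le hρ hδ huc.continuous hM (u x) fun y hy => ?_
  exact abs_sub_le_modCont hM (by simpa using hy)

/-- The left side is `r ^ (1 - 2s/3)`, whose exponent lies between `1/3` and `1`. -/
theorem rpow_third_bound {s r : ℝ} (hs : 1 / 2 < s) (hs' : s < 1) (hr : 0 < r) :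
    r * (r ^ (1 / 3 : ℝ)) ^ (-(2 * s)) ≤ r ^ (1 / 3 : ℝ) + r := by
  rw [← Real.rpow_mul hr.le, ← Real.rpow_one_add' hr.le (by linarith)]
  have h0 : 0 ≤ r ^ (1 / 3 : ℝ) := by positivity
  rcases le_or_gt r 1 with h | h
  · have := Real.rpow_le_rpow_of_exponent_ge hr h
      (by linarith : (1 / 3 : ℝ) ≤ 1 + 1 / 3 * -(2 * s))
    linarith
  · have := Real.rpow_le_rpow_of_exponent_le h.le
      (by linarith : 1 + 1 / 3 * -(2 * s) ≤ 1)
    rw [Real.rpow_one] at this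
    linarith

end time

/-! ### The modulus of continuity in time -/

section timeMod
variable {n : ℕ} {s ε τ δ M r : ℝ} {ρ f u : Space n → ℝ}

theorem IsBUC.abs_le_supNorm (hu : IsBUC u) (x : Space n) : |u x| ≤ supNorm u := by
  obtain ⟨⟨M, hM⟩, -⟩ := hu
  exact InfFracLap.abs_le_supNorm hM x

theorem mul_rpow_le_timeConst [hne : Nonempty (Dir n)] (hs : 1 / 2 < s) (hs' : s < 1)
    (hρ : IsMollifier ρ) {a : ℝ} (ha : 0 ≤ a) (hr : 0 < r) :
    r * (a * lapConst s * supNorm u * (∫ x, ‖gradient ρ x‖) ^ (2 - 2 * s)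
      * (∫ x, ‖iteratedFDeriv ℝ 2 ρ x‖) ^ (2 * s - 1) * (r ^ (1 / 3 : ℝ)) ^ (-(2 * s)))
      ≤ timeConst (a * lapConst s) s ρ u * (r ^ (1 / 3 : ℝ) + r) := by
  have hG := hρ.integral_gradient_pos hne
  have hD := hρ.integral_iteratedFDeriv_pos hne
  have := lapConst_pos hs hs'
  have hu := supNorm_nonneg u
  unfold timeConst
  calc _ = a * lapConst s * supNorm u * (∫ x, ‖gradient ρ x‖) ^ (2 - 2 * s)
      * (∫ x, ‖iteratedFDeriv ℝ 2 ρ x‖) ^ (2 * s - 1)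
      * (r * (r ^ (1 / 3 : ℝ)) ^ (-(2 * s))) := by ring
    _ ≤ _ := mul_le_mul_of_nonneg_left (rpow_third_bound hs hs' hr) (by positivity)

theorem timeConst_mono [hne : Nonempty (Dir n)] (hρ : IsMollifier ρ) {c c' : ℝ} (h : c ≤ c') :
    timeConst c s ρ u ≤ timeConst c' s ρ u := by
  have hG := hρ.integral_gradient_pos hne
  have hD := hρ.integral_iteratedFDeriv_pos hne
  have hu := supNorm_nonneg u
  unfold timeConst
  gcongr

theorem supNorm_truncLap_mollify_le [Nonempty (Dir n)] (hs : 1 / 2 < s) (hs' : s < 1)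
    (hρ : IsMollifier ρ) (hu : IsBUC u) (hδ : 0 < δ) (e : Ioi (0 : ℝ)) :
    supNorm (truncLap s e (mollify ρ δ u)) ≤
      lapConst s * supNorm u * (∫ x, ‖gradient ρ x‖) ^ (2 - 2 * s)
      * (∫ x, ‖iteratedFDeriv ℝ 2 ρ x‖) ^ (2 * s - 1) * δ ^ (-(2 * s)) :=
  supNorm_le (abs_truncLap_mollify_le hs hs' e.2 hδ hρ hu.2.continuous hu.abs_le_supNorm)

theorem abs_truncLap_mollify_le_iSup [Nonempty (Dir n)] (hs : 1 / 2 < s) (hs' : s < 1)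
    (hρ : IsMollifier ρ) (hu : IsBUC u) (hδ : 0 < δ) (hε : 0 < ε) (x : Space n) :
    |truncLap s ε (mollify ρ δ u) x|
      ≤ ⨆ e : Ioi (0 : ℝ), supNorm (truncLap s e (mollify ρ δ u)) :=
  (abs_le_supNorm (abs_truncLap_mollify_le hs hs' hε hδ hρ hu.2.continuous hu.abs_le_supNorm)
    x).trans (le_ciSup (f := fun e : Ioi (0 : ℝ) => supNorm (truncLap s e (mollify ρ δ u)))
      ⟨_, by rintro _ ⟨e, rfl⟩; exact supNorm_truncLap_mollify_le hs hs' hρ hu hδ e⟩ ⟨ε, hε⟩)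

theorem timeMod_term_nonneg (s : ℝ) (ρ u : Space n → ℝ) (hr : 0 ≤ r) (δ : Ioi (0 : ℝ)) :
    0 ≤ 2 * modCont u δ
      + r * ⨆ ε : Ioi (0 : ℝ), supNorm (truncLap s ε (mollify ρ δ u)) := by
  have h1 := modCont_nonneg u δ
  have h2 : 0 ≤ ⨆ ε : Ioi (0 : ℝ), supNorm (truncLap s ε (mollify ρ δ u)) :=
    Real.iSup_nonneg fun _ => supNorm_nonneg _
  positivity

theorem timeMod_le (s : ℝ) (ρ u : Space n → ℝ) (hr : 0 ≤ r) (hδ : 0 < δ) :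
    timeMod s ρ u r ≤ 2 * modCont u δ
      + r * ⨆ ε : Ioi (0 : ℝ), supNorm (truncLap s ε (mollify ρ δ u)) :=
  ciInf_le (f := fun δ : Ioi (0 : ℝ) => 2 * modCont u δ
    + r * ⨆ ε : Ioi (0 : ℝ), supNorm (truncLap s ε (mollify ρ δ u)))
    ⟨0, by rintro _ ⟨δ, rfl⟩; exact timeMod_term_nonneg s ρ u hr δ⟩ ⟨δ, hδ⟩

theorem timeMod_nonneg (s : ℝ) (ρ u : Space n → ℝ) (hr : 0 ≤ r) : 0 ≤ timeMod s ρ u r :=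
  Real.iInf_nonneg fun δ => timeMod_term_nonneg s ρ u hr δ

theorem timeMod_monotoneOn (s : ℝ) (ρ u : Space n → ℝ) : MonotoneOn (timeMod s ρ u) (Ici 0) := by
  intro r hr r' _ h
  refine le_ciInf fun δ => (timeMod_le s ρ u hr δ.2).trans ?_
  have h2 : 0 ≤ ⨆ ε : Ioi (0 : ℝ), supNorm (truncLap s ε (mollify ρ δ u)) :=
    Real.iSup_nonneg fun _ => supNorm_nonneg _
  gcongr

theorem timeMod_le_third [Nonempty (Dir n)] (hs : 1 / 2 < s) (hs' : s < 1)
    (hρ : IsMollifier ρ) (hu : IsBUC u) (hr : 0 ≤ r) :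
    timeMod s ρ u r ≤ 2 * modCont u (r ^ (1 / 3 : ℝ))
      + timeConst (lapConst s) s ρ u * (r ^ (1 / 3 : ℝ) + r) := by
  -- At `r = 0` the choice `δ = r ^ (1/3)` is not positive; there `δ → 0` shows that the infimum is
  -- at most `0`.
  rcases hr.eq_or_lt with rfl | hr
  · rw [Real.zero_rpow (by norm_num), add_zero, mul_zero, add_zero]
    refine le_trans ?_ (mul_nonneg two_pos.le (modCont_nonneg u 0))
    refine le_of_forall_pos_le_add fun e he => ?_
    obtain ⟨δ, hδ, h⟩ := modCont_tendsto hu.2 (e / 2) (by positivity)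
    refine (timeMod_le s ρ u le_rfl hδ).trans ?_
    linarith [h δ le_rfl]
  · have hδ : 0 < r ^ (1 / 3 : ℝ) := by positivity
    refine (timeMod_le s ρ u hr.le hδ).trans ?_
    have h1 := mul_rpow_le_timeConst (u := u) hs hs' hρ zero_le_one hr
    rw [one_mul] at h1
    refine add_le_add_right (le_trans ?_ h1) _
    exact mul_le_mul_of_nonneg_left
      (ciSup_le fun e => supNorm_truncLap_mollify_le hs hs' hρ hu hδ e) hr.le

theorem timeMod_isModulus (s : ℝ) (ρ : Space n → ℝ) (hu : IsBUC u) : IsModulus (timeMod s ρ u) := by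
  refine ⟨fun r hr => timeMod_nonneg s ρ u hr, timeMod_monotoneOn s ρ u, ?_⟩
  rw [Metric.tendsto_nhdsWithin_nhds]
  intro e he
  obtain ⟨δ, hδ, h⟩ := modCont_tendsto hu.2 (e / 8) (by positivity)
  set K := ⨆ ε : Ioi (0 : ℝ), supNorm (truncLap s ε (mollify ρ δ u))
  have hK : 0 ≤ K := Real.iSup_nonneg fun _ => supNorm_nonneg _
  refine ⟨e / (2 * (K + 1)), by positivity, fun {r} hr hr' => ?_⟩
  have hr0 : 0 < r := hr
  rw [Real.dist_eq, sub_zero, abs_of_pos hr0, lt_div_iff₀ (by positivity)] at hr'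
  rw [Real.dist_eq, sub_zero, abs_of_nonneg (timeMod_nonneg s ρ u hr0.le)]
  have h1 := timeMod_le s ρ u hr0.le hδ
  have h2 := h δ le_rfl
  change _ ≤ _ + r * K at h1
  nlinarith

theorem abs_schemeInterp_sub_le_timeMod [Nonempty (Dir n)] (hs : 1 / 2 < s) (hs' : s < 1)
    (hc : IsCFL s ε τ) (hρ : IsMollifier ρ) (hu : IsBUC u) {t t' : ℝ} (ht : 0 ≤ t) (ht' : 0 ≤ t')
    (x : Space n) :
    |schemeInterp s ε τ u x t - schemeInterp s ε τ u x t'| ≤ timeMod s ρ u |t - t'| := by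
  refine le_ciInf fun δ => ?_
  exact abs_schemeInterp_time_le (by linarith) hs' hc hu
    (mollify_isBUC hρ δ.2 hu.2.continuous hu.abs_le_supNorm)
    (abs_mollify_sub_self_le hρ hu δ.2)
    (abs_truncLap_mollify_le_iSup hs hs' hρ hu δ.2 hc.1) ht ht' x

/-- Comparison with the mollified midrange costs twice half of the modulus, whence the coefficient
`1`. -/
theorem abs_schemeInterp_sub_le_third [Nonempty (Dir n)] (hs : 1 / 2 < s) (hs' : s < 1)
    (hc : IsCFL s ε τ) (hρ : IsMollifier ρ) (hu : IsBUC u) {t t' : ℝ} (ht : 0 ≤ t) (ht' : 0 ≤ t')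
    (x : Space n) :
    |schemeInterp s ε τ u x t - schemeInterp s ε τ u x t'| ≤ modCont u (|t - t'| ^ (1 / 3 : ℝ))
      + timeConst (4 * lapConst s) s ρ u * (|t - t'| ^ (1 / 3 : ℝ) + |t - t'|) := by
  rcases (abs_nonneg (t - t')).eq_or_lt with h0 | hr
  · rw [← h0, sub_eq_zero.1 (abs_eq_zero.1 h0.symm), sub_self, abs_zero,
      Real.zero_rpow (by norm_num), add_zero, mul_zero, add_zero]
    exact modCont_nonneg _ _
  set r := |t - t'| with hrdef
  have hδ : 0 < r ^ (1 / 3 : ℝ) := by positivity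
  have hδ2 : 0 < r ^ (1 / 3 : ℝ) / 2 := by positivity
  have hmid := midrange_isBUC hu hδ2.le
  have hmidM := abs_midrange_le hu.abs_le_supNorm hδ2.le
  refine (abs_schemeInterp_time_le (by linarith) hs' hc hu
    (mollify_isBUC hρ hδ2 hmid.2.continuous hmidM) (abs_mollify_midrange_sub_le hρ hu hδ)
    (abs_truncLap_mollify_le hs hs' hc.1 hδ2 hρ hmid.2.continuous hmidM) ht ht' x).trans ?_
  rw [mul_div_cancel₀ _ two_ne_zero, ← hrdef]
  refine add_le_add_right (le_trans ?_ (mul_rpow_le_timeConst hs hs' hρ (by norm_num) hr)) _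
  -- Mollifying at half the scale costs `2 ^ (2s) ≤ 4`, the source of the factor `4` in the
  -- constant.
  have h2 : (r ^ (1 / 3 : ℝ) / 2) ^ (-(2 * s)) ≤ 4 * (r ^ (1 / 3 : ℝ)) ^ (-(2 * s)) := by
    rw [Real.div_rpow hδ.le two_pos.le, Real.rpow_neg two_pos.le, div_inv_eq_mul, mul_comm]
    refine mul_le_mul_of_nonneg_right ?_ (by positivity)
    have := Real.rpow_le_rpow_of_exponent_le (x := 2) (by norm_num) (by linarith : 2 * s ≤ 2)
    norm_num at this ⊢
    exact this
  have hG : 0 ≤ ∫ x, ‖gradient ρ x‖ := integral_nonneg fun _ => norm_nonneg _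
  have hD : 0 ≤ ∫ x, ‖iteratedFDeriv ℝ 2 ρ x‖ := integral_nonneg fun _ => norm_nonneg _
  have hL := lapConst_pos hs hs'
  have hu0 := supNorm_nonneg u
  calc _ ≤ r * (lapConst s * supNorm u * (∫ x, ‖gradient ρ x‖) ^ (2 - 2 * s)
      * (∫ x, ‖iteratedFDeriv ℝ 2 ρ x‖) ^ (2 * s - 1) * (4 * (r ^ (1 / 3 : ℝ)) ^ (-(2 * s)))) := by
        gcongr
    _ = _ := by ring

theorem exists_isMollifier (n : ℕ) : ∃ ρ : Space n → ℝ, IsMollifier ρ := by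
  let b : ContDiffBump (0 : Space n) := ⟨1 / 2, 1, by norm_num, by norm_num⟩
  refine ⟨b.normed volume, b.contDiff_normed, fun x => b.nonneg_normed x, fun x hx => ?_,
    b.integral_normed⟩
  by_contra h
  have : x ∈ Function.support (b.normed volume) := h
  rw [b.support_normed_eq, mem_ball_zero_iff] at this
  exact absurd (hx.trans this) (lt_irrefl _)

end timeMod

/-! ### Compactness -/

/-- Arzelà–Ascoli: a subsequence converges on a dense sequence by compactness of a product of
intervals, and equicontinuity carries this to all points, locally uniformly. -/
theorem exists_subseq_tendstoLocallyUniformly {X : Type*} [PseudoMetricSpace X]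
    [TopologicalSpace.SeparableSpace X] [Nonempty X] {F : ℕ → X → ℝ} {M : ℝ}
    (hM : ∀ k x, |F k x| ≤ M)
    (hF : ∀ e > 0, ∃ δ > 0, ∀ k x y, dist x y < δ → |F k x - F k y| ≤ e) :
    ∃ (κ : ℕ → ℕ) (u : X → ℝ), StrictMono κ ∧
      TendstoLocallyUniformly (fun k => F (κ k)) u atTop := by
  obtain ⟨a, -, κ, hκ, ha⟩ := (isCompact_univ_pi fun _ : ℕ => isCompact_Icc (a := -M) (b := M)).tendsto_subseq
    (x := fun k i => F k (TopologicalSpace.denseSeq X i)) fun k i _ => abs_le.1 (hM k _)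
  rw [tendsto_pi_nhds] at ha
  have hc : ∀ x, ∃ l, Tendsto (fun k => F (κ k) x) atTop (𝓝 l) := fun x => by
    refine cauchySeq_tendsto_of_complete (Metric.cauchySeq_iff'.2 fun e he => ?_)
    obtain ⟨δ, hδ, h⟩ := hF (e / 4) (by positivity)
    obtain ⟨i, hi⟩ := (TopologicalSpace.denseRange_denseSeq X).exists_dist_lt x hδ
    obtain ⟨N, hN⟩ := Metric.cauchySeq_iff'.1 (ha i).cauchySeq (e / 4) (by positivity)
    refine ⟨N, fun k hk => ?_⟩
    have h1 := abs_le.1 (h (κ k) _ _ hi)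
    have h2 := abs_le.1 (h (κ N) _ _ hi)
    have h3 := hN k hk
    simp only [Function.comp, Real.dist_eq, abs_lt] at h3 ⊢
    constructor <;> linarith
  choose u hu using hc
  refine ⟨κ, u, hκ, ?_⟩
  rw [Metric.tendstoLocallyUniformly_iff]
  intro e he x
  obtain ⟨δ, hδ, h⟩ := hF (e / 4) (by positivity)
  refine ⟨Metric.ball x δ, Metric.ball_mem_nhds x hδ, ?_⟩
  have hx := Metric.tendsto_nhds.1 (hu x) (e / 4) (by positivity)
  filter_upwards [hx] with k hk y hy
  have h1 := abs_le.1 (h (κ k) _ _ hy)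
  have h2 : |u y - u x| ≤ e / 4 :=
    le_of_tendsto ((hu y).sub (hu x)).abs (Eventually.of_forall fun k => h (κ k) _ _ hy)
  rw [abs_le] at h2
  rw [Real.dist_eq, abs_lt] at *
  constructor <;> linarith

/-! ### Test functions -/

/-- The derivative is Lipschitz near `p₀`, and the mean value inequality is applied on the segment
from `p` to `p + v`. Uniformity in the base point matters because the touching points move. -/
theorem exists_taylor {E : Type*} [NormedAddCommGroup E] [NormedSpace ℝ E] {Φ : E → ℝ}
    {B : Set E} {p₀ : E} (hB : IsOpen B) (hp : p₀ ∈ B) (h : ContDiffOn ℝ 2 Φ B) :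
    ∃ r K : ℝ, 0 < r ∧ 0 ≤ K ∧ Metric.closedBall p₀ (2 * r) ⊆ B ∧
      ∀ p ∈ Metric.closedBall p₀ r, ∀ v, ‖v‖ ≤ r →
        |Φ (p + v) - Φ p - fderiv ℝ Φ p v| ≤ K * ‖v‖ ^ 2 := by
  have h1 : ContDiffAt ℝ 1 (fderiv ℝ Φ) p₀ :=
    (h.contDiffAt (hB.mem_nhds hp)).fderiv_right (by norm_num)
  obtain ⟨K, t, ht, hL⟩ := h1.exists_lipschitzOnWith
  obtain ⟨r, hr, hsub⟩ := Metric.nhds_basis_closedBall.mem_iff.1 (inter_mem ht (hB.mem_nhds hp))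
  have hdiff : ∀ q ∈ B, DifferentiableAt ℝ Φ q := fun q hq =>
    (h.contDiffAt (hB.mem_nhds hq)).differentiableAt (by norm_num)
  refine ⟨r / 2, K, by positivity, K.2, ?_, fun p hpr v hv => ?_⟩
  · rw [mul_div_cancel₀ r two_ne_zero]
    exact hsub.trans inter_subset_right
  have hseg : segment ℝ p (p + v) ⊆ Metric.closedBall p₀ r ∩ Metric.closedBall p ‖v‖ := by
    have hpp : p ∈ Metric.closedBall p₀ r := Metric.closedBall_subset_closedBall (by linarith) hpr
    have hd : dist (p + v) p = ‖v‖ := by simp [dist_eq_norm]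
    refine ((convex_closedBall _ _).inter (convex_closedBall _ _)).segment_subset
      ⟨hpp, by simp⟩ ⟨?_, hd.le⟩
    rw [Metric.mem_closedBall] at hpr ⊢
    linarith [dist_triangle (p + v) p p₀]
  have := Convex.norm_image_sub_le_of_norm_hasFDerivWithin_le' (f := Φ) (f' := fderiv ℝ Φ)
    (φ := fderiv ℝ Φ p) (C := K * ‖v‖) (s := segment ℝ p (p + v))
    (fun q hq => (hdiff q (hsub (hseg hq).1).2).hasFDerivAt.hasFDerivWithinAt)
    (fun q hq => by
      rw [← dist_eq_norm]
      refine (hL.dist_le_mul q (hsub (hseg hq).1).1 p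
        (hsub (hseg (left_mem_segment _ _ _)).1).1).trans ?_
      exact mul_le_mul_of_nonneg_left (hseg hq).2 K.2)
    (convex_segment _ _) (left_mem_segment _ _ _) (right_mem_segment _ _ _)
  rw [add_sub_cancel_left, Real.norm_eq_abs] at this
  linarith [sq ‖v‖]

section test
variable {n : ℕ} {s R t₀ T : ℝ} {x₀ : Space n} {φ : Space n → ℝ → ℝ}

theorem isOpen_stBall (x₀ : Space n) (t₀ R : ℝ) : IsOpen (stBall x₀ t₀ R) := by
  have h1 : IsOpen {p : Space n × ℝ | 0 < p.2} := isOpen_lt continuous_const continuous_snd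
  have h2 : IsOpen {p : Space n × ℝ | ‖p.1 - x₀‖ ^ 2 + (p.2 - t₀) ^ 2 < R ^ 2} :=
    isOpen_lt (by fun_prop) continuous_const
  exact h1.inter h2

theorem mem_stBall_center (ht₀ : 0 < t₀) (hR : 0 < R) : (x₀, t₀) ∈ stBall x₀ t₀ R :=
  ⟨ht₀, by simpa using by positivity⟩

/-- A test function is continuous off the lateral boundary of its ball. -/
theorem IsTest.continuousAt (hφ : IsTest x₀ t₀ R φ) {p : Space n × ℝ} (hp : 0 < p.2)
    (h : ‖p.1 - x₀‖ ^ 2 + (p.2 - t₀) ^ 2 ≠ R ^ 2) :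
    ContinuousAt (fun p : Space n × ℝ => φ p.1 p.2) p := by
  rcases h.lt_or_gt with h | h
  · exact hφ.1.continuousOn.continuousAt ((isOpen_stBall x₀ t₀ R).mem_nhds ⟨hp, h⟩)
  · have h1 : IsOpen {p : Space n × ℝ | 0 < p.2} := isOpen_lt continuous_const continuous_snd
    have h2 : IsOpen {p : Space n × ℝ | R ^ 2 < ‖p.1 - x₀‖ ^ 2 + (p.2 - t₀) ^ 2} :=
      isOpen_lt continuous_const (by fun_prop)
    refine hφ.2.1.continuousOn.continuousAt (mem_of_superset ((h1.inter h2).mem_nhds ⟨hp, h⟩) ?_)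
    exact fun q hq => ⟨hq.1, fun hq' => lt_asymm hq'.2 hq.2⟩

/-- A test function may jump across the boundary of its ball; on a line it is glued from two
continuous pieces, hence measurable. -/
theorem IsTest.rayBdd (hφ : IsTest x₀ t₀ R φ) {M : ℝ} (hM : ∀ x t, 0 < t → |φ x t| ≤ M)
    (hT : 0 < T) (x : Space n) : RayBdd (fun z => φ z T) M x := by
  classical
  refine ⟨fun z => hM z T hT, fun y => ?_⟩
  have hline : Continuous fun η : ℝ => ((x + η • y, T) : Space n × ℝ) := by fun_prop
  have h := ContinuousOn.measurable_piecewise (f := fun η : ℝ => φ (x + η • y) T)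
    (g := fun η : ℝ => φ (x + η • y) T)
    (s := (fun η : ℝ => ((x + η • y, T) : Space n × ℝ)) ⁻¹' stBall x₀ t₀ R)
    (hφ.1.continuousOn.comp hline.continuousOn fun η hη => hη)
    (hφ.2.1.continuousOn.comp hline.continuousOn fun η hη => ⟨hT, hη⟩)
    ((isOpen_stBall x₀ t₀ R).preimage hline).measurableSet
  simpa using h

end test

/-! ### Local estimates from the Taylor expansion -/

/-- Data of the first order Taylor expansion with quadratic remainder near `p₀`. -/
structure TaylorNear {n : ℕ} (φ : Space n → ℝ → ℝ) (p₀ : Space n × ℝ) (r K : ℝ) : Prop where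
  pos : 0 < r
  nonneg : 0 ≤ K
  rem : ∀ p ∈ Metric.closedBall p₀ r, ∀ v : Space n × ℝ, ‖v‖ ≤ r →
    |φ (p + v).1 (p + v).2 - φ p.1 p.2 - fderiv ℝ (fun p : Space n × ℝ => φ p.1 p.2) p v|
      ≤ K * ‖v‖ ^ 2

section taylor
variable {n : ℕ} {φ : Space n → ℝ → ℝ} {p₀ : Space n × ℝ} {r K : ℝ}

theorem TaylorNear.ray (h : TaylorNear φ p₀ r K) {x : Space n} {T : ℝ}
    (hx : (x, T) ∈ Metric.closedBall p₀ r) {y : Space n} (hy : ‖y‖ = 1) {η : ℝ} (hη : |η| ≤ r) :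
    |φ (x + η • y) T - φ x T - η * fderiv ℝ (fun p : Space n × ℝ => φ p.1 p.2) (x, T) (y, 0)|
      ≤ K * η ^ 2 := by
  have hv : ‖((η • y, 0) : Space n × ℝ)‖ = |η| := by
    rw [Prod.norm_def, norm_zero, norm_smul, hy, mul_one, Real.norm_eq_abs]
    exact max_eq_left (abs_nonneg _)
  have := h.rem _ hx (η • y, 0) (hv.trans_le hη)
  rw [hv, sq_abs, show ((η • y, 0) : Space n × ℝ) = η • (y, 0) by simp, map_smul, smul_eq_mul]
    at this
  simpa using this

theorem TaylorNear.second (h : TaylorNear φ p₀ r K) {x : Space n} {T : ℝ}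
    (hx : (x, T) ∈ Metric.closedBall p₀ r) {y : Space n} (hy : ‖y‖ = 1) {η : ℝ} (hη : |η| ≤ r) :
    |φ (x + η • y) T + φ (x - η • y) T - 2 * φ x T| ≤ 2 * K * η ^ 2 := by
  have h1 := abs_le.1 (h.ray hx hy hη)
  have h2 := abs_le.1 (h.ray hx hy (η := -η) (by rwa [abs_neg]))
  rw [neg_smul, ← sub_eq_add_neg] at h2
  rw [abs_le]
  constructor <;> nlinarith

theorem TaylorNear.time (h : TaylorNear φ p₀ r K) {x : Space n} {T t : ℝ}
    (hx : (x, T) ∈ Metric.closedBall p₀ r) (htT : |t - T| ≤ r) :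
    |φ x t - φ x T - (t - T) * fderiv ℝ (fun p : Space n × ℝ => φ p.1 p.2) (x, T) (0, 1)|
      ≤ K * (t - T) ^ 2 := by
  have hv : ‖((0, t - T) : Space n × ℝ)‖ = |t - T| := by
    rw [Prod.norm_def, norm_zero, Real.norm_eq_abs]
    exact max_eq_right (abs_nonneg _)
  have := h.rem _ hx (0, t - T) (hv.trans_le htT)
  rw [hv, sq_abs, show ((0, t - T) : Space n × ℝ) = (t - T) • (0, 1) by simp, map_smul,
    smul_eq_mul] at this
  simpa using this

theorem TaylorNear.dir_diff (h : TaylorNear φ p₀ r K) {x : Space n} {T : ℝ}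
    (hx : (x, T) ∈ Metric.closedBall p₀ r) {y z : Space n} (hy : ‖y‖ = 1) (hz : ‖z‖ = 1)
    {η : ℝ} (hη : |η| ≤ r) :
    |φ (x + η • y) T - φ (x + η • z) T
      - η * fderiv ℝ (fun p : Space n × ℝ => φ p.1 p.2) (x, T) (y - z, 0)| ≤ 2 * K * η ^ 2 := by
  have h1 := abs_le.1 (h.ray hx hy hη)
  have h2 := abs_le.1 (h.ray hx hz hη)
  have e : fderiv ℝ (fun p : Space n × ℝ => φ p.1 p.2) (x, T) (y - z, 0)
      = fderiv ℝ (fun p : Space n × ℝ => φ p.1 p.2) (x, T) (y, 0)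
        - fderiv ℝ (fun p : Space n × ℝ => φ p.1 p.2) (x, T) (z, 0) := by
    rw [← map_sub]
    simp
  rw [e, abs_le]
  constructor <;> nlinarith

end taylor

theorem integral_Ioi_eq_indicator {ε : ℝ} (hε : 0 ≤ ε) (f : ℝ → ℝ) :
    ∫ η in Ioi ε, f η = ∫ η in Ioi 0, (Ioi ε).indicator f η := by
  rw [setIntegral_indicator measurableSet_Ioi, Ioi_inter_Ioi, sup_eq_right.2 hε]

/-! ### Passage to the limit in the inequality for test functions -/

section consistency
variable {n : ℕ} {s R t₀ M r K : ℝ} {x₀ : Space n} {φ : Space n → ℝ → ℝ}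
  {x : ℕ → Space n} {T ε : ℕ → ℝ} {y : ℕ → Dir n} {y₀ : Dir n}

/-- Dominated convergence: the majorant comes from the Taylor expansion up to `r` and from
boundedness beyond. -/
theorem tendsto_sym_integral (hs : 0 < s) (hs' : s < 1) (hφ : IsTest x₀ t₀ R φ) (ht₀ : 0 < t₀)
    (hR : 0 < R) (hM : ∀ x t, 0 < t → |φ x t| ≤ M) (hK : TaylorNear φ (x₀, t₀) r K)
    (hx : Tendsto x atTop (𝓝 x₀)) (hT : Tendsto T atTop (𝓝 t₀)) (hε : ∀ m, 0 < ε m)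
    (hε0 : Tendsto ε atTop (𝓝 0)) (hy : Tendsto y atTop (𝓝 y₀)) :
    Tendsto (fun m => ∫ η in Ioi (ε m), (φ (x m + η • (y m : Space n)) (T m)
        + φ (x m - η • (y m : Space n)) (T m) - 2 * φ (x m) (T m)) / η ^ (1 + 2 * s)) atTop
      (𝓝 (∫ η in Ioi (0 : ℝ), (φ (x₀ + η • (y₀ : Space n)) t₀
        + φ (x₀ - η • (y₀ : Space n)) t₀ - 2 * φ x₀ t₀) / η ^ (1 + 2 * s))) := by
  simp_rw [fun m => integral_Ioi_eq_indicator (hε m).le]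
  have hy' : Tendsto (fun m => (y m : Space n)) atTop (𝓝 (y₀ : Space n)) :=
    (continuous_subtype_val.tendsto y₀).comp hy
  have hxT : Tendsto (fun m => (x m, T m)) atTop (𝓝 (x₀, t₀)) := hx.prodMk_nhds hT
  have hTpos : ∀ᶠ m in atTop, 0 < T m := hT.eventually_const_lt ht₀
  have hball : ∀ᶠ m in atTop, (x m, T m) ∈ Metric.closedBall (x₀, t₀) r :=
    hxT.eventually_mem (Metric.closedBall_mem_nhds _ hK.pos)
  have hmeas : Measurable fun η : ℝ => η ^ (1 + 2 * s) := by fun_prop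
  refine tendsto_integral_filter_of_dominated_convergence
    (splitBound s (1 + 2 * s) (2 * K) (4 * M) r) ?_ ?_
    (splitBound_integrable hs' (by linarith) hK.pos) ?_
  · filter_upwards [hTpos] with m hm
    have hb := hφ.rayBdd hM hm (x m)
    have h2 := hb.meas (-(y m : Space n))
    simp_rw [smul_neg, ← sub_eq_add_neg] at h2
    exact ((((hb.meas (y m)).add h2).sub_const _).div hmeas).indicator measurableSet_Ioi
      |>.aestronglyMeasurable
  · filter_upwards [hTpos, hball] with m hm hm2
    refine (ae_restrict_iff' measurableSet_Ioi).2 (Eventually.of_forall fun η hη => ?_)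
    have hη0 : 0 < η := hη
    refine (norm_indicator_le_norm_self _ _).trans ?_
    rw [Real.norm_eq_abs]
    refine abs_div_weight_le_splitBound hη0 (fun h => hK.second hm2 (norm_eq_of_mem_sphere _)
      (by rwa [abs_of_pos hη0])) fun _ => ?_
    rw [sub_self, Real.rpow_zero, mul_one]
    have h1 := abs_le.1 (hM (x m + η • (y m : Space n)) (T m) hm)
    have h2 := abs_le.1 (hM (x m - η • (y m : Space n)) (T m) hm)
    have h3 := abs_le.1 (hM (x m) (T m) hm)
    rw [abs_le]
    constructor <;> linarith
  -- At time `t₀` a ray from the centre meets the boundary of the ball only at `η = R`, a null set;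
  -- elsewhere `φ` is continuous at the limit point.
  · have hne : ∀ᵐ η ∂(volume.restrict (Ioi (0 : ℝ))), η ≠ R :=
      ae_restrict_of_ae (Measure.ae_ne volume R)
    filter_upwards [hne, ae_restrict_mem measurableSet_Ioi] with η hηR hη
    have hη0 : 0 < η := hη
    have hn : ‖η • (y₀ : Space n)‖ = η := by
      rw [norm_smul, norm_eq_of_mem_sphere, Real.norm_of_nonneg hη0.le, mul_one]
    have hsq : η ^ 2 ≠ R ^ 2 := fun h => hηR ((sq_eq_sq₀ hη0.le hR.le).1 h)
    have hc1 : ContinuousAt (fun p : Space n × ℝ => φ p.1 p.2) (x₀ + η • (y₀ : Space n), t₀) :=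
      hφ.continuousAt ht₀ (by simpa [hn] using hsq)
    have hc2 : ContinuousAt (fun p : Space n × ℝ => φ p.1 p.2) (x₀ - η • (y₀ : Space n), t₀) :=
      hφ.continuousAt ht₀ (by simpa [hn] using hsq)
    have hc3 : ContinuousAt (fun p : Space n × ℝ => φ p.1 p.2) (x₀, t₀) :=
      hφ.continuousAt ht₀ (by simpa using (pow_pos hR 2).ne)
    have l1 := hc1.tendsto.comp ((hx.add (hy'.const_smul η)).prodMk_nhds hT)
    have l2 := hc2.tendsto.comp ((hx.sub (hy'.const_smul η)).prodMk_nhds hT)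
    have l3 := hc3.tendsto.comp hxT
    refine (((l1.add l2).sub (l3.const_mul 2)).div_const (η ^ (1 + 2 * s))).congr' ?_
    filter_upwards [hε0.eventually_lt_const hη0] with m hm
    rw [indicator_of_mem (show η ∈ Ioi (ε m) from hm)]
    rfl

theorem integral_Ioc_rpow_neg (hs : 1 / 2 < s) {a b : ℝ} (ha : 0 < a) (hab : a ≤ b) :
    ∫ η in Ioc a b, η ^ (-(2 * s)) = (a ^ (1 - 2 * s) - b ^ (1 - 2 * s)) / (2 * s - 1) := by
  rw [← intervalIntegral.integral_of_le hab, integral_rpow (Or.inr ⟨by linarith, by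
    rw [uIcc_of_le hab]
    exact fun h => absurd h.1 (not_le.2 ha)⟩), show -(2 * s) + 1 = 1 - 2 * s by ring,
    ← neg_div_neg_eq]
  congr 1 <;> ring

theorem integrableOn_Ioc_rpow_neg (s : ℝ) {a b : ℝ} (ha : 0 < a) (hab : a ≤ b) :
    IntegrableOn (fun η : ℝ => η ^ (-(2 * s))) (Ioc a b) :=
  (intervalIntegrable_iff_integrableOn_Ioc_of_le hab).1
    (intervalIntegral.intervalIntegrable_rpow (Or.inr (by
      rw [uIcc_of_le hab]
      exact fun h => absurd h.1 (not_le.2 ha))))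

/-- The difference of two ray integrals is governed by the first order term. -/
theorem rayInt_sub_le (hs : 1 / 2 < s) (hs' : s < 1) {M₀ T₀ e : ℝ} {x₁ : Space n}
    (hb : RayBdd (fun z => φ z T₀) M₀ x₁) {p₀ : Space n × ℝ} (hK : TaylorNear φ p₀ r K)
    (hx₁ : (x₁, T₀) ∈ Metric.closedBall p₀ r) (he : 0 < e) (her : e ≤ r) (y z : Dir n) :
    rayInt s e (fun z => φ z T₀) x₁ y - rayInt s e (fun z => φ z T₀) x₁ z
      ≤ fderiv ℝ (fun p : Space n × ℝ => φ p.1 p.2) (x₁, T₀) ((y : Space n) - z, 0)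
          * ((e ^ (1 - 2 * s) - r ^ (1 - 2 * s)) / (2 * s - 1))
        + ∫ η in Ioi 0, splitBound s (1 + 2 * s) (2 * K) (2 * M₀) r η := by
  set D := fderiv ℝ (fun p : Space n × ℝ => φ p.1 p.2) (x₁, T₀) ((y : Space n) - z, 0)
  have hs0 : 0 < s := by linarith
  have hM0 : 0 ≤ M₀ := (abs_nonneg _).trans (hb.bound x₁)
  have hint := splitBound_integrable (s := s) (q := 1 + 2 * s) (B := 2 * K) (A := 2 * M₀)
    hs' (by linarith) hK.pos
  have hI : IntegrableOn (fun η : ℝ => (Iic r).indicator (fun η => D * η ^ (-(2 * s))) η) (Ioi e) := by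
    rw [IntegrableOn, integrable_indicator_iff measurableSet_Iic, IntegrableOn,
      Measure.restrict_restrict measurableSet_Iic, inter_comm, Ioi_inter_Iic]
    exact (integrableOn_Ioc_rpow_neg s he her).const_mul D
  have hJ : ∫ η in Ioi e, (Iic r).indicator (fun η => D * η ^ (-(2 * s))) η
      = D * ((e ^ (1 - 2 * s) - r ^ (1 - 2 * s)) / (2 * s - 1)) := by
    rw [setIntegral_indicator measurableSet_Iic, Ioi_inter_Iic, integral_const_mul,
      integral_Ioc_rpow_neg hs he her]
  have hmono : ∫ η in Ioi e, splitBound s (1 + 2 * s) (2 * K) (2 * M₀) r η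
      ≤ ∫ η in Ioi 0, splitBound s (1 + 2 * s) (2 * K) (2 * M₀) r η :=
    setIntegral_mono_set hint ((ae_restrict_iff' measurableSet_Ioi).2
      (Eventually.of_forall fun η hη => splitBound_nonneg (by linarith [hK.nonneg])
        (by positivity) hη)) (Ioi_subset_Ioi he.le).eventuallyLE
  refine le_trans ?_ (add_le_add_right hmono _)
  rw [← hJ, ← integral_add hI (hint.mono_set (Ioi_subset_Ioi he.le))]
  unfold rayInt
  rw [← integral_sub (hb.integrable hs0 he y) (hb.integrable hs0 he z)]
  refine setIntegral_mono_on ((hb.integrable hs0 he y).sub (hb.integrable hs0 he z))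
    (hI.add (hint.mono_set (Ioi_subset_Ioi he.le))) measurableSet_Ioi fun η hη => ?_
  have hη0 : 0 < η := he.trans hη
  rw [← sub_div]
  have hw : 0 < η ^ (1 + 2 * s) := Real.rpow_pos_of_pos hη0 _
  rw [← sub_le_iff_le_add']
  rcases le_or_gt η r with h | h
  · rw [indicator_of_mem (by exact h)]
    have e1 : D * η ^ (-(2 * s)) = η * D / η ^ (1 + 2 * s) := by
      rw [weight_eq hη0, mul_comm η D, mul_assoc, ← Real.rpow_one_add' hη0.le (by linarith)]
      congr 2
      ring
    rw [e1, ← sub_div]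
    refine (le_abs_self _).trans (abs_div_weight_le_splitBound hη0 (fun _ => ?_)
      fun h' => absurd h (not_le.2 h'))
    exact hK.dir_diff hx₁ (norm_eq_of_mem_sphere y) (norm_eq_of_mem_sphere z)
      (by rwa [abs_of_pos hη0])
  · rw [indicator_of_notMem (by simpa using h), sub_zero]
    refine (le_abs_self _).trans (abs_div_weight_le_splitBound hη0
      (fun h' => absurd h (not_lt.2 h')) fun _ => ?_)
    rw [sub_self, Real.rpow_zero, mul_one]
    have h1 := abs_le.1 (hb.bound (x₁ + η • (y : Space n)))
    have h2 := abs_le.1 (hb.bound (x₁ + η • (z : Space n)))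
    rw [abs_le]
    constructor <;> linarith

end consistency

theorem tendsto_clm_apply {ι E : Type*} [NormedAddCommGroup E] [NormedSpace ℝ E] {l : Filter ι}
    {A : ι → E →L[ℝ] ℝ} {A₀ : E →L[ℝ] ℝ} {v : ι → E} {v₀ : E} (hA : Tendsto A l (𝓝 A₀))
    (hv : Tendsto v l (𝓝 v₀)) : Tendsto (fun i => A i (v i)) l (𝓝 (A₀ v₀)) :=
  (isBoundedBilinearMap_apply (𝕜 := ℝ) (E := E) (F := ℝ)).continuous.continuousAt.tendsto.comp
    (hA.prodMk_nhds hv)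

section consistency
variable {n : ℕ} {s R t₀ M : ℝ} {x₀ : Space n} {φ : Space n → ℝ → ℝ}
  {x : ℕ → Space n} {T t ε θ : ℕ → ℝ} {y : ℕ → Dir n} {y₀ : Dir n}

theorem IsTest.hasFDerivAt (hφ : IsTest x₀ t₀ R φ) (ht₀ : 0 < t₀) (hR : 0 < R) :
    HasFDerivAt (fun p : Space n × ℝ => φ p.1 p.2)
      (fderiv ℝ (fun p : Space n × ℝ => φ p.1 p.2) (x₀, t₀)) (x₀, t₀) :=
  ((hφ.1.contDiffAt ((isOpen_stBall x₀ t₀ R).mem_nhds (mem_stBall_center ht₀ hR))).differentiableAt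
    (by norm_num)).hasFDerivAt

theorem IsTest.deriv_eq (hφ : IsTest x₀ t₀ R φ) (ht₀ : 0 < t₀) (hR : 0 < R) :
    deriv (fun t => φ x₀ t) t₀
      = fderiv ℝ (fun p : Space n × ℝ => φ p.1 p.2) (x₀, t₀) (0, 1) := by
  have h1 : HasDerivAt (fun t : ℝ => ((x₀, t) : Space n × ℝ)) (0, 1) t₀ :=
    (hasDerivAt_const t₀ x₀).prodMk (hasDerivAt_id t₀)
  exact ((hφ.hasFDerivAt ht₀ hR).comp_hasDerivAt t₀ h1).deriv

theorem IsTest.inner_gradient (hφ : IsTest x₀ t₀ R φ) (ht₀ : 0 < t₀) (hR : 0 < R) (v : Space n) :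
    inner ℝ (gradient (fun x => φ x t₀) x₀) v
      = fderiv ℝ (fun p : Space n × ℝ => φ p.1 p.2) (x₀, t₀) (v, 0) := by
  have h1 : HasFDerivAt (fun x : Space n => ((x, t₀) : Space n × ℝ))
      (ContinuousLinearMap.inl ℝ (Space n) ℝ) x₀ := hasFDerivAt_prodMk_left x₀ t₀
  have h2 := ((hφ.hasFDerivAt ht₀ hR).comp x₀ h1).fderiv
  rw [gradient, InnerProductSpace.toDual_symm_apply]
  change fderiv ℝ ((fun p : Space n × ℝ => φ p.1 p.2) ∘ fun x => (x, t₀)) x₀ v = _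
  rw [h2]
  simp

theorem IsTest.exists_taylorNear (hφ : IsTest x₀ t₀ R φ) (ht₀ : 0 < t₀) (hR : 0 < R) :
    ∃ r K, TaylorNear φ (x₀, t₀) r K := by
  obtain ⟨r, K, hr, hK, -, h⟩ := exists_taylor (isOpen_stBall x₀ t₀ R)
    (mem_stBall_center ht₀ hR) hφ.1
  exact ⟨r, K, hr, hK, h⟩

theorem IsTest.continuousAt_fderiv (hφ : IsTest x₀ t₀ R φ) (ht₀ : 0 < t₀) (hR : 0 < R) :
    ContinuousAt (fderiv ℝ (fun p : Space n × ℝ => φ p.1 p.2)) (x₀, t₀) :=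
  ((hφ.1.contDiffAt ((isOpen_stBall x₀ t₀ R).mem_nhds (mem_stBall_center ht₀ hR))).fderiv_right
    (m := 1) (by norm_num)).continuousAt

/-- The inequality of the scheme passes to the limit when the directions converge. -/
theorem deriv_le_sym_integral (hs : 1 / 2 < s) (hs' : s < 1) (hφ : IsTest x₀ t₀ R φ)
    (ht₀ : 0 < t₀) (hR : 0 < R) (hM : ∀ x t, 0 < t → |φ x t| ≤ M)
    (hx : Tendsto x atTop (𝓝 x₀)) (hT : Tendsto T atTop (𝓝 t₀)) (ht : Tendsto t atTop (𝓝 t₀))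
    (htT : ∀ m, T m < t m) (hε : ∀ m, 0 < ε m) (hε0 : Tendsto ε atTop (𝓝 0))
    (hθ : Tendsto θ atTop (𝓝 0)) (hy : Tendsto y atTop (𝓝 y₀))
    (hineq : ∀ m, φ (x m) (t m) - φ (x m) (T m) ≤ (t m - T m) * (Cs s *
      ((∫ η in Ioi (ε m), (φ (x m + η • (y m : Space n)) (T m)
        + φ (x m - η • (y m : Space n)) (T m) - 2 * φ (x m) (T m)) / η ^ (1 + 2 * s)) + 3 * θ m))) :
    deriv (fun t => φ x₀ t) t₀ ≤ Cs s * ∫ η in Ioi (0 : ℝ), (φ (x₀ + η • (y₀ : Space n)) t₀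
        + φ (x₀ - η • (y₀ : Space n)) t₀ - 2 * φ x₀ t₀) / η ^ (1 + 2 * s) := by
  obtain ⟨r, K, hK⟩ := hφ.exists_taylorNear ht₀ hR
  have hxT : Tendsto (fun m => (x m, T m)) atTop (𝓝 (x₀, t₀)) := hx.prodMk_nhds hT
  have hdt : Tendsto (fun m => t m - T m) atTop (𝓝 0) := by simpa using ht.sub hT
  have hD₀ : Tendsto (fun m => fderiv ℝ (fun p : Space n × ℝ => φ p.1 p.2) (x m, T m)) atTop
      (𝓝 (fderiv ℝ (fun p : Space n × ℝ => φ p.1 p.2) (x₀, t₀))) :=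
    (hφ.continuousAt_fderiv ht₀ hR).tendsto.comp hxT
  have hD := tendsto_clm_apply hD₀
    (tendsto_const_nhds (x := ((0 : Space n), (1 : ℝ))))
  have hI := tendsto_sym_integral (by linarith) hs' hφ ht₀ hR hM hK hx hT hε hε0 hy
  rw [hφ.deriv_eq ht₀ hR]
  have l1 := hD.sub (hdt.const_mul K)
  have l2 := (hI.add (hθ.const_mul 3)).const_mul (Cs s)
  rw [mul_zero, sub_zero] at l1
  rw [mul_zero, add_zero] at l2
  refine le_of_tendsto_of_tendsto l1 l2 ?_
  filter_upwards [hxT.eventually_mem (Metric.closedBall_mem_nhds _ hK.pos),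
    hdt.eventually_le_const hK.pos] with m hm hm2
  have hpos : 0 < t m - T m := sub_pos.2 (htT m)
  have h1 := neg_le_of_abs_le (hK.time hm (by rwa [abs_of_pos hpos]))
  have h2 := hineq m
  refine le_of_mul_le_mul_left ?_ hpos
  refine le_trans ?_ h2
  linarith [sq (t m - T m)]

/-- Limits of nearly maximal directions maximize the first order term. -/
theorem fderiv_sub_nonneg (hs : 1 / 2 < s) (hs' : s < 1) (hφ : IsTest x₀ t₀ R φ)
    (ht₀ : 0 < t₀) (hR : 0 < R) (hM : ∀ x t, 0 < t → |φ x t| ≤ M)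
    (hx : Tendsto x atTop (𝓝 x₀)) (hT : Tendsto T atTop (𝓝 t₀))
    (hε : ∀ m, 0 < ε m) (hε0 : Tendsto ε atTop (𝓝 0))
    (hθ : Tendsto θ atTop (𝓝 0)) (hy : Tendsto y atTop (𝓝 y₀)) {z : Dir n}
    (hmax : ∀ m, rayInt s (ε m) (fun w => φ w (T m)) (x m) z
      ≤ rayInt s (ε m) (fun w => φ w (T m)) (x m) (y m) + θ m) :
    0 ≤ fderiv ℝ (fun p : Space n × ℝ => φ p.1 p.2) (x₀, t₀) ((y₀ : Space n) - z, 0) := by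
  obtain ⟨r, K, hK⟩ := hφ.exists_taylorNear ht₀ hR
  have hxT : Tendsto (fun m => (x m, T m)) atTop (𝓝 (x₀, t₀)) := hx.prodMk_nhds hT
  have hy' : Tendsto (fun m => (y m : Space n)) atTop (𝓝 (y₀ : Space n)) :=
    (continuous_subtype_val.tendsto y₀).comp hy
  have hD₀ : Tendsto (fun m => fderiv ℝ (fun p : Space n × ℝ => φ p.1 p.2) (x m, T m)) atTop
      (𝓝 (fderiv ℝ (fun p : Space n × ℝ => φ p.1 p.2) (x₀, t₀))) :=
    (hφ.continuousAt_fderiv ht₀ hR).tendsto.comp hxT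
  have hD := tendsto_clm_apply hD₀
    ((hy'.sub_const (z : Space n)).prodMk_nhds (tendsto_const_nhds (x := (0 : ℝ))))
  by_contra hneg
  rw [not_le] at hneg
  set D₀ := fderiv ℝ (fun p : Space n × ℝ => φ p.1 p.2) (x₀, t₀) ((y₀ : Space n) - z, 0)
  set Q := ∫ η in Ioi 0, splitBound s (1 + 2 * s) (2 * K) (2 * M) r η
  -- The weight `∫ η ^ (-2s)` over `(ε, r]` of the first order term diverges since `2s > 1`, so a
  -- negative derivative would contradict near maximality.
  have hJ : Tendsto (fun m => ((ε m) ^ (1 - 2 * s) - r ^ (1 - 2 * s)) / (2 * s - 1)) atTop atTop := by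
    have h1 := (tendsto_rpow_neg_nhdsGT_zero (by linarith : 1 - 2 * s < 0)).comp
      (tendsto_nhdsWithin_iff.2 ⟨hε0, Eventually.of_forall hε⟩)
    exact (tendsto_atTop_add_const_right _ (-r ^ (1 - 2 * s)) h1).atTop_div_const (by linarith)
  obtain ⟨m, h1, h2, h3, h4, h5, h6, h7⟩ :=
    ((hxT.eventually_mem (Metric.closedBall_mem_nhds _ hK.pos)).and
    ((hT.eventually_const_lt ht₀).and ((hε0.eventually_le_const hK.pos).and
    ((hD.eventually_lt_const (by linarith : D₀ < D₀ / 2)).and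
    ((hJ.eventually_ge_atTop 0).and ((hθ.eventually_lt_const one_pos).and
    (hJ.eventually_ge_atTop ((1 + Q) / (-(D₀ / 2)))))))))).exists
  have h8 := rayInt_sub_le hs hs' (hφ.rayBdd hM h2 (x m)) hK h1 (hε m) h3 (y m) z
  have h9 := hmax m
  have hc : 0 < -(D₀ / 2) := by linarith
  rw [div_le_iff₀ hc] at h7
  have h10 := mul_le_mul_of_nonneg_right h4.le h5
  change _ ≤ _ + Q at h8
  linarith

theorem bddAbove_sym_integral (hs : 0 < s) (hs' : s < 1) (hφ : IsTest x₀ t₀ R φ)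
    (ht₀ : 0 < t₀) (hR : 0 < R) :
    BddAbove (range fun y : Dir n => ∫ η in Ioi (0 : ℝ), (φ (x₀ + η • (y : Space n)) t₀
        + φ (x₀ - η • (y : Space n)) t₀ - 2 * φ x₀ t₀) / η ^ (1 + 2 * s)) := by
  obtain ⟨r, K, hK⟩ := hφ.exists_taylorNear ht₀ hR
  obtain ⟨M, hM⟩ := hφ.2.2
  refine ⟨∫ η in Ioi 0, splitBound s (1 + 2 * s) (2 * K) (4 * M) r η, ?_⟩
  rintro _ ⟨y, rfl⟩
  refine (le_abs_self _).trans ?_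
  rw [← Real.norm_eq_abs]
  refine norm_integral_le_of_norm_le (splitBound_integrable hs' (by linarith) hK.pos)
    ((ae_restrict_iff' measurableSet_Ioi).2 (Eventually.of_forall fun η hη => ?_))
  have hη0 : 0 < η := hη
  refine abs_div_weight_le_splitBound hη0 (fun h => hK.second
    (Metric.mem_closedBall_self hK.pos.le) (norm_eq_of_mem_sphere _)
      (by rwa [abs_of_pos hη0])) fun _ => ?_
  rw [sub_self, Real.rpow_zero, mul_one]
  have h1 := abs_le.1 (hM (x₀ + η • (y : Space n)) t₀ ht₀)
  have h2 := abs_le.1 (hM (x₀ - η • (y : Space n)) t₀ ht₀)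
  have h3 := abs_le.1 (hM x₀ t₀ ht₀)
  rw [abs_le]
  constructor <;> linarith

/-- Compactness of the sphere gives a limit direction `y₀`. For nonzero gradient it does at least as
well as the gradient direction, so equality holds in Cauchy–Schwarz and the two agree; otherwise it
is absorbed by the supremum. -/
theorem test_consistency (hs : 1 / 2 < s) (hs' : s < 1) (hφ : IsTest x₀ t₀ R φ)
    (ht₀ : 0 < t₀) (hR : 0 < R)
    (hx : Tendsto x atTop (𝓝 x₀)) (hT : Tendsto T atTop (𝓝 t₀)) (ht : Tendsto t atTop (𝓝 t₀))
    (htT : ∀ m, T m < t m) (hε : ∀ m, 0 < ε m) (hε0 : Tendsto ε atTop (𝓝 0))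
    (hθ : Tendsto θ atTop (𝓝 0))
    (hineq : ∀ m, φ (x m) (t m) - φ (x m) (T m) ≤ (t m - T m) * (Cs s *
      ((∫ η in Ioi (ε m), (φ (x m + η • (y m : Space n)) (T m)
        + φ (x m - η • (y m : Space n)) (T m) - 2 * φ (x m) (T m)) / η ^ (1 + 2 * s)) + 3 * θ m)))
    (hmax : ∀ m (z : Dir n), rayInt s (ε m) (fun w => φ w (T m)) (x m) z
      ≤ rayInt s (ε m) (fun w => φ w (T m)) (x m) (y m) + θ m) :
    (gradient (fun x => φ x t₀) x₀ ≠ 0 →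
      deriv (fun t => φ x₀ t) t₀ ≤ infLap s (fun x => φ x t₀) x₀) ∧
    (gradient (fun x => φ x t₀) x₀ = 0 →
      deriv (fun t => φ x₀ t) t₀ ≤ infLapSup s (fun x => φ x t₀) x₀) := by
  obtain ⟨M, hM⟩ := hφ.2.2
  obtain ⟨y₀, κ, hκ, hy⟩ := CompactSpace.tendsto_subseq y
  have hκ' := hκ.tendsto_atTop
  have hle := deriv_le_sym_integral hs hs' hφ ht₀ hR hM (hx.comp hκ') (hT.comp hκ') (ht.comp hκ')
    (fun m => htT (κ m)) (fun m => hε (κ m)) (hε0.comp hκ') (hθ.comp hκ') hy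
    (fun m => hineq (κ m))
  have hC := Cs_pos (by linarith : 0 < s) hs'
  refine ⟨fun hg => ?_, fun _ => hle.trans ?_⟩
  · set g := gradient (fun x => φ x t₀) x₀ with hgdef
    have hg0 : 0 < ‖g‖ := norm_pos_iff.2 hg
    have hζ : ‖‖g‖⁻¹ • g‖ = 1 := by
      rw [norm_smul, norm_inv, norm_norm, inv_mul_cancel₀ hg0.ne']
    have h1 := fderiv_sub_nonneg hs hs' hφ ht₀ hR hM (hx.comp hκ') (hT.comp hκ')
      (fun m => hε (κ m)) (hε0.comp hκ') (hθ.comp hκ') hy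
      (z := ⟨‖g‖⁻¹ • g, mem_sphere_zero_iff_norm.2 hζ⟩) (fun m => hmax (κ m) _)
    rw [← hφ.inner_gradient ht₀ hR, ← hgdef, inner_sub_right, inner_smul_right,
      real_inner_self_eq_norm_sq] at h1
    have h2 : 1 ≤ inner ℝ (‖g‖⁻¹ • g) (y₀ : Space n) := by
      rw [real_inner_smul_left]
      have : ‖g‖⁻¹ * ‖g‖ ^ 2 = ‖g‖ := by field_simp
      rw [this] at h1
      rw [← div_eq_inv_mul, le_div_iff₀ hg0]
      linarith
    have hy1 : ‖(y₀ : Space n)‖ = 1 := norm_eq_of_mem_sphere y₀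
    have h3 : inner ℝ (‖g‖⁻¹ • g) (y₀ : Space n) ≤ 1 :=
      (real_inner_le_norm _ _).trans_eq (by rw [hζ, hy1, one_mul])
    have h4 : ‖g‖⁻¹ • g = y₀ := (inner_eq_one_iff_of_norm_eq_one hζ hy1).1 (le_antisymm h3 h2)
    rw [infLap, if_pos hg, ← hgdef, h4]
    exact hle
  · exact mul_le_mul_of_nonneg_left
      (le_ciSup (bddAbove_sym_integral (by linarith) hs' hφ ht₀ hR) y₀) hC.le

end consistency

/-- If a step of the scheme from `U` lies above `a + m` at `x`, and `U` lies below `ψ + m` up to a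
small error, then `ψ` satisfies the inequality of the scheme along a nearly maximal direction. -/
theorem eulerStep_touch {n : ℕ} [Nonempty (Dir n)] {s ε τ M N a m θ : ℝ} {U ψ : Space n → ℝ}
    {x : Space n} (hs : 0 < s) (hs' : s < 1) (hε : 0 < ε) (hτ₀ : 0 < τ)
    (hτ : τ ≤ s / Cs s * ε ^ (2 * s)) (hU : RayBdd U M x) (hψ : RayBdd ψ N x)
    (hθ : 0 < θ) {e : ℝ → ℝ} (he : IntegrableOn (fun η : ℝ => e η / η ^ (1 + 2 * s)) (Ioi ε))
    (heθ : ∫ η in Ioi ε, e η / η ^ (1 + 2 * s) ≤ θ) (hx : U x ≤ ψ x + m)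
    (hray : ∀ (y : Dir n) (η : ℝ), ε < η →
      U (x + η • (y : Space n)) ≤ ψ (x + η • (y : Space n)) + (m + e η))
    (ha : a + m ≤ eulerStep s ε τ U x) :
    ∃ y : Dir n, a - ψ x ≤ τ * (Cs s * ((∫ η in Ioi ε, (ψ (x + η • (y : Space n))
        + ψ (x - η • (y : Space n)) - 2 * ψ x) / η ^ (1 + 2 * s)) + 3 * θ)) ∧
      ∀ z : Dir n, rayInt s ε ψ x z ≤ rayInt s ε ψ x y + θ := by
  have hC := Cs_pos hs hs'
  have hcfl := cfl_le hs hs' hε hτ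
  obtain ⟨y, hy⟩ := exists_lt_of_lt_ciSup
    (show (⨆ y : Dir n, rayInt s ε ψ x y) - θ < ⨆ y : Dir n, rayInt s ε ψ x y by linarith)
  have hmax : ∀ z : Dir n, rayInt s ε ψ x z ≤ rayInt s ε ψ x y + θ := fun z => by
    have := le_ciSup (hψ.bddAbove hs hε) z
    linarith
  refine ⟨y, ?_, hmax⟩
  rw [hψ.sym_integral hs hε]
  rw [hU.eulerStep_eq hs hε] at ha
  set w := ε ^ (-(2 * s)) / (2 * s) with hw
  have hw2 : ε ^ (-(2 * s)) / s = 2 * w := by rw [hw]; field_simp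
  rw [hw2] at ha hcfl ⊢
  have hcomp : ∀ z : Dir n, rayInt s ε U x z ≤ rayInt s ε ψ x z + (m * w + θ) := fun z => by
    have h0 : IntegrableOn (fun η : ℝ => (m + e η) / η ^ (1 + 2 * s)) (Ioi ε) := by
      simp_rw [add_div]
      exact (weight_integrable hs hε m).add he
    have h1 := hU.rayInt_le hψ hs hε h0 (hray z)
    simp_rw [add_div] at h1
    rw [integral_add (weight_integrable hs hε m) he, weight_integral hs hε, ← hw] at h1
    linarith
  -- One `θ` comes from near maximality of `y`, one from each comparison of `U` with `ψ` in `hsup`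
  -- and `hinf`: in total `3 * θ`.
  have hsup : (⨆ y : Dir n, rayInt s ε U x y) ≤ rayInt s ε ψ x y + θ + (m * w + θ) :=
    ciSup_le fun z => (hcomp z).trans (by linarith [hmax z])
  -- The infimum is tested at `-y`, which completes the ray along `y` to a symmetric integral.
  have hinf : (⨅ y : Dir n, rayInt s ε U x y) ≤ rayInt s ε ψ x (-(y : Space n)) + (m * w + θ) := by
    have := (ciInf_le (hU.bddBelow hs hε) (-y)).trans (hcomp (-y))
    rwa [coe_neg_sphere] at this
  have h1 := mul_le_mul_of_nonneg_left hx (by linarith : 0 ≤ 1 - τ * Cs s * (2 * w))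
  have h2 := mul_le_mul_of_nonneg_left (add_le_add hsup hinf)
    (by positivity : 0 ≤ τ * Cs s)
  nlinarith

theorem tail_indicator_integral {s a ε : ℝ} (hs : 0 < s) (hε : 0 < ε) (ha : ε ≤ a) (c : ℝ) :
    IntegrableOn (fun η : ℝ => (Ioi a).indicator (fun _ => c) η / η ^ (1 + 2 * s)) (Ioi ε) ∧
    ∫ η in Ioi ε, (Ioi a).indicator (fun _ => c) η / η ^ (1 + 2 * s)
      = c * (a ^ (-(2 * s)) / (2 * s)) := by
  have e : (fun η : ℝ => (Ioi a).indicator (fun _ => c) η / η ^ (1 + 2 * s))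
      = (Ioi a).indicator fun η => c / η ^ (1 + 2 * s) := by
    funext η
    by_cases h : η ∈ Ioi a
    · rw [indicator_of_mem h, indicator_of_mem h]
    · rw [indicator_of_notMem h, indicator_of_notMem h, zero_div]
  have hset : Ioi a ∩ Ioi ε = Ioi a := by rw [Ioi_inter_Ioi, sup_eq_left.2 ha]
  constructor
  · rw [e, IntegrableOn, integrable_indicator_iff measurableSet_Ioi, IntegrableOn,
      Measure.restrict_restrict measurableSet_Ioi, hset]
    exact weight_integrable hs (hε.trans_le ha) c
  · rw [e, setIntegral_indicator measurableSet_Ioi, inter_comm, hset,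
      weight_integral hs (hε.trans_le ha)]

/-- A version of `eulerStep_touch` in which `U` lies below `ψ + m` on a ball of radius `ρ`, with an
error `b` up to radius `N` and an error `c` beyond. -/
theorem eulerStep_touch_of_balls {n : ℕ} [Nonempty (Dir n)] {s ε τ M M' a m θ ρ N b c : ℝ}
    {U ψ : Space n → ℝ} {x : Space n} (hs : 0 < s) (hs' : s < 1) (hε : 0 < ε) (hτ₀ : 0 < τ)
    (hτ : τ ≤ s / Cs s * ε ^ (2 * s)) (hU : RayBdd U M x) (hψ : RayBdd ψ M' x) (hθ : 0 < θ)
    (hερ : ε ≤ ρ) (hρN : ρ ≤ N) (hb : 0 ≤ b) (hbθ : b * (ρ ^ (-(2 * s)) / (2 * s)) ≤ θ / 2)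
    (hcθ : c * (N ^ (-(2 * s)) / (2 * s)) ≤ θ / 2)
    (hnear : ∀ z, dist z x ≤ ρ → U z ≤ ψ z + m) (hmid : ∀ z, dist z x ≤ N → U z ≤ ψ z + (m + b))
    (hfar : ∀ z, U z ≤ ψ z + (m + c)) (ha : a + m ≤ eulerStep s ε τ U x) :
    ∃ y : Dir n, a - ψ x ≤ τ * (Cs s * ((∫ η in Ioi ε, (ψ (x + η • (y : Space n))
        + ψ (x - η • (y : Space n)) - 2 * ψ x) / η ^ (1 + 2 * s)) + 3 * θ)) ∧
      ∀ z : Dir n, rayInt s ε ψ x z ≤ rayInt s ε ψ x y + θ := by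
  obtain ⟨hi1, hI1⟩ := tail_indicator_integral hs hε hερ b
  obtain ⟨hi2, hI2⟩ := tail_indicator_integral hs hε (hερ.trans hρN) c
  refine eulerStep_touch hs hs' hε hτ₀ hτ hU hψ hθ
    (e := fun η => (Ioi ρ).indicator (fun _ => b) η + (Ioi N).indicator (fun _ => c) η)
    (by simp_rw [add_div]; exact hi1.add hi2) ?_ (hnear x (by
      rw [dist_self]; linarith)) (fun y η hη => ?_) ha
  · simp_rw [add_div]
    rw [integral_add hi1 hi2, hI1, hI2]
    linarith
  have hη0 : 0 < η := hε.trans hη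
  have hdist : dist (x + η • (y : Space n)) x = η := by
    rw [dist_eq_norm, add_sub_cancel_left, norm_smul, norm_eq_of_mem_sphere, mul_one,
      Real.norm_of_nonneg hη0.le]
  rcases le_or_gt η ρ with h | h
  · rw [indicator_of_notMem (by simpa using h),
      indicator_of_notMem (by simpa using h.trans hρN), add_zero, add_zero]
    exact hnear _ (hdist.trans_le h)
  · rw [indicator_of_mem (by exact h)]
    rcases le_or_gt η N with h' | h'
    · rw [indicator_of_notMem (by simpa using h'), add_zero]
      exact hmid _ (hdist.trans_le h')
    · rw [indicator_of_mem (by exact h')]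
      linarith [hfar (x + η • (y : Space n))]

theorem eventually_abs_sub_le {n : ℕ} {w : ℕ → Space n → ℝ → ℝ} {u : Space n → ℝ → ℝ}
    (hconv : TendstoLocallyUniformlyOn (fun k (p : Space n × ℝ) => w k p.1 p.2)
      (fun p => u p.1 p.2) atTop (univ ×ˢ Ici 0))
    {C : Set (Space n × ℝ)} (hC : IsCompact C) (hC0 : ∀ p ∈ C, 0 ≤ p.2) {σ : ℝ} (hσ : 0 < σ) :
    ∀ᶠ k in atTop, ∀ p ∈ C, |w k p.1 p.2 - u p.1 p.2| ≤ σ := by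
  have h := (tendstoLocallyUniformlyOn_iff_tendstoUniformlyOn_of_compact hC).1
    (hconv.mono fun p hp => ⟨mem_univ _, hC0 p hp⟩)
  filter_upwards [Metric.tendstoUniformlyOn_iff.1 h σ hσ] with k hk p hp
  have := hk p hp
  rw [dist_comm, Real.dist_eq] at this
  exact this.le

theorem exists_gap {X : Type*} [TopologicalSpace X] {S : Set X} (hS : IsCompact S) {f : X → ℝ}
    (hf : ContinuousOn f S) {V : ℝ} (h : ∀ x ∈ S, f x < V) : ∃ γ > 0, ∀ x ∈ S, f x ≤ V - γ := by
  rcases S.eq_empty_or_nonempty with rfl | hne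
  · exact ⟨1, one_pos, by simp⟩
  · obtain ⟨q, hq, hmax⟩ := hS.exists_isMaxOn hne hf
    exact ⟨V - f q, sub_pos.2 (h q hq), fun x hx => by
      have := hmax hx
      change f x ≤ f q at this
      linarith⟩

/-- Maxima of a perturbation of `g` are close to a strict maximum of `g`. -/
theorem exists_near_max {X : Type*} [PseudoMetricSpace X] {C : Set X} (hC : IsCompact C) {p₀ : X}
    (hp₀ : p₀ ∈ C) {f g : X → ℝ} (hf : ContinuousOn f C) {δ γ : ℝ} (hγ : 0 < γ)
    (hfg : ∀ p ∈ C, |f p - g p| ≤ γ / 3)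
    (hgap : ∀ p ∈ C \ Metric.ball p₀ δ, g p ≤ g p₀ - γ) :
    ∃ p ∈ C, dist p p₀ < δ ∧ ∀ q ∈ C, f q ≤ f p := by
  obtain ⟨p, hp, hmax⟩ := hC.exists_isMaxOn ⟨p₀, hp₀⟩ hf
  have hmax' : ∀ q ∈ C, f q ≤ f p := fun q hq => hmax hq
  refine ⟨p, hp, ?_, hmax'⟩
  by_contra h
  have h1 := hgap p ⟨hp, h⟩
  linarith [hmax' p₀ hp₀, le_of_abs_le (hfg p hp), neg_le_of_abs_le (hfg p₀ hp₀)]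

/-! ### Limits of the scheme are subsolutions -/

section limit
variable {n : ℕ} [Nonempty (Dir n)] {s : ℝ} {ε τ : ℕ → ℝ} {u₀ : Space n → ℝ}
  {u : Space n → ℝ → ℝ}

theorem tendsto_tau (hs : 0 < s) (hc : ∀ k, IsCFL s (ε k) (τ k))
    (hε0 : Tendsto ε atTop (𝓝 0)) : Tendsto τ atTop (𝓝 0) := by
  have h1 : Tendsto (fun k => s / Cs s * ε k ^ (2 * s)) atTop (𝓝 0) := by
    have := (hε0.rpow_const (p := 2 * s) (Or.inr (by linarith))).const_mul (s / Cs s)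
    rwa [Real.zero_rpow (by linarith), mul_zero] at this
  exact squeeze_zero (fun k => (hc k).2.1.le) (fun k => (hc k).2.2) h1

/-- One parameter `d` bounds all distances and errors, so that a sequence `d → 0` feeds
`test_consistency`. -/
theorem exists_touching (hs : 1 / 2 < s) (hs' : s < 1) (hu₀ : IsBUC u₀)
    (hc : ∀ k, IsCFL s (ε k) (τ k)) (hε0 : Tendsto ε atTop (𝓝 0))
    (hconv : TendstoLocallyUniformlyOn
      (fun k (p : Space n × ℝ) => schemeInterp s (ε k) (τ k) u₀ p.1 p.2)
      (fun p => u p.1 p.2) atTop (univ ×ˢ Ici 0))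
    (hwc : ∀ k, ContinuousOn
      (fun p : Space n × ℝ => schemeInterp s (ε k) (τ k) u₀ p.1 p.2) (univ ×ˢ Ici 0))
    {M : ℝ} (huM : ∀ x t, 0 ≤ t → |u x t| ≤ M) (hu₀M : ∀ x, |u₀ x| ≤ M)
    {x₀ : Space n} {t₀ R : ℝ} {φ : Space n → ℝ → ℝ} (ht₀ : 0 < t₀) (hR : 0 < R)
    (hφ : IsTest x₀ t₀ R φ)
    (hstrict : ∀ x t, (x, t) ∈ stBall x₀ t₀ R → (x, t) ≠ (x₀, t₀) →
      u x t - φ x t < u x₀ t₀ - φ x₀ t₀)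
    (hout : ∀ x t, (x, t) ∈ posTime n \ stBall x₀ t₀ R →
      u x t - φ x t ≤ u x₀ t₀ - φ x₀ t₀) {d : ℝ} (hd : 0 < d) :
    ∃ (x : Space n) (t T e : ℝ) (y : Dir n), dist x x₀ < d ∧ |t - t₀| < d ∧ |T - t₀| < d ∧ T < t ∧
      0 < e ∧ e < d ∧
      φ x t - φ x T ≤ (t - T) * (Cs s * ((∫ η in Ioi e, (φ (x + η • (y : Space n)) T
        + φ (x - η • (y : Space n)) T - 2 * φ x T) / η ^ (1 + 2 * s)) + 3 * d)) ∧
      ∀ z : Dir n, rayInt s e (fun w => φ w T) x z ≤ rayInt s e (fun w => φ w T) x y + d := by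
  have hs0 : 0 < s := by linarith
  obtain ⟨Mφ, hMφ⟩ := hφ.2.2
  have hM0 : 0 ≤ M := (abs_nonneg _).trans (hu₀M 0)
  set p₀ : Space n × ℝ := (x₀, t₀) with hp₀
  have hB := isOpen_stBall x₀ t₀ R
  obtain ⟨r, hr, hrB⟩ := Metric.nhds_basis_closedBall.mem_iff.1
    (hB.mem_nhds (mem_stBall_center (x₀ := x₀) ht₀ hR))
  set C : Set (Space n × ℝ) := Metric.closedBall p₀ r with hCdef
  have hC : IsCompact C := isCompact_closedBall _ _
  have hC0 : ∀ p ∈ C, 0 < p.2 := fun p hp => (hrB hp).1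
  have hCsub : C ⊆ univ ×ˢ Ici 0 := fun p hp => ⟨mem_univ _, (hC0 p hp).le⟩
  have hΦC : ContinuousOn (fun p : Space n × ℝ => φ p.1 p.2) C := hφ.1.continuousOn.mono hrB
  have huC : ContinuousOn (fun p : Space n × ℝ => u p.1 p.2) C :=
    (hconv.continuousOn (Eventually.of_forall hwc).frequently).mono hCsub
  set V := u x₀ t₀ - φ x₀ t₀ with hV
  have hglob : ∀ x t, 0 < t → u x t - φ x t ≤ V := fun x t ht => by
    by_cases h : (x, t) ∈ stBall x₀ t₀ R
    · by_cases h' : (x, t) = (x₀, t₀)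
      · obtain ⟨rfl, rfl⟩ := Prod.mk.inj h'
        exact le_rfl
      · exact (hstrict x t h h').le
    · exact hout x t ⟨ht, h⟩
  obtain ⟨d', hd'0, hd'd, hd'r, hd't, hd'1⟩ :
      ∃ d' > 0, d' ≤ d / 2 ∧ d' ≤ r / 2 ∧ d' ≤ t₀ / 4 ∧ d' ≤ 1 / 2 :=
    ⟨min (min (d / 2) (r / 2)) (min (t₀ / 4) (1 / 2)), by positivity,
      (min_le_left _ _).trans (min_le_left _ _), (min_le_left _ _).trans (min_le_right _ _),
      (min_le_right _ _).trans (min_le_left _ _), (min_le_right _ _).trans (min_le_right _ _)⟩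
  obtain ⟨γ, hγ, hgap⟩ := exists_gap (S := C \ Metric.ball p₀ d') (hC.diff Metric.isOpen_ball)
    (f := fun p => u p.1 p.2 - φ p.1 p.2) ((huC.sub hΦC).mono sdiff_subset) (V := V)
    (fun p hp => hstrict p.1 p.2 (hrB hp.1) fun h => hp.2 (by
      have : p = p₀ := h
      rw [this]; exact Metric.mem_ball_self hd'0))
  set A := (r / 2) ^ (-(2 * s)) with hA
  have hA0 : 0 < A := by positivity
  -- Beyond `N` the limit and the scheme are compared only through their bounds, with error `4 * M`;
  -- `N` makes this tail contribute at most `d / 2`.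
  obtain ⟨N, hN, hNr⟩ : ∃ N : ℝ, 4 * M * (N ^ (-(2 * s)) / (2 * s)) ≤ d / 2 ∧ r / 2 ≤ N := by
    have h1 := ((tendsto_rpow_neg_atTop (by linarith : 0 < 2 * s)).div_const (2 * s)).const_mul
      (4 * M)
    rw [zero_div, mul_zero] at h1
    exact ((h1.eventually_le_const (by positivity)).and (eventually_ge_atTop (r / 2))).exists
  -- Between `r / 2` and `N` uniform convergence within `σ` is used at two points; this value makes
  -- `2 * σ` contribute exactly `d / 2`.
  set σ := d * s / (2 * A) with hσdef
  have hσ : 0 < σ := by positivity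
  have hσA : 2 * σ * (A / (2 * s)) = d / 2 := by rw [hσdef]; field_simp
  have hC' : IsCompact (Metric.closedBall x₀ (N + 1) ×ˢ Icc 0 (t₀ + 1)) :=
    (isCompact_closedBall _ _).prod isCompact_Icc
  obtain ⟨k, hk1, hk2, hk3, hk4, hk5⟩ := ((eventually_abs_sub_le hconv hC (fun p hp => (hC0 p hp).le)
    (by positivity : 0 < γ / 3)).and ((eventually_abs_sub_le hconv hC' (fun p hp => hp.2.1) hσ).and
    (((tendsto_tau hs0 hc hε0).eventually_lt_const hd'0).and
    ((hε0.eventually_lt_const hd).and (hε0.eventually_lt_const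
      (by positivity : 0 < r / 2)))))).exists
  obtain ⟨hε, hτ, hcfl⟩ := hc k
  set w := schemeInterp s (ε k) (τ k) u₀ with hw
  have hwM : ∀ x t, 0 ≤ t → |w x t| ≤ M := fun x t ht =>
    abs_schemeInterp_le hs0 hs' (hc k) hu₀ hu₀M ht x
  have hp₀C : p₀ ∈ C := Metric.mem_closedBall_self hr.le
  obtain ⟨⟨x, t⟩, hxC, hnear, hmax⟩ := exists_near_max (f := fun p => w p.1 p.2 - φ p.1 p.2)
    (g := fun p => u p.1 p.2 - φ p.1 p.2) (δ := d') hC hp₀C (((hwc k).mono hCsub).sub hΦC) hγ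
    (fun p hp => by
      rw [sub_sub_sub_cancel_right]
      exact hk1 p hp) hgap
  have hmax' : ∀ z T, (z, T) ∈ C → w z T - φ z T ≤ w x t - φ x t := fun z T h => hmax (z, T) h
  have hm0 := hmax' x₀ t₀ hp₀C
  rw [Prod.dist_eq, max_lt_iff] at hnear
  obtain ⟨hxn, htn⟩ := hnear
  change dist x x₀ < d' at hxn
  change |t - t₀| < d' at htn
  have htpos : 0 < t := hC0 _ hxC
  obtain ⟨j, hj1, hj2, hj3⟩ := exists_last_step (n := n) (s := s) (ε := ε k) (u := u₀) hτ htpos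
  set T := j * τ k with hT
  have htn' := abs_lt.1 htn
  have hTt : t - T ≤ τ k := by linarith
  have hTn : |T - t₀| < 2 * d' := abs_lt.2 ⟨by linarith, by linarith⟩
  have hTn' := abs_lt.1 hTn
  have hT0 : 0 < T := by linarith
  set m := w x t - φ x t with hm
  have hU : ∀ z, schemeStep s (ε k) (τ k) u₀ j z = w z T := fun z =>
    (schemeInterp_node hτ j z).symm
  -- The error is `2 * c` because convergence is used at `(z, T)` and at `(x₀, t₀)`, where `m` is
  -- compared with the maximum of `u - φ`.
  have hfar : ∀ z {c : ℝ}, |w z T - u z T| ≤ c → |w x₀ t₀ - u x₀ t₀| ≤ c →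
      w z T ≤ φ z T + (m + 2 * c) := fun z c h1 h2 => by
    linarith [hglob z T hT0, le_of_abs_le h1, neg_le_of_abs_le h2]
  have hclose : ∀ z, dist z x₀ ≤ r → w z T ≤ φ z T + m := fun z hz => by
    have := hmax' z T (by
      rw [hCdef, Metric.mem_closedBall, Prod.dist_eq, max_le_iff]
      exact ⟨hz, by
        change |T - t₀| ≤ r
        linarith⟩)
    linarith
  have h2M : ∀ z t, 0 ≤ t → |w z t - u z t| ≤ 2 * M := fun z t ht => by
    have h1 := abs_le.1 (hwM z t ht)
    have h2 := abs_le.1 (huM z t ht)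
    rw [abs_le]
    constructor <;> linarith
  obtain ⟨y, hy1, hy2⟩ := eulerStep_touch_of_balls (a := φ x t) (m := m) (θ := d) (ρ := r / 2)
    (N := N) (b := 2 * σ) (c := 4 * M) hs0 hs' hε (sub_pos.2 hj1) (hTt.trans hcfl)
    (RayBdd.schemeStep hs0 hs' (hc k) hu₀ hu₀M j x) (hφ.rayBdd hMφ hT0 x) hd hk5.le hNr
    (by positivity) hσA.le hN
    (fun z hz => by
      rw [hU]
      exact hclose z (by linarith [dist_triangle z x x₀]))
    (fun z hz => by
      rw [hU]
      refine hfar _ (hk2 (z, T) ⟨?_, hT0.le, by linarith⟩) (hk2 p₀ ⟨?_, ht₀.le, by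
        change t₀ ≤ t₀ + 1
        linarith⟩)
      · rw [Metric.mem_closedBall]
        linarith [dist_triangle z x x₀]
      · exact Metric.mem_closedBall_self (by linarith))
    (fun z => by
      rw [hU]
      linarith [hfar z (h2M z T hT0.le) (h2M x₀ t₀ ht₀.le)])
    (by
      rw [← hj3, hm]
      linarith)
  exact ⟨x, t, T, ε k, y, by linarith, by linarith, by linarith, hj1, hε, hk4, hy1, hy2⟩

/-- Locally uniform limits of the scheme are viscosity subsolutions. -/
theorem isViscSub_of_tendsto (hs : 1 / 2 < s) (hs' : s < 1) (hu₀ : IsBUC u₀)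
    (hc : ∀ k, IsCFL s (ε k) (τ k)) (hε0 : Tendsto ε atTop (𝓝 0))
    (hconv : TendstoLocallyUniformlyOn
      (fun k (p : Space n × ℝ) => schemeInterp s (ε k) (τ k) u₀ p.1 p.2)
      (fun p => u p.1 p.2) atTop (univ ×ˢ Ici 0))
    (hwc : ∀ k, ContinuousOn
      (fun p : Space n × ℝ => schemeInterp s (ε k) (τ k) u₀ p.1 p.2) (univ ×ˢ Ici 0))
    {M : ℝ} (huM : ∀ x t, 0 ≤ t → |u x t| ≤ M) (hu₀M : ∀ x, |u₀ x| ≤ M) : IsViscSub s u := by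
  refine ⟨⟨M, fun x t ht => huM x t ht.le⟩, ?_, ?_⟩
  · exact ((hconv.continuousOn (Eventually.of_forall hwc).frequently).mono
      fun p hp => ⟨mem_univ _, (show 0 < p.2 from hp).le⟩).upperSemicontinuousOn
  intro x₀ t₀ R φ ht₀ hR hφ hstrict hout
  choose x t T e y h1 h2 h3 h4 h5 h6 h7 h8 using fun m : ℕ =>
    exists_touching hs hs' hu₀ hc hε0 hconv hwc huM hu₀M ht₀ hR hφ hstrict hout
      (d := 1 / ((m : ℝ) + 1)) Nat.one_div_pos_of_nat
  have hlim : Tendsto (fun m : ℕ => 1 / ((m : ℝ) + 1)) atTop (𝓝 0) :=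
    tendsto_one_div_add_atTop_nhds_zero_nat
  exact test_consistency hs hs' hφ ht₀ hR
    (tendsto_iff_dist_tendsto_zero.2 (squeeze_zero (fun _ => dist_nonneg) (fun m => (h1 m).le) hlim))
    (tendsto_iff_dist_tendsto_zero.2 (squeeze_zero (fun _ => dist_nonneg) (fun m => (h3 m).le) hlim))
    (tendsto_iff_dist_tendsto_zero.2 (squeeze_zero (fun _ => dist_nonneg) (fun m => (h2 m).le) hlim))
    h4 h5 (squeeze_zero (fun m => (h5 m).le) (fun m => (h6 m).le) hlim) hlim h7 h8

end limit

/-! ### Reflection -/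

section reflection
variable {n : ℕ} {s : ℝ} {u : Space n → ℝ → ℝ}

theorem gradient_neg (f : Space n → ℝ) (x : Space n) :
    gradient (fun z => -f z) x = -gradient f x := by
  simp [gradient, fderiv_fun_neg]

theorem infLapSup_neg (s : ℝ) (f : Space n → ℝ) (x : Space n) :
    infLapSup s (fun z => -f z) x = -infLapInf s f x := by
  have e : ∀ (y : Dir n) (η : ℝ), (-f (x + η • (y : Space n)) + -f (x - η • (y : Space n))
      - 2 * -f x) / η ^ (1 + 2 * s) = -((f (x + η • (y : Space n)) + f (x - η • (y : Space n))
      - 2 * f x) / η ^ (1 + 2 * s)) := fun y η => by ring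
  unfold infLapSup infLapInf
  simp_rw [e, integral_neg]
  rw [real_iSup_neg, mul_neg]

/-- The gradient direction is reversed, which only exchanges the two rays. -/
theorem infLap_neg (s : ℝ) {f : Space n → ℝ} {x : Space n} (hg : gradient f x ≠ 0) :
    infLap s (fun z => -f z) x = -infLap s f x := by
  rw [infLap, if_pos (by rw [gradient_neg]; exact neg_ne_zero.2 hg), infLap, if_pos hg,
    gradient_neg, norm_neg, ← mul_neg, ← integral_neg]
  congr 2
  funext η
  simp only [smul_neg, sub_neg_eq_add, ← sub_eq_add_neg, ← neg_div]
  congr 1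
  ring

theorem IsViscSub.isViscSuper_of_neg (h : IsViscSub s fun x t => -u x t) : IsViscSuper s u := by
  obtain ⟨⟨M, hM⟩, husc, htest⟩ := h
  refine ⟨⟨M, fun x t ht => by simpa using hM x t ht⟩, ?_, ?_⟩
  · intro p hp c hc
    have := husc p hp (-c) (neg_lt_neg hc)
    exact this.mono fun q hq => neg_lt_neg_iff.1 hq
  intro x₀ t₀ R φ ht₀ hR hφ hstrict hout
  obtain ⟨hφ1, hφ2, Mφ, hφ3⟩ := hφ
  have := htest x₀ t₀ R (fun x t => -φ x t) ht₀ hR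
    ⟨hφ1.neg, uniformContinuous_neg.comp_uniformContinuousOn hφ2, Mφ,
      fun x t ht => by simpa using hφ3 x t ht⟩
    (fun x t h1 h2 => by linarith [hstrict x t h1 h2])
    (fun x t h1 => by linarith [hout x t h1])
  rw [gradient_neg] at this
  have hd : deriv (fun t => -φ x₀ t) t₀ = -deriv (fun t => φ x₀ t) t₀ := deriv.fun_neg
  rw [hd, infLapSup_neg s (fun x => φ x t₀)] at this
  refine ⟨fun hg => ?_, fun hg => ?_⟩
  · have h1 := this.1 (neg_ne_zero.2 hg)
    rw [infLap_neg s hg] at h1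
    linarith
  · have h1 := this.2 (neg_eq_zero.2 hg)
    linarith

end reflection

theorem tendsto_apply_of_locallyUniformly {n : ℕ} {w : ℕ → Space n → ℝ → ℝ} {u : Space n → ℝ → ℝ}
    (h : TendstoLocallyUniformlyOn (fun k (p : Space n × ℝ) => w k p.1 p.2)
      (fun p => u p.1 p.2) atTop (univ ×ˢ Ici 0)) (x : Space n) {t : ℝ} (ht : 0 ≤ t) :
    Tendsto (fun k => w k x t) atTop (𝓝 (u x t)) := by
  have h1 := h.tendsto_at (a := (x, t)) (mem_prod.2 ⟨mem_univ _, mem_Ici.2 ht⟩)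
  exact h1

/-! ### Equicontinuity, extraction of the limit, and the viscosity solution -/

section final
variable {n : ℕ} [Nonempty (Dir n)] {s : ℝ} {ε τ : ℕ → ℝ} {u₀ : Space n → ℝ}

/-- Any mollifier provides a modulus in time common to all parameters. Truncating time at `0`
extends the scheme to the whole of `ℝⁿ × ℝ`, where the compactness lemma applies. -/
theorem schemeInterp_equicontinuous (hs : 1 / 2 < s) (hs' : s < 1) (hu₀ : IsBUC u₀)
    (hc : ∀ k, IsCFL s (ε k) (τ k)) {e : ℝ} (he : 0 < e) :
    ∃ δ > 0, ∀ k (p q : Space n × ℝ), dist p q < δ →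
      |schemeInterp s (ε k) (τ k) u₀ p.1 (max p.2 0)
        - schemeInterp s (ε k) (τ k) u₀ q.1 (max q.2 0)| ≤ e := by
  obtain ⟨ρ, hρ⟩ := exists_isMollifier n
  obtain ⟨δ₁, hδ₁, h₁⟩ := modCont_tendsto hu₀.2 (e / 2) (by positivity)
  obtain ⟨-, hmono, hlim⟩ := timeMod_isModulus s ρ hu₀
  obtain ⟨r, hr, hr0⟩ := ((hlim.eventually_le_const (by positivity : 0 < e / 2)).and
    self_mem_nhdsWithin).exists
  refine ⟨min δ₁ r, by positivity, fun k p q hpq => ?_⟩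
  rw [Prod.dist_eq, max_lt_iff, lt_min_iff, lt_min_iff, dist_eq_norm, Real.dist_eq] at hpq
  have hp : 0 ≤ max p.2 0 := le_max_right _ _
  have hq : 0 ≤ max q.2 0 := le_max_right _ _
  have ht : |max p.2 0 - max q.2 0| ≤ r :=
    (abs_max_sub_max_le_abs p.2 q.2 0).trans hpq.2.2.le
  have h2 : |schemeInterp s (ε k) (τ k) u₀ p.1 (max p.2 0)
      - schemeInterp s (ε k) (τ k) u₀ p.1 (max q.2 0)| ≤ e / 2 :=
    ((abs_schemeInterp_sub_le_timeMod hs hs' (hc k) hρ hu₀ hp hq p.1).trans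
      (hmono (mem_Ici.2 (abs_nonneg _)) hr0.le ht)).trans hr
  have h3 := abs_schemeInterp_translate_le (by linarith) hs' (hc k) hu₀ hq (y := p.1 - q.1)
    (c := e / 2) (fun x => le_trans
      (by
        have := abs_sub_le_modCont hu₀.abs_le_supNorm (x := x + (p.1 - q.1)) (y := x) (r := δ₁)
          (by rw [add_sub_cancel_left]; exact hpq.1.1.le)
        exact this) (h₁ δ₁ le_rfl)) q.1
  rw [add_sub_cancel] at h3
  have := abs_sub_le (schemeInterp s (ε k) (τ k) u₀ p.1 (max p.2 0))
    (schemeInterp s (ε k) (τ k) u₀ p.1 (max q.2 0))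
    (schemeInterp s (ε k) (τ k) u₀ q.1 (max q.2 0))
  linarith

theorem schemeInterp_continuousOn (hs : 1 / 2 < s) (hs' : s < 1) (hu₀ : IsBUC u₀)
    (hc : ∀ k, IsCFL s (ε k) (τ k)) (k : ℕ) :
    ContinuousOn (fun p : Space n × ℝ => schemeInterp s (ε k) (τ k) u₀ p.1 p.2)
      (univ ×ˢ Ici 0) := by
  have h : Continuous fun p : Space n × ℝ =>
      schemeInterp s (ε k) (τ k) u₀ p.1 (max p.2 0) := by
    rw [Metric.continuous_iff]
    intro p e he
    obtain ⟨δ, hδ, h⟩ := schemeInterp_equicontinuous hs hs' hu₀ hc (half_pos he)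
    exact ⟨δ, hδ, fun q hq => (h k q p hq).trans_lt (half_lt_self he)⟩
  refine h.continuousOn.congr fun p hp => ?_
  simp only
  rw [max_eq_left hp.2]

theorem exists_subseq_scheme (hs : 1 / 2 < s) (hs' : s < 1) (hu₀ : IsBUC u₀)
    (hc : ∀ k, IsCFL s (ε k) (τ k)) :
    ∃ (κ : ℕ → ℕ) (u : Space n → ℝ → ℝ), StrictMono κ ∧
      TendstoLocallyUniformlyOn
        (fun k (p : Space n × ℝ) => schemeInterp s (ε (κ k)) (τ (κ k)) u₀ p.1 p.2)
        (fun p => u p.1 p.2) atTop (univ ×ˢ Ici 0) := by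
  obtain ⟨κ, u, hκ, hu⟩ := exists_subseq_tendstoLocallyUniformly (X := Space n × ℝ)
    (F := fun k p => schemeInterp s (ε k) (τ k) u₀ p.1 (max p.2 0)) (M := supNorm u₀)
    (fun k p => abs_schemeInterp_le (by linarith) hs' (hc k) hu₀ hu₀.abs_le_supNorm
      (le_max_right _ _) p.1) fun e he => schemeInterp_equicontinuous hs hs' hu₀ hc he
  refine ⟨κ, fun x t => u (x, t), hκ, hu.tendstoLocallyUniformlyOn.congr fun k p hp => ?_⟩
  simp only
  rw [max_eq_left hp.2]

theorem limit_isViscSol {M : ℝ} {u : Space n → ℝ → ℝ} (hs : 1 / 2 < s) (hs' : s < 1)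
    (hu₀ : IsBUC u₀) (hc : ∀ k, IsCFL s (ε k) (τ k)) (hε0 : Tendsto ε atTop (𝓝 0))
    (hconv : TendstoLocallyUniformlyOn
      (fun k (p : Space n × ℝ) => schemeInterp s (ε k) (τ k) u₀ p.1 p.2)
      (fun p => u p.1 p.2) atTop (univ ×ˢ Ici 0))
    (huM : ∀ x t, 0 ≤ t → |u x t| ≤ M) (hu₀M : ∀ x, |u₀ x| ≤ M) : IsViscSol s u₀ u := by
  have hwc := schemeInterp_continuousOn hs hs' hu₀ hc
  refine ⟨⟨hconv.continuousOn (Eventually.of_forall hwc).frequently, M, huM⟩,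
    isViscSub_of_tendsto hs hs' hu₀ hc hε0 hconv hwc huM hu₀M,
    IsViscSub.isViscSuper_of_neg ?_, fun x => ?_⟩
  -- The scheme started from `-u₀` is the negative of the scheme, so `-u` is a limit of the same
  -- kind and hence a subsolution.
  · have hneg : IsBUC fun x => -u₀ x := ⟨⟨M, fun x => by simpa using hu₀M x⟩, hu₀.2.neg⟩
    refine isViscSub_of_tendsto hs hs' hneg hc hε0 ?_
      (schemeInterp_continuousOn hs hs' hneg hc) (M := M) (fun x t ht => by simpa using huM x t ht)
      (fun x => by simpa using hu₀M x)
    have := uniformContinuous_neg.comp_tendstoLocallyUniformlyOn hconv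
    refine this.congr fun k p hp => ?_
    exact (schemeInterp_neg (by linarith) hs' (hc k) hu₀ p.1 p.2).symm
  · have h := tendsto_apply_of_locallyUniformly hconv x le_rfl
    refine tendsto_nhds_unique h (tendsto_const_nhds.congr fun k => ?_)
    exact (schemeInterp_zero (hc k).2.1 x).symm

end final

end InfFracLap

end

open Set Filter Topology MeasureTheory InfFracLap

theorem theorem2p2 (s : ℝ) (hs : 1 / 2 < s) (hs' : s < 1) :
    -- the constant `c` depends only on `s`
    ∃ c : ℝ, 0 < c ∧ ∀ (n : ℕ), 2 ≤ n → ∀ u₀ : Space n → ℝ, IsBUC u₀ →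
    -- the parameters of the scheme tend to zero under the stability condition
    ∀ ε τ : ℕ → ℝ, (∀ k, IsCFL s (ε k) (τ k)) → Tendsto ε atTop (𝓝 0) →
    ∃ (κ : ℕ → ℕ) (u : Space n → ℝ → ℝ), StrictMono κ ∧
      TendstoLocallyUniformlyOn
        (fun k (p : Space n × ℝ) => schemeInterp s (ε (κ k)) (τ (κ k)) u₀ p.1 p.2)
        (fun p => u p.1 p.2) atTop (univ ×ˢ Ici 0) ∧
      IsViscSol s u₀ u ∧
      (∀ t, 0 < t → supNorm (fun x => u x t) ≤ supNorm u₀) ∧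
      (∀ y t, 0 < t → supNorm (fun x => u (x + y) t - u x t) ≤ modCont u₀ ‖y‖) ∧
      ∀ ρ : Space n → ℝ, IsMollifier ρ →
        -- the suprema in the definition of `timeMod` are finite
        (∀ δ, 0 < δ → ∃ K, ∀ e, 0 < e → ∀ x, |truncLap s e (mollify ρ δ u₀) x| ≤ K) ∧
        (∀ t t', 0 < t → 0 < t' →
          supNorm (fun x => u x t - u x t') ≤ timeMod s ρ u₀ |t - t'|) ∧
        IsModulus (timeMod s ρ u₀) ∧
        (∀ r, 0 ≤ r → timeMod s ρ u₀ r ≤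
          2 * modCont u₀ (r ^ (1 / 3 : ℝ)) + timeConst c s ρ u₀ * (r ^ (1 / 3 : ℝ) + r)) ∧
        ∀ t t', 0 < t → 0 < t' → supNorm (fun x => u x t - u x t') ≤
          modCont u₀ (|t - t'| ^ (1 / 3 : ℝ))
            + timeConst c s ρ u₀ * (|t - t'| ^ (1 / 3 : ℝ) + |t - t'|) := by
  have hs0 : 0 < s := by linarith
  -- The bound on `timeMod` needs only `lapConst s`; the factor `4` is for the sharper estimate
  -- through the midrange.
  refine ⟨4 * lapConst s, mul_pos four_pos (lapConst_pos hs hs'),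
    fun n hn u₀ hu₀ ε τ hc hε0 => ?_⟩
  have hne := dir_nonempty hn
  obtain ⟨κ, u, hκ, hconv⟩ := exists_subseq_scheme hs hs' hu₀ hc
  have hc' : ∀ k, IsCFL s (ε (κ k)) (τ (κ k)) := fun k => hc (κ k)
  have hpt : ∀ x t, 0 ≤ t →
      Tendsto (fun k => schemeInterp s (ε (κ k)) (τ (κ k)) u₀ x t) atTop (𝓝 (u x t)) :=
    fun x t ht => by
      have h := tendsto_apply_of_locallyUniformly hconv x ht
      exact h
  have huM : ∀ x t, 0 ≤ t → |u x t| ≤ supNorm u₀ := fun x t ht =>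
    le_of_tendsto (hpt x t ht).abs (Eventually.of_forall fun k =>
      abs_schemeInterp_le hs0 hs' (hc' k) hu₀ hu₀.abs_le_supNorm ht x)
  refine ⟨κ, u, hκ, hconv,
    limit_isViscSol hs hs' hu₀ hc' (hε0.comp hκ.tendsto_atTop) hconv huM hu₀.abs_le_supNorm,
    fun t ht => supNorm_le fun x => huM x t ht.le, fun y t ht => supNorm_le fun x => ?_,
    fun ρ hρ => ⟨fun δ hδ => ⟨_, fun e he x =>
      abs_truncLap_mollify_le_iSup hs hs' hρ hu₀ hδ he x⟩,
      fun t t' ht ht' => supNorm_le fun x => ?_, timeMod_isModulus s ρ hu₀, fun r hr => ?_,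
      fun t t' ht ht' => supNorm_le fun x => ?_⟩⟩
  · refine le_of_tendsto ((hpt (x + y) t ht.le).sub (hpt x t ht.le)).abs
      (Eventually.of_forall fun k => ?_)
    exact abs_schemeInterp_translate_le hs0 hs' (hc' k) hu₀ ht.le (fun z =>
      (abs_diff_le_supNorm hu₀.abs_le_supNorm z y).trans
        (supNorm_diff_le_modCont hu₀.abs_le_supNorm le_rfl)) x
  · exact le_of_tendsto ((hpt x t ht.le).sub (hpt x t' ht'.le)).abs
      (Eventually.of_forall fun k =>
        abs_schemeInterp_sub_le_timeMod hs hs' (hc' k) hρ hu₀ ht.le ht'.le x)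
  · refine (timeMod_le_third hs hs' hρ hu₀ hr).trans ?_
    have := timeConst_mono (s := s) (u := u₀) hρ
      (by linarith [lapConst_pos hs hs'] : lapConst s ≤ 4 * lapConst s)
    gcongr
  · exact le_of_tendsto ((hpt x t ht.le).sub (hpt x t' ht'.le)).abs
      (Eventually.of_forall fun k =>
        abs_schemeInterp_sub_le_third hs hs' (hc' k) hρ hu₀ ht.le ht'.le x)
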